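/- **Setting.** Let $A\in\mathbb R^{m\times n}$ be a nonnegative matrix whose smallest nonzero entry equals $1$ and that has no zero column; let $\rho$ be its largest entry. For $\alpha\ge 0$ put $f_\alpha(t)=t^{1-\alpha}/(1-\alpha)$ if $\alpha\ne1$ and $f_1(t)=\log t$ (with $f_\alpha(0)=-\infty$ if $\alpha\ge1$), and $f_\alpha(x)=\sum_{j=1}^n f_\alpha(x_j)$. The $\alpha$-fair packing problem is $$\max\{f_\alpha(x):\ Ax\le \mathbf 1,\ x\ge 0\}.$$ Let $0<\epsilon\le 1/2$ with $\epsilon\le 1/(10|\alpha-1|)$ if $\alpha\neq 1$. Put $\beta=\frac{\epsilon/4}{(1+\alpha)\log(4mn\rho/\epsilon)}$, $C=(1+\epsilon/2)^{1/\beta}$; $F_\alpha(x)_j=x_j^{1/(1-\alpha)}$ and $\hat f_\alpha(x)=\frac1{1-\alpha}\sum_j x_j$ if $\alpha\ne1$, $F_1(x)_j=e^{x_j}$ and $\hat f_1(x)=\sum_jx_j$; and $$f_r(x)=-\hat f_\alpha(x)+\tfrac{C\beta}{1+\beta}\sum_{i=1}^m (AF_\alpha(x))_i^{(1+\beta)/\beta}.$$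 With $g_j(x)=(1-\alpha)\,\partial_jf_r(x)$ if $\alpha\ne1$ and $g_j(x)=\partial_jf_r(x)$ if $\alpha=1$, let $\overline{\nabla_j f}_r(x)=g_j(x)$ if $g_j(x)\in[-1,1]$ and $\overline{\nabla_j f}_r(x)=1$ otherwise. **The algorithm FairPacking.** Start from $x^{(0)}$ with $F_\alpha(x^{(0)})=\frac{1-\epsilon}{n\rho}\mathbf 1$. For $k=1,\dots,K$: - if $\alpha<1$: with $z^{(0)}=(e^{\epsilon/4}-1)\mathbf 1$, $\beta'=\frac{(1-\alpha)\epsilon/4}{\log(n\rho/(1-\epsilon))}$, $h=\frac{(1-\alpha)\beta\beta'}{16\epsilon(1+\alpha\beta)}$, set $x^{(k)}=(\mathbf 1+z^{(k-1)})^{-1/\beta'}$ and $z^{(k)}=z^{(k-1)}+\epsilon h\overline{\nabla f}_r(x^{(k)})$; here $K=\lceil 2/((1-\alpha)h\epsilon)\rceil$; - if $\alpha=1$: $x^{(k)}=x^{(k-1)}-\frac{\beta}{4(1+\beta)}\overline{\nabla f}_r(x^{(k-1)})$; here $K=\lceil 10\log^2(8\rho mn/\epsilon)/(\epsilon\beta)\rceil$;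 - if $\alpha>1$: $x^{(k)}_j=\bigl(1-\frac{\beta(1-\alpha)}{4(1+\alpha\beta)}\overline{\nabla_j f}_r(x^{(k-1)})\bigr)x_j^{(k-1)}$; here, with $\mu=\min\{\alpha-1,1\}$, $K=\lceil 800(1+\alpha)^2\log(n\rho/(\epsilon\mu))/(\beta\mu)\rceil$. Return $F_\alpha(x^{(K)})$. **Theorem.** The problem has an optimal solution $x^*$. The returned point $\hat x=F_\alpha(x^{(K)})$ is feasible, and for every optimal solution $x^*$ $$f_\alpha(x^*)-f_\alpha(\hat x)=O(\epsilon_f),\qquad \epsilon_f=\begin{cases}\epsilon n,&\alpha=1,\\ \epsilon(1-\alpha)f_\alpha(x^*),&\alpha\ne1.\end{cases}$$ The number of iterations satisfies: - if $\alpha\in[0,1)$ and $n\rho\ge2$: $K=O\bigl(\frac{\log(n\rho)\log(mn\rho/\epsilon)}{(1-\alpha)^3\epsilon^2}\bigr)$; - if $\alpha=1$: $K=O\bigl(\frac{\log^3(mn\rho/\epsilon)}{\epsilon^2}\bigr)$; - if $\alpha>1$: $F_\alpha(x^{(k)})$ is feasible with $f_\alpha(x^*)-f_\alpha(F_\alpha(x^{(k)}))=O(\epsilon_f)$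 as soon as $k$ is at least a bound of the order $$O\Bigl(\max\Bigl\{\frac{\alpha^3\log(n\rho/\epsilon)\log(mn\rho/\epsilon)}{\epsilon},\ \frac{\log(\frac1{\epsilon(\alpha-1)})\log(mn\rho/\epsilon)}{\epsilon(\alpha-1)}\Bigr\}\Bigr),$$ and the prescribed number satisfies $K=O\bigl(\frac{\alpha^3\log(n\rho/(\epsilon\mu))\log(mn\rho/\epsilon)}{\epsilon\mu}\bigr)$. Each iteration can be carried out with $O(\mathrm{nnz}(A))$ elementary real operations (arithmetic operations, powers, exponentials, comparisons), where $\mathrm{nnz}(A)$ is the number of nonzero entries of $A$, given in sparse form. All constants hidden in $O(\cdot)$ are absolute. -/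

import Mathlib

noncomputable section

namespace FairPacking

variable {m n : ℕ}

/-! ### The packing problem -/

/-- Constraint matrices in standard scaled form: the entries are nonnegative and the smallest
nonzero entry equals one. Every variable occurs in some constraint (otherwise the `α`-fair
packing problem has no optimal solution). -/
structure IsScaled (A : Matrix (Fin m) (Fin n) ℝ) : Prop where
  entry : ∀ i j, A i j = 0 ∨ 1 ≤ A i j
  exists_one : ∃ i j, A i j = 1
  column_ne_zero : ∀ j, ∃ i, A i j ≠ 0

/-- The width `ρ`: the largest entry (the smallest nonzero entry being one). -/
def width (A : Matrix (Fin m) (Fin n) ℝ) : ℝ := ⨆ p : Fin m × Fin n, A p.1 p.2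

/-- The number of nonzero entries. -/
def nnz (A : Matrix (Fin m) (Fin n) ℝ) : ℕ :=
  (Finset.univ.filter fun p : Fin m × Fin n => A p.1 p.2 ≠ 0).card

/-- The `α`-fair utility of a share `x ≥ 0`; it is `-∞` at `x = 0` when `α ≥ 1`. -/
def utility (α x : ℝ) : EReal :=
  if 1 ≤ α ∧ x = 0 then ⊥
  else if α = 1 then ((Real.log x : ℝ) : EReal)
  else ((x ^ (1 - α) / (1 - α) : ℝ) : EReal)

/-- The objective `f_α(x) = ∑ j, f_α(x j)`. -/
def objective (α : ℝ) (x : Fin n → ℝ) : EReal := ∑ j, utility α (x j)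

/-- `A x ≤ 1`, `x ≥ 0`. -/
def IsFeasible (A : Matrix (Fin m) (Fin n) ℝ) (x : Fin n → ℝ) : Prop :=
  (∀ i, A.mulVec x i ≤ 1) ∧ ∀ j, 0 ≤ x j

/-- `x` maximizes the `α`-fair objective over the feasible points. -/
def IsOptimal (A : Matrix (Fin m) (Fin n) ℝ) (α : ℝ) (x : Fin n → ℝ) : Prop :=
  IsFeasible A x ∧ ∀ u, IsFeasible A u → objective α u ≤ objective α x

/-! ### The regularized objective -/

/-- The change of variables `F_α`. -/
def transform (α : ℝ) (x : Fin n → ℝ) : Fin n → ℝ := fun j =>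
  if α = 1 then Real.exp (x j) else x j ^ (1 / (1 - α))

/-- `β = (ε/4) / ((1+α) log (4mnρ/ε))`. -/
def beta (A : Matrix (Fin m) (Fin n) ℝ) (ε α : ℝ) : ℝ :=
  (ε / 4) / ((1 + α) * Real.log (4 * m * n * width A / ε))

/-- `C = (1+ε/2)^(1/β)`. -/
def penalty (A : Matrix (Fin m) (Fin n) ℝ) (ε α : ℝ) : ℝ :=
  (1 + ε / 2) ^ (1 / beta A ε α)

/-- The objective in the new variables: `⟨1, x⟩ / (1-α)`, or `⟨1, x⟩` if `α = 1`. -/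
def linearObjective (α : ℝ) (x : Fin n → ℝ) : ℝ :=
  if α = 1 then ∑ j, x j else (∑ j, x j) / (1 - α)

/-- `f_r(x) = -f̂_α(x) + (C β / (1+β)) ∑ i, (A F_α(x))_i ^ ((1+β)/β)`. -/
def regularized (A : Matrix (Fin m) (Fin n) ℝ) (ε α : ℝ) (x : Fin n → ℝ) : ℝ :=
  -linearObjective α x +
    penalty A ε α * beta A ε α / (1 + beta A ε α) *
      ∑ i, A.mulVec (transform α x) i ^ ((1 + beta A ε α) / beta A ε α)

/-- Partial derivative of a function of `n` real variables. -/
def partialDeriv (f : (Fin n → ℝ) → ℝ) (j : Fin n) (x : Fin n → ℝ) : ℝ :=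
  deriv (fun t => f (Function.update x j t)) (x j)

/-- The truncated scaled gradient of `f_r`: the scaling factor is `1-α`, or `1` if `α = 1`. -/
def truncGrad (A : Matrix (Fin m) (Fin n) ℝ) (ε α : ℝ) (x : Fin n → ℝ) : Fin n → ℝ := fun j =>
  let g := (if α = 1 then 1 else 1 - α) * partialDeriv (regularized A ε α) j x
  if -1 ≤ g ∧ g ≤ 1 then g else 1

/-! ### The algorithm -/

/-- `β' = (1-α)(ε/4) / log (nρ/(1-ε))`, used for `α < 1`. -/
def betaDual (A : Matrix (Fin m) (Fin n) ℝ) (ε α : ℝ) : ℝ :=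
  (1 - α) * (ε / 4) / Real.log (n * width A / (1 - ε))

/-- `h = (1-α) β β' / (16 ε (1+αβ))`, used for `α < 1`. -/
def stepSize (A : Matrix (Fin m) (Fin n) ℝ) (ε α : ℝ) : ℝ :=
  (1 - α) * beta A ε α * betaDual A ε α / (16 * ε * (1 + α * beta A ε α))

/-- The state of the main loop: the iterate `x` and the vector `z` (which only the regime `α < 1`
uses). -/
@[ext] structure State (n : ℕ) where
  x : Fin n → ℝ
  z : Fin n → ℝ

/-- Initialization: `F_α(x⁽⁰⁾) = (1-ε)/(nρ)` in every coordinate, and `z⁽⁰⁾ = exp(ε/4) - 1`. -/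
def init (A : Matrix (Fin m) (Fin n) ℝ) (ε α : ℝ) : State n where
  x := fun _ => if α = 1 then Real.log ((1 - ε) / (n * width A))
    else ((1 - ε) / (n * width A)) ^ (1 - α)
  z := fun _ => Real.exp (ε / 4) - 1

/-- The body of the main loop. -/
def step (A : Matrix (Fin m) (Fin n) ℝ) (ε α : ℝ) (s : State n) : State n :=
  if α < 1 then
    let x' : Fin n → ℝ := fun j => (1 + s.z j) ^ (-1 / betaDual A ε α)
    { x := x'
      z := fun j => s.z j + ε * stepSize A ε α * truncGrad A ε α x' j }
  else if α = 1 then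
    { x := fun j => s.x j - beta A ε α / (4 * (1 + beta A ε α)) * truncGrad A ε α s.x j
      z := s.z }
  else
    { x := fun j => (1 - beta A ε α * (1 - α) * truncGrad A ε α s.x j /
        (4 * (1 + α * beta A ε α))) * s.x j
      z := s.z }

/-- The state after `k` passes through the loop. -/
def state (A : Matrix (Fin m) (Fin n) ℝ) (ε α : ℝ) (k : ℕ) : State n :=
  (step A ε α)^[k] (init A ε α)

/-- The solution `F_α(x⁽ᵏ⁾)` held after `k` iterations. -/
def solution (A : Matrix (Fin m) (Fin n) ℝ) (ε α : ℝ) (k : ℕ) : Fin n → ℝ :=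
  transform α (state A ε α k).x

/-- The number `K` of iterations that the algorithm performs. -/
def iterations (A : Matrix (Fin m) (Fin n) ℝ) (ε α : ℝ) : ℕ :=
  if α < 1 then ⌈2 / ((1 - α) * stepSize A ε α * ε)⌉₊
  else if α = 1 then
    ⌈10 * Real.log (8 * width A * m * n / ε) ^ 2 / (ε * beta A ε α)⌉₊
  else
    ⌈800 * ((1 + α) ^ 2 * Real.log (n * width A / (ε * min (α - 1) 1))) /
      (beta A ε α * min (α - 1) 1)⌉₊

/-- The point returned by the algorithm. -/
def output (A : Matrix (Fin m) (Fin n) ℝ) (ε α : ℝ) : Fin n → ℝ :=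
  solution A ε α (iterations A ε α)

/-! ### Work per iteration

A real-number random access machine: programs are built from unit-cost operations on real numbers
and from loops, which cost one further unit per pass. The matrix is given in sparse form, by the
list of its nonzero rows and by the supports of its rows and columns. -/

/-- A value together with the number of elementary operations spent on computing it. -/
structure Timed (τ : Type) where
  val : τ
  ops : ℕ

namespace Timed

instance : Monad Timed where
  pure a := ⟨a, 0⟩
  bind a f := ⟨(f a.val).val, a.ops + (f a.val).ops⟩

def add (a b : ℝ) : Timed ℝ := ⟨a + b, 1⟩
def sub (a b : ℝ) : Timed ℝ := ⟨a - b, 1⟩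
def mul (a b : ℝ) : Timed ℝ := ⟨a * b, 1⟩
def pow (a b : ℝ) : Timed ℝ := ⟨a ^ b, 1⟩
def exp (a : ℝ) : Timed ℝ := ⟨Real.exp a, 1⟩
def le (a b : ℝ) : Timed Bool := ⟨decide (a ≤ b), 1⟩

/-- Loop over `s` that accumulates a sum. -/
def sumOver {ι : Type} (s : Finset ι) (f : ι → Timed ℝ) : Timed ℝ :=
  ⟨∑ i ∈ s, (f i).val, ∑ i ∈ s, ((f i).ops + 1)⟩

open Classical in
/-- Loop over `s` that fills an array (whose other cells hold zero). -/
def arrayOver {ι : Type} (s : Finset ι) (f : ι → Timed ℝ) : Timed (ι → ℝ) :=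
  ⟨fun i => if i ∈ s then (f i).val else 0, ∑ i ∈ s, ((f i).ops + 1)⟩

end Timed

def rowSupport (A : Matrix (Fin m) (Fin n) ℝ) (i : Fin m) : Finset (Fin n) :=
  Finset.univ.filter fun j => A i j ≠ 0

def colSupport (A : Matrix (Fin m) (Fin n) ℝ) (j : Fin n) : Finset (Fin m) :=
  Finset.univ.filter fun i => A i j ≠ 0

def nonzeroRows (A : Matrix (Fin m) (Fin n) ℝ) : Finset (Fin m) :=
  Finset.univ.filter fun i => (rowSupport A i).Nonempty

/-- Program for the truncated gradient at `x`. The scalars `β`, `C` and the exponents have been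
computed once and for all. -/
def truncGradProgram (A : Matrix (Fin m) (Fin n) ℝ) (ε α : ℝ) (x : Fin n → ℝ) :
    Timed (Fin n → ℝ) := do
  let v ← Timed.arrayOver Finset.univ fun j =>
    if α = 1 then Timed.exp (x j) else Timed.pow (x j) (1 / (1 - α))
  let y ← Timed.arrayOver (nonzeroRows A) fun i => do
    let r ← Timed.sumOver (rowSupport A i) fun j => Timed.mul (A i j) (v j)
    let p ← Timed.pow r (1 / beta A ε α)
    Timed.mul (penalty A ε α) p
  Timed.arrayOver Finset.univ fun j => do
    let t ← Timed.sumOver (colSupport A j) fun i => Timed.mul (A i j) (y i)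
    let w ← if α = 1 then Timed.exp (x j) else Timed.pow (x j) (α / (1 - α))
    let p ← Timed.mul w t
    let g ← Timed.sub p 1
    let lower ← Timed.le (-1) g
    let upper ← Timed.le g 1
    return if lower && upper then g else 1

/-- Program for the body of the main loop. -/
def stepProgram (A : Matrix (Fin m) (Fin n) ℝ) (ε α : ℝ) (s : State n) : Timed (State n) :=
  if α < 1 then do
    let x' ← Timed.arrayOver Finset.univ fun j => do
      let a ← Timed.add 1 (s.z j)
      Timed.pow a (-1 / betaDual A ε α)
    let g ← truncGradProgram A ε α x'
    let z' ← Timed.arrayOver Finset.univ fun j => do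
      let a ← Timed.mul (ε * stepSize A ε α) (g j)
      Timed.add (s.z j) a
    return { x := x', z := z' }
  else if α = 1 then do
    let g ← truncGradProgram A ε α s.x
    let x' ← Timed.arrayOver Finset.univ fun j => do
      let a ← Timed.mul (beta A ε α / (4 * (1 + beta A ε α))) (g j)
      Timed.sub (s.x j) a
    return { x := x', z := s.z }
  else do
    let g ← truncGradProgram A ε α s.x
    let x' ← Timed.arrayOver Finset.univ fun j => do
      let a ← Timed.mul (beta A ε α * (1 - α) / (4 * (1 + α * beta A ε α))) (g j)
      let b ← Timed.sub 1 a
      Timed.mul b (s.x j)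
    return { x := x', z := s.z }

/-! ### Accuracy -/

/-- `x` is feasible and, for every optimal `xopt`, `f_α(xopt) - f_α(x) ≤ c ε_f`, where
`ε_f = ε n` if `α = 1` and `ε_f = ε (1-α) f_α(xopt)` otherwise. -/
def IsApproxSolution (A : Matrix (Fin m) (Fin n) ℝ) (ε α c : ℝ) (x : Fin n → ℝ) : Prop :=
  IsFeasible A x ∧ ∀ xopt, IsOptimal A α xopt →
    objective α xopt - objective α x ≤
      if α = 1 then ((c * (ε * n) : ℝ) : EReal)
      else ((c * (ε * (1 - α)) : ℝ) : EReal) * objective α xopt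

end FairPacking

end

noncomputable section

namespace FairPacking

variable {m n : ℕ}

/-! ### Scalar inequalities -/

/-! Everything is done in the original variables `y = F_α(x)`. There the regularized objective is
`merit`, a convex barrier `congestion` minus the utility; the gradient of the barrier is the price
vector `p = Aᵀ λ` with shadow prices `λ i = C (A y)_i ^ (1/β)`, and the scaled partial derivative of
`f_r` is `t - 1` with `t = y_j ^ α p_j` (`partialDeriv_regularized`). As `t ≥ 0`, truncation only
acts above one. With `S = 4mnρ/ε`, the constants `β`, `C` make `λ i ≤ S⁻²` on rows with slack `ε`
and `λ i ≥ S^(1+α)` on rows with slack at most `ε/8`.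

In all three regimes a step multiplies `y_j` by `exp (-σ_j)` with `σ_j` of the sign of the truncated
gradient and of size `O(β)`. Jensen's inequality separates the barrier into coordinates
(`congestion_exp_le`), so that such a step decreases `merit` by a sum of terms `y_j ^ (1-α) *
progress t_j`, up to the step length (`merit_sub_le`). The function `progress` is quadratic near `t
= 1` and linear for large `t`; hence truncation costs nothing essential. Feasibility persists
(`isFeasible_step`): a row with slack cannot be filled in one step, and in a nearly tight row every
coordinate that is not tiny has `t ≥ 2`, so that it shrinks and outweighs the growth of the others.

The optimality gap is then compared with the progress. For `α > 1`, conjugacy of the utility bounds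
the gap by `∑ y_j ^ (1-α) progress t_j / min (α-1) 1` plus errors of relative size `ε`
(`merit_add_le`). A step thus removes a fixed fraction of the excess gap, and convergence is linear.
For `α = 1`, `merit` is convex in `log y`, and the logarithms stay in a range of length `O(log S)`.
The squared gap is at most a multiple of the decrease, which yields decay like `1/k`. For `α < 1`,
the iteration is mirror descent in `x = y ^ (1-α)` with dual variable `Z = 1 + z`. The quadratic
error of mirror descent and the truncation error are both dominated by `progress`, so their total is
paid for by the total decrease of `merit` (`sum_gap_le`). Since `merit` is monotone along the run,
the last iterate inherits the bound on the average. This needs `nρ ≥ 2`; otherwise `n = 1`, and the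
single coordinate is followed directly.

Points with slack `ε` have a negligible barrier, so a slightly shrunk optimum serves as comparator
when `α ≤ 1`. The work bound holds because each nonzero entry is visited twice per gradient and `n ≤
nnz A`. -/

/-- The truncation of `t - 1` at one. -/
def clip (t : ℝ) : ℝ := min (t - 1) 1

/-- The progress made along a coordinate whose scaled partial derivative is `t - 1`. -/
def progress (t : ℝ) : ℝ := if t ≤ 2 then (t - 1) ^ 2 else t

theorem clip_le_one (t : ℝ) : clip t ≤ 1 := min_le_right _ _

theorem neg_one_le_clip {t : ℝ} (ht : 0 ≤ t) : -1 ≤ clip t :=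
  le_min (by linarith) (by norm_num)

theorem abs_clip_le_one {t : ℝ} (ht : 0 ≤ t) : |clip t| ≤ 1 :=
  abs_le.2 ⟨neg_one_le_clip ht, clip_le_one t⟩

theorem clip_of_two_le {t : ℝ} (ht : 2 ≤ t) : clip t = 1 := min_eq_right (by linarith)

theorem clip_of_le_two {t : ℝ} (ht : t ≤ 2) : clip t = t - 1 := min_eq_left (by linarith)

theorem progress_nonneg {t : ℝ} : 0 ≤ progress t := by
  unfold progress
  split_ifs with h
  · positivity
  · linarith

/-- This and the next two inequalities dictate the shape of `progress`: it must dominate the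
second-order error of a step, the error caused by truncation, and, up to a constant, the marginal
itself. -/
theorem clip_sq_le_progress (t : ℝ) : clip t ^ 2 ≤ progress t := by
  unfold progress
  split_ifs with h
  · rw [clip_of_le_two h]
  · rw [clip_of_two_le (by linarith)]; linarith

theorem sub_one_sub_clip_le_progress (t : ℝ) : t - 1 - clip t ≤ progress t := by
  unfold progress
  split_ifs with h
  · rw [clip_of_le_two h]; nlinarith [sq_nonneg (t - 1)]
  · rw [clip_of_two_le (by linarith)]; linarith

theorem le_two_add_progress (t : ℝ) : t ≤ 2 + progress t := by
  unfold progress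
  split_ifs with h
  · nlinarith [sq_nonneg (t - 1)]
  · linarith

theorem exp_neg_le {w : ℝ} (hw : |w| ≤ 1) : Real.exp (-w) ≤ 1 - w + w ^ 2 := by
  have h := (abs_le.1 (Real.abs_exp_sub_one_sub_id_le (x := -w) (by rwa [abs_neg]))).2
  nlinarith

/-- Change of barrier minus change of utility along one coordinate, to be made negative. For `t ≤ 2`
the linear terms give `-κ (t-1)²` and the quadratic one at most `0.6 κ (t-1)²`; for `t > 2` one has
`κ ≤ κ t / 2`. The second case produces the factor `1/5`. -/
theorem mul_exp_neg_clip_le {κ t : ℝ} (hκ : 0 ≤ κ) (hκ' : κ ≤ 3 / 10) (ht : 0 ≤ t) :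
    t * (Real.exp (-(κ * clip t)) - 1) + κ * clip t ≤ -(κ * progress t) / 5 := by
  have hc := abs_clip_le_one ht
  have h := exp_neg_le (w := κ * clip t) (by
    rw [abs_mul, abs_of_nonneg hκ]; nlinarith [abs_nonneg (clip t)])
  have h2 := mul_le_mul_of_nonneg_left h ht
  unfold progress
  split_ifs with h1
  · rw [clip_of_le_two h1] at *
    have e : t * (κ * (t - 1)) ^ 2 ≤ 2 * (κ * (t - 1)) ^ 2 :=
      mul_le_mul_of_nonneg_right h1 (sq_nonneg _)
    have e2 : (κ * (t - 1)) ^ 2 ≤ 3 / 10 * (κ * (t - 1) ^ 2) := by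
      have : 0 ≤ κ * (t - 1) ^ 2 := by positivity
      nlinarith
    nlinarith
  · rw [clip_of_two_le (by linarith)] at *
    have e : t * κ ^ 2 ≤ 3 / 10 * (t * κ) := by
      have : 0 ≤ t * κ := by positivity
      nlinarith
    have : κ * 2 ≤ κ * t := by gcongr; linarith
    nlinarith

theorem log_one_add_le {u : ℝ} (hu : |u| ≤ 1 / 20) : Real.log (1 + u) ≤ u := by
  have := abs_le.1 hu
  linarith [Real.log_le_sub_one_of_pos (x := 1 + u) (by linarith)]

theorem le_log_one_add {u : ℝ} (hu : |u| ≤ 1 / 20) :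
    u - 11 / 10 * u ^ 2 ≤ Real.log (1 + u) := by
  have h := abs_le.1 hu
  have h0 : 0 < 1 + u := by linarith
  refine le_trans ?_ (Real.one_sub_inv_le_log_of_pos h0)
  have : 1 - (1 + u)⁻¹ = u / (1 + u) := by field_simp; ring
  rw [this, le_div_iff₀ h0]
  nlinarith [sq_nonneg u, mul_nonneg (sq_nonneg u) (by linarith : 0 ≤ 1 / 20 + u)]

/-- Turns an additive update of `x` or `Z` into an exponential step of `y` whose length is distorted
by at most a tenth. -/
theorem exists_log_one_add_eq_mul {u : ℝ} (hu : |u| ≤ 1 / 20) :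
    ∃ c : ℝ, 9 / 10 ≤ c ∧ c ≤ 11 / 10 ∧ Real.log (1 + u) = c * u := by
  rcases eq_or_ne u 0 with rfl | h0
  · exact ⟨1, by norm_num, by norm_num, by simp⟩
  have h1 := log_one_add_le hu
  have h2 := le_log_one_add hu
  have h := abs_le.1 hu
  refine ⟨Real.log (1 + u) / u, ?_, ?_, by field_simp⟩
  · rcases lt_or_gt_of_ne h0 with h3 | h3
    · rw [le_div_iff_of_neg h3]; nlinarith
    · rw [le_div_iff₀ h3]; nlinarith
  · rcases lt_or_gt_of_ne h0 with h3 | h3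
    · rw [div_le_iff_of_neg h3]; nlinarith
    · rw [div_le_iff₀ h3]; nlinarith

theorem abs_log_one_add_le {u : ℝ} (hu : |u| ≤ 1 / 20) : |Real.log (1 + u)| ≤ 11 / 10 * |u| := by
  obtain ⟨c, hc, hc', h⟩ := exists_log_one_add_eq_mul hu
  rw [h, abs_mul, abs_of_nonneg (by linarith)]
  gcongr

theorem one_add_rpow_neg_le {q v : ℝ} (hq : 0 < q) (hv : |v| ≤ 1 / 20) (hqv : q * |v| ≤ 1 / 4) :
    (1 + v) ^ (-q) ≤ 1 - q * v + 2 * q * (q + 1) * v ^ 2 := by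
  have h := abs_le.1 hv
  have h1 := abs_log_one_add_le hv
  have h2 := le_log_one_add hv
  have h3 : |q * Real.log (1 + v)| ≤ 11 / 10 * (q * |v|) := by
    rw [abs_mul, abs_of_pos hq]; nlinarith
  rw [Real.rpow_def_of_pos (by linarith), show Real.log (1 + v) * -q = -(q * Real.log (1 + v)) by ring]
  have h4 := exp_neg_le (w := q * Real.log (1 + v)) (by linarith)
  have h5 : (q * Real.log (1 + v)) ^ 2 ≤ (11 / 10 * (q * |v|)) ^ 2 := sq_le_sq' (by linarith [(abs_le.1 h3).1]) (abs_le.1 h3).2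
  have h6 : (11 / 10 * (q * |v|)) ^ 2 = 121 / 100 * (q ^ 2 * v ^ 2) := by
    rw [mul_pow, mul_pow, sq_abs]; ring
  have h7 := mul_le_mul_of_nonneg_left h2 hq.le
  have : 0 ≤ q * v ^ 2 := by positivity
  have : 0 ≤ q ^ 2 * v ^ 2 := by positivity
  nlinarith

/-- A sequence whose decrements dominate the squares of its terms decays harmonically. -/
theorem mul_le_of_sq_le_mul_sub {a : ℕ → ℝ} {M : ℝ} (hM : 0 ≤ M)
    (h : ∀ k, 0 ≤ a k → a k ^ 2 ≤ M * (a k - a (k + 1))) (hmono : ∀ k, a (k + 1) ≤ a k) (k : ℕ) :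
    a k * k ≤ M := by
  induction k with
  | zero => simpa using hM
  | succ k ih =>
    push_cast
    have hk : (0 : ℝ) ≤ k := k.cast_nonneg
    rcases lt_or_ge (a (k + 1)) 0 with h0 | h0
    · nlinarith
    have ha : 0 ≤ a k := h0.trans (hmono k)
    have h1 := h k ha
    have h2 := hmono k
    -- Either monotonicity alone suffices, or `a k * (k + 1) > M`, in which case `(M - a k) (k + 1)
    -- ≤ k M` and the induction hypothesis applies.
    rcases le_or_gt (a k * (k + 1)) M with h3 | h3
    · nlinarith
    · rcases ha.eq_or_lt with h4 | h4
      · rw [← h4] at h3; simp at h3; linarith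
      have hMpos : 0 < M := by
        rcases hM.eq_or_lt with h5 | h5
        · rw [← h5] at h1; nlinarith [pow_pos h4 2]
        · exact h5
      have h5 : a (k + 1) * M ≤ a k * M - a k ^ 2 := by linarith
      have h6 : a (k + 1) * (k + 1) * M ≤ (a k * M - a k ^ 2) * (k + 1) := by nlinarith
      have h7 : (a k * M - a k ^ 2) * (k + 1) ≤ a k * k * M := by nlinarith
      have h8 : a (k + 1) * (k + 1) * M ≤ M * M := by nlinarith
      exact le_of_mul_le_mul_right h8 hMpos

/-! ### Congestion and prices -/

/-- The prices `Aᵀ λ` for `λ i = C (A y)_i ^ (1/b)`. -/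
def price (A : Matrix (Fin m) (Fin n) ℝ) (b C : ℝ) (y : Fin n → ℝ) (j : Fin n) : ℝ :=
  ∑ i, A i j * (C * A.mulVec y i ^ (1 / b))

/-- The barrier of the regularized objective, as a function of the original variables. -/
def congestion (A : Matrix (Fin m) (Fin n) ℝ) (b C : ℝ) (y : Fin n → ℝ) : ℝ :=
  C * b / (1 + b) * ∑ i, A.mulVec y i ^ ((1 + b) / b)

/-- Weighted power-mean (Jensen) inequality, with unnormalized weights so that a zero row needs no
separate treatment. -/
theorem rpow_sum_mul_le {ι : Type*} (s : Finset ι) {p : ℝ} (hp : 1 ≤ p) {w r : ι → ℝ}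
    (hw : ∀ i, 0 ≤ w i) (hr : ∀ i, 0 ≤ r i) :
    (∑ i ∈ s, w i * r i) ^ p ≤ (∑ i ∈ s, w i) ^ (p - 1) * ∑ i ∈ s, w i * r i ^ p := by
  have hp0 : 0 < p := by linarith
  have h0 : 0 ≤ ∑ i ∈ s, w i := Finset.sum_nonneg fun i _ => hw i
  have h1 : 0 ≤ ∑ i ∈ s, w i * r i ^ p :=
    Finset.sum_nonneg fun i _ => mul_nonneg (hw i) (Real.rpow_nonneg (hr i) _)
  have h := Real.rpow_le_rpow (Finset.sum_nonneg fun i _ => mul_nonneg (hw i) (hr i))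
    (Real.inner_le_weight_mul_Lp_of_nonneg s hp w r hw hr) hp0.le
  refine h.trans (le_of_eq ?_)
  rw [Real.mul_rpow (Real.rpow_nonneg h0 _) (Real.rpow_nonneg h1 _), ← Real.rpow_mul h0,
    ← Real.rpow_mul h1, inv_mul_cancel₀ hp0.ne', Real.rpow_one]
  congr 2
  field_simp

section
variable {A : Matrix (Fin m) (Fin n) ℝ} {b C : ℝ} {y : Fin n → ℝ}

theorem mulVec_eq_sum (y : Fin n → ℝ) (i : Fin m) : A.mulVec y i = ∑ j, A i j * y j := rfl

theorem mulVec_nonneg (hA : ∀ i j, 0 ≤ A i j) (hy : ∀ j, 0 ≤ y j) (i : Fin m) :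
    0 ≤ A.mulVec y i :=
  mulVec_eq_sum (A := A) y i ▸ Finset.sum_nonneg fun j _ => mul_nonneg (hA i j) (hy j)

theorem price_nonneg (hA : ∀ i j, 0 ≤ A i j) (hC : 0 ≤ C) (hy : ∀ j, 0 ≤ y j) (j : Fin n) :
    0 ≤ price A b C y j :=
  Finset.sum_nonneg fun i _ =>
    mul_nonneg (hA i j) (mul_nonneg hC (Real.rpow_nonneg (mulVec_nonneg hA hy i) _))

theorem sum_mul_price (v : Fin n → ℝ) :
    ∑ j, v j * price A b C y j = ∑ i, C * A.mulVec y i ^ (1 / b) * A.mulVec v i := by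
  simp only [price, Finset.mul_sum, Matrix.mulVec, dotProduct]
  rw [Finset.sum_comm]
  refine Finset.sum_congr rfl fun i _ => Finset.sum_congr rfl fun j _ => ?_
  ring

theorem rpow_one_add_div {x : ℝ} (hb : 0 < b) (hx : 0 ≤ x) :
    x ^ ((1 + b) / b) = x ^ (1 / b) * x := by
  rw [add_div, div_self hb.ne', Real.rpow_add_one' hx (by positivity)]

theorem congestion_eq (hb : 0 < b) (hA : ∀ i j, 0 ≤ A i j) (hy : ∀ j, 0 ≤ y j) :
    congestion A b C y = b / (1 + b) * ∑ j, y j * price A b C y j := by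
  rw [sum_mul_price, congestion, mul_div_assoc, mul_comm C, mul_assoc, Finset.mul_sum]
  congr 1
  refine Finset.sum_congr rfl fun i _ => ?_
  rw [rpow_one_add_div hb (mulVec_nonneg hA hy i)]; ring

theorem congestion_nonneg (hb : 0 < b) (hA : ∀ i j, 0 ≤ A i j) (hC : 0 ≤ C)
    (hy : ∀ j, 0 ≤ y j) : 0 ≤ congestion A b C y :=
  mul_nonneg (by positivity) (Finset.sum_nonneg fun i _ => Real.rpow_nonneg (mulVec_nonneg hA hy i) _)

/-- A multiplicative step is majorized coordinatewise. -/
theorem congestion_exp_le (hb : 0 < b) (hA : ∀ i j, 0 ≤ A i j) (hC : 0 ≤ C) (hy : ∀ j, 0 ≤ y j)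
    {y' σ : Fin n → ℝ} (h : ∀ j, y' j = y j * Real.exp (-σ j)) :
    congestion A b C y' - congestion A b C y ≤
      b / (1 + b) * ∑ j, y j * price A b C y j * (Real.exp (-((1 + b) / b * σ j)) - 1) := by
  have key : congestion A b C y' ≤
      b / (1 + b) * ∑ j, y j * Real.exp (-((1 + b) / b * σ j)) * price A b C y j := by
    rw [sum_mul_price, congestion, mul_div_assoc, mul_comm C, mul_assoc, Finset.mul_sum]
    refine mul_le_mul_of_nonneg_left (Finset.sum_le_sum fun i _ => ?_) (by positivity)
    rw [mul_assoc]
    refine mul_le_mul_of_nonneg_left ?_ hC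
    have hp : 1 ≤ (1 + b) / b := by rw [le_div_iff₀ hb]; linarith
    -- Jensen on row `i` with weights `A i j * y j`: the exponent `(1+b)/b` moves from the row sum
    -- onto each factor `exp (-σ j)`.
    have := rpow_sum_mul_le Finset.univ hp (w := fun j => A i j * y j)
      (r := fun j => Real.exp (-σ j)) (fun j => mul_nonneg (hA i j) (hy j))
      (fun j => (Real.exp_pos _).le)
    have e : (1 + b) / b - 1 = 1 / b := by field_simp; ring
    rw [e] at this
    have e1 (j) : Real.exp (-σ j) ^ ((1 + b) / b) = Real.exp (-((1 + b) / b * σ j)) := by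
      rw [← Real.exp_mul]; ring_nf
    simp only [e1, mul_assoc] at this
    simpa only [mulVec_eq_sum, h] using this
  rw [congestion_eq hb hA hy]
  have e : ∑ j, y j * price A b C y j * (Real.exp (-((1 + b) / b * σ j)) - 1) =
      ∑ j, y j * Real.exp (-((1 + b) / b * σ j)) * price A b C y j -
        ∑ j, y j * price A b C y j := by
    rw [← Finset.sum_sub_distrib]
    exact Finset.sum_congr rfl fun j _ => by ring
  rw [e, mul_sub]
  linarith

/-- The tangent inequality of a convex function; row by row it is Young's inequality for the
conjugate exponents `(1+b)/b` and `1+b`. -/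
theorem congestion_add_le (hb : 0 < b) (hA : ∀ i j, 0 ≤ A i j) (hC : 0 ≤ C) (hy : ∀ j, 0 ≤ y j)
    {v : Fin n → ℝ} (hv : ∀ j, 0 ≤ v j) :
    congestion A b C y + ∑ j, price A b C y j * (v j - y j) ≤ congestion A b C v := by
  have e : ∑ j, price A b C y j * (v j - y j) =
      ∑ j, v j * price A b C y j - ∑ j, y j * price A b C y j := by
    rw [← Finset.sum_sub_distrib]
    exact Finset.sum_congr rfl fun j _ => by ring
  rw [e, congestion_eq hb hA hy, sum_mul_price, sum_mul_price, congestion, Finset.mul_sum,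
    Finset.mul_sum, ← Finset.sum_sub_distrib, ← Finset.sum_add_distrib]
  refine Finset.sum_le_sum fun i _ => ?_
  have h1 := mulVec_nonneg hA hy i
  have h2 := mulVec_nonneg hA hv i
  have hpq : ((1 + b) / b).HolderConjugate (1 + b) := by
    constructor <;> first | positivity | (field_simp; ring)
  have hy' := Real.young_inequality_of_nonneg h2 (Real.rpow_nonneg h1 (1 / b)) hpq
  rw [← Real.rpow_mul h1, show 1 / b * (1 + b) = (1 + b) / b by ring, rpow_one_add_div hb h1] at hy'
  have e2 : A.mulVec v i ^ ((1 + b) / b) / ((1 + b) / b) = b / (1 + b) * A.mulVec v i ^ ((1 + b) / b) := by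
    field_simp
  rw [e2] at hy'
  have := mul_le_mul_of_nonneg_left hy' hC
  have e3 : C * (b / (1 + b) * A.mulVec v i ^ ((1 + b) / b) +
      A.mulVec y i ^ (1 / b) * A.mulVec y i / (1 + b)) = C * b / (1 + b) * A.mulVec v i ^ ((1 + b) / b)
      + C * A.mulVec y i ^ (1 / b) * A.mulVec y i * (1 / (1 + b)) := by ring
  have e4 : b / (1 + b) = 1 - 1 / (1 + b) := by field_simp; ring
  rw [e3] at this
  rw [e4]
  nlinarith

end

/-! ### Descent of the regularized objective -/

/-- The real-valued `α`-fair utility. -/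
def fair (α v : ℝ) : ℝ := if α = 1 then Real.log v else v ^ (1 - α) / (1 - α)

/-- The ratio of the price of a coordinate to its marginal utility. -/
def marginal (A : Matrix (Fin m) (Fin n) ℝ) (b C α : ℝ) (y : Fin n → ℝ) (j : Fin n) : ℝ :=
  y j ^ α * price A b C y j

/-- The regularized objective as a function of the original variables. -/
def merit (A : Matrix (Fin m) (Fin n) ℝ) (b C α : ℝ) (y : Fin n → ℝ) : ℝ :=
  congestion A b C y - ∑ j, fair α (y j)

section
variable {A : Matrix (Fin m) (Fin n) ℝ} {b C α : ℝ} {y : Fin n → ℝ}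

theorem marginal_nonneg (hA : ∀ i j, 0 ≤ A i j) (hC : 0 ≤ C) (hy : ∀ j, 0 ≤ y j) (j : Fin n) :
    0 ≤ marginal A b C α y j :=
  mul_nonneg (Real.rpow_nonneg (hy j) _) (price_nonneg hA hC hy j)

theorem mul_price_eq (hy : ∀ j, 0 < y j) (j : Fin n) :
    y j * price A b C y j = y j ^ (1 - α) * marginal A b C α y j := by
  rw [marginal, ← mul_assoc, ← Real.rpow_add (hy j), sub_add_cancel, Real.rpow_one]

theorem congestion_eq_sum_marginal (hb : 0 < b) (hA : ∀ i j, 0 ≤ A i j) (hy : ∀ j, 0 < y j) :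
    congestion A b C y = b / (1 + b) * ∑ j, y j ^ (1 - α) * marginal A b C α y j := by
  rw [congestion_eq hb hA fun j => (hy j).le]
  simp only [mul_price_eq (α := α) hy]

/-- The descent estimate common to all regimes. The vector `e` absorbs the second-order loss of the
utility along a multiplicative step; it vanishes for `α ≤ 1` and must be beaten by the progress term
for `α > 1`. -/
theorem merit_sub_le (hb : 0 < b) (hA : ∀ i j, 0 ≤ A i j) (hC : 0 ≤ C) (hy : ∀ j, 0 < y j)
    {y' σ κ e : Fin n → ℝ} (h : ∀ j, y' j = y j * Real.exp (-σ j))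
    (hσ : ∀ j, (1 + b) / b * σ j = κ j * clip (marginal A b C α y j))
    (hκ : ∀ j, 0 ≤ κ j) (hκ' : ∀ j, κ j ≤ 3 / 10)
    (hf : ∀ j, -(y j ^ (1 - α) * (σ j + e j)) ≤ fair α (y' j) - fair α (y j)) :
    merit A b C α y' - merit A b C α y ≤
      ∑ j, y j ^ (1 - α) * (e j - b / (1 + b) * (κ j * progress (marginal A b C α y j) / 5)) := by
  have h1 := congestion_exp_le hb hA hC (fun j => (hy j).le) h
  have h2 : merit A b C α y' - merit A b C α y = (congestion A b C y' - congestion A b C y) -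
      ∑ j, (fair α (y' j) - fair α (y j)) := by
    rw [Finset.sum_sub_distrib, merit, merit]; ring
  rw [h2]
  refine (sub_le_sub_right h1 _).trans ?_
  rw [Finset.mul_sum, ← Finset.sum_sub_distrib]
  refine Finset.sum_le_sum fun j _ => ?_
  have ht := marginal_nonneg (b := b) (α := α) hA hC (fun j => (hy j).le) j
  have hx := Real.rpow_nonneg (hy j).le (1 - α)
  rw [mul_price_eq (α := α) hy, hσ j]
  have h3 := mul_exp_neg_clip_le (hκ j) (hκ' j) ht
  have h4 : σ j = b / (1 + b) * (κ j * clip (marginal A b C α y j)) := by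
    rw [← hσ j]; field_simp
  have h5 := hf j
  rw [h4] at h5
  have hb' : 0 ≤ b / (1 + b) := by positivity
  have h6 := mul_le_mul_of_nonneg_left h3 (mul_nonneg hb' hx)
  nlinarith

end

/-- For `α ≤ 1` the utility is convex as a function of `log y`, so its tangent bounds it from below.
-/
theorem fair_sub_ge {α y σ : ℝ} (hα : α ≤ 1) (hy : 0 < y) :
    -(y ^ (1 - α) * σ) ≤ fair α (y * Real.exp (-σ)) - fair α y := by
  unfold fair
  split_ifs with h
  · subst h
    rw [Real.log_mul hy.ne' (Real.exp_pos _).ne', Real.log_exp]; simp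
  · have ha : 0 < 1 - α := by
      rcases hα.lt_or_eq with h1 | h1
      · linarith
      · exact absurd h1 h
    rw [Real.mul_rpow hy.le (Real.exp_pos _).le, ← Real.exp_mul, ← sub_div, le_div_iff₀ ha]
    have h1 := Real.add_one_le_exp (-σ * (1 - α))
    have h2 := Real.rpow_nonneg hy.le (1 - α)
    nlinarith

/-! ### Parameters -/

/-- The standing assumptions. -/
structure Admissible (A : Matrix (Fin m) (Fin n) ℝ) (ε α : ℝ) : Prop where
  scaled : IsScaled A
  alpha_nonneg : 0 ≤ α
  eps_pos : 0 < ε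
  eps_le : ε ≤ 1 / 2
  eps_mul_le : ε * (10 * |α - 1|) ≤ 1

/-- The quantity `4 m n ρ / ε`. -/
def scale (A : Matrix (Fin m) (Fin n) ℝ) (ε : ℝ) : ℝ := 4 * m * n * width A / ε

theorem beta_eq_scale (A : Matrix (Fin m) (Fin n) ℝ) (ε α : ℝ) :
    beta A ε α = (ε / 4) / ((1 + α) * Real.log (scale A ε)) := rfl

theorem IsScaled.nonneg {A : Matrix (Fin m) (Fin n) ℝ} (hA : IsScaled A) (i : Fin m) (j : Fin n) :
    0 ≤ A i j := by
  rcases hA.entry i j with h | h <;> linarith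

theorem le_width (A : Matrix (Fin m) (Fin n) ℝ) (i : Fin m) (j : Fin n) : A i j ≤ width A :=
  le_ciSup (f := fun p : Fin m × Fin n => A p.1 p.2) (Set.finite_range _).bddAbove (i, j)

theorem IsScaled.one_le_width {A : Matrix (Fin m) (Fin n) ℝ} (hA : IsScaled A) : 1 ≤ width A := by
  obtain ⟨i, j, h⟩ := hA.exists_one
  exact h ▸ le_width A i j

theorem IsScaled.one_le_rows {A : Matrix (Fin m) (Fin n) ℝ} (hA : IsScaled A) : (1 : ℝ) ≤ m := by
  obtain ⟨i, j, h⟩ := hA.exists_one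
  exact_mod_cast i.pos

theorem IsScaled.one_le_cols {A : Matrix (Fin m) (Fin n) ℝ} (hA : IsScaled A) : (1 : ℝ) ≤ n := by
  obtain ⟨i, j, h⟩ := hA.exists_one
  exact_mod_cast j.pos

theorem IsScaled.one_le_card_mul_width {A : Matrix (Fin m) (Fin n) ℝ} (hA : IsScaled A) :
    1 ≤ n * width A := one_le_mul_of_one_le_of_one_le hA.one_le_cols hA.one_le_width

/-- A nonzero column contains an entry at least one, and that row alone caps the coordinate. -/
theorem IsFeasible.le_one {A : Matrix (Fin m) (Fin n) ℝ} (hA : IsScaled A) {y : Fin n → ℝ}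
    (hy : IsFeasible A y) (j : Fin n) : y j ≤ 1 := by
  obtain ⟨i, hi⟩ := hA.column_ne_zero j
  have h1 : 1 ≤ A i j := (hA.entry i j).resolve_left hi
  have h2 := hy.1 i
  rw [mulVec_eq_sum] at h2
  have h3 := Finset.single_le_sum (f := fun j => A i j * y j)
    (fun j _ => mul_nonneg (hA.nonneg i j) (hy.2 j)) (Finset.mem_univ j)
  have h4 := hy.2 j
  nlinarith

/-- The uniform point `1/(nρ)` is feasible, with slack proportional to any down-scaling. -/
theorem IsScaled.mulVec_const_le {A : Matrix (Fin m) (Fin n) ℝ} (hA : IsScaled A) {c : ℝ}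
    (hc : 0 ≤ c) {y : Fin n → ℝ} (hy : ∀ j, y j ≤ c / (n * width A)) (i : Fin m) :
    A.mulVec y i ≤ c := by
  have hn := hA.one_le_cols
  have hw := hA.one_le_width
  rw [mulVec_eq_sum]
  calc ∑ j, A i j * y j ≤ ∑ _j : Fin n, width A * (c / (n * width A)) := by
        refine Finset.sum_le_sum fun j _ => ?_
        exact (mul_le_mul_of_nonneg_left (hy j) (hA.nonneg i j)).trans
          (mul_le_mul_of_nonneg_right (le_width A i j) (by positivity))
    _ = c := by
        rw [Finset.sum_const, Finset.card_univ, Fintype.card_fin, nsmul_eq_mul]; field_simp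

namespace Admissible
variable {A : Matrix (Fin m) (Fin n) ℝ} {ε α : ℝ} (H : Admissible A ε α)
include H

theorem scale_mul_eps : scale A ε * ε = 4 * m * n * width A := by
  have := H.eps_pos
  rw [scale]; field_simp

theorem eight_le_scale : 8 ≤ scale A ε := by
  have h1 := H.scaled.one_le_rows
  have h2 := H.scaled.one_le_card_mul_width
  have h0 := H.eps_pos
  rw [scale, le_div_iff₀ h0]
  nlinarith [H.eps_le]

theorem scale_pos : 0 < scale A ε := by linarith [H.eight_le_scale]

theorem two_le_log_scale : 2 ≤ Real.log (scale A ε) := by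
  have h : Real.log 8 ≤ Real.log (scale A ε) := Real.log_le_log (by norm_num) H.eight_le_scale
  rw [show (8 : ℝ) = 2 ^ 3 by norm_num, Real.log_pow] at h
  push_cast at h
  linarith [Real.log_two_gt_d9]

theorem one_add_alpha_pos : 0 < 1 + α := by linarith [H.alpha_nonneg]

theorem beta_pos : 0 < beta A ε α := by
  have := H.two_le_log_scale
  have := H.eps_pos
  have := H.one_add_alpha_pos
  rw [beta_eq_scale]
  positivity

theorem eps_div_beta : ε / beta A ε α = 4 * ((1 + α) * Real.log (scale A ε)) := by
  have := H.two_le_log_scale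
  have := H.eps_pos
  have := H.one_add_alpha_pos
  rw [beta_eq_scale]
  field_simp

theorem beta_mul_le : beta A ε α * (1 + α) ≤ ε / 8 := by
  have := H.two_le_log_scale
  have := H.eps_pos
  have := H.one_add_alpha_pos
  rw [beta_eq_scale, div_mul_eq_mul_div, div_le_iff₀ (by positivity)]
  nlinarith [mul_pos H.eps_pos H.one_add_alpha_pos]

theorem beta_le : beta A ε α ≤ ε / 8 := by
  have := H.beta_mul_le
  nlinarith [mul_nonneg H.beta_pos.le H.alpha_nonneg]

theorem alpha_mul_beta_le : α * beta A ε α ≤ ε / 8 := by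
  have := H.beta_mul_le
  nlinarith [H.beta_pos]

/-! ### Shadow prices of slack and of nearly tight rows -/

theorem penalty_pos : 0 < penalty A ε α := Real.rpow_pos_of_pos (by linarith [H.eps_pos]) _

theorem penalty_mul_rpow {s : ℝ} (hs : 0 < s) : penalty A ε α * s ^ (1 / beta A ε α) =
    Real.exp ((Real.log (1 + ε / 2) + Real.log s) / beta A ε α) := by
  have h0 := H.eps_pos
  rw [penalty, ← Real.mul_rpow (by linarith) hs.le, Real.rpow_def_of_pos (by positivity),
    Real.log_mul (by positivity) hs.ne']
  ring_nf

theorem exp_eps_mul_div_beta (c : ℝ) :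
    Real.exp (c * ε / beta A ε α) = scale A ε ^ (4 * c * (1 + α)) := by
  rw [mul_div_assoc, H.eps_div_beta, Real.rpow_def_of_pos H.scale_pos]
  ring_nf

/-- Since `log (1 + ε/2) + log (1 - ε) ≤ -ε/2` and `ε/β = 4 (1+α) log S`, the power is at most `S ^
(-2 (1+α))`. -/
theorem penalty_mul_le {s : ℝ} (hs : 0 ≤ s) (hs' : s ≤ 1 - ε) :
    penalty A ε α * s ^ (1 / beta A ε α) ≤ 1 / scale A ε ^ 2 := by
  have h0 := H.eps_pos
  have hb := H.beta_pos
  have h1 : 0 < 1 - ε := by linarith [H.eps_le]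
  calc penalty A ε α * s ^ (1 / beta A ε α)
      ≤ penalty A ε α * (1 - ε) ^ (1 / beta A ε α) := by
        have := H.penalty_pos
        gcongr
    _ ≤ Real.exp ((-(1 / 2)) * ε / beta A ε α) := by
        rw [H.penalty_mul_rpow h1]
        gcongr
        linarith [Real.log_le_sub_one_of_pos (x := 1 + ε / 2) (by linarith),
          Real.log_le_sub_one_of_pos h1]
    _ ≤ scale A ε ^ (-2 : ℝ) := by
        rw [H.exp_eps_mul_div_beta]
        refine Real.rpow_le_rpow_of_exponent_le (by linarith [H.eight_le_scale]) ?_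
        linarith [H.alpha_nonneg]
    _ = 1 / scale A ε ^ 2 := by
        rw [Real.rpow_neg H.scale_pos.le]
        norm_num

/-- Since `(1 + ε/2)(1 - ε/8) ≥ 1 + 11ε/32` has logarithm at least `ε/4`, and `ε/(4β) = (1+α) log
S`. -/
theorem le_penalty_mul {s : ℝ} (hs : 1 - ε / 8 ≤ s) :
    scale A ε ^ (1 + α) ≤ penalty A ε α * s ^ (1 / beta A ε α) := by
  have h0 := H.eps_pos
  have h3 := H.eps_le
  have hb := H.beta_pos
  have h1 : 0 < s := by linarith
  have e := H.exp_eps_mul_div_beta (1 / 4)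
  rw [show 4 * (1 / 4) * (1 + α) = 1 + α by ring] at e
  rw [← e, H.penalty_mul_rpow h1, ← Real.log_mul (by positivity) h1.ne']
  gcongr
  have h2 : 1 + 11 / 32 * ε ≤ (1 + ε / 2) * s := by nlinarith
  refine le_trans ?_ (Real.log_le_log (by positivity) h2)
  refine le_trans ?_ (Real.one_sub_inv_le_log_of_pos (by positivity))
  rw [show 1 - (1 + 11 / 32 * ε)⁻¹ = 11 / 32 * ε / (1 + 11 / 32 * ε) by field_simp; ring,
    le_div_iff₀ (by positivity)]
  nlinarith

theorem penalty_le : penalty A ε α ≤ scale A ε ^ (2 * (1 + α)) := by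
  have h0 := H.eps_pos
  have hb := H.beta_pos
  have h1 := H.penalty_mul_rpow one_pos
  rw [Real.one_rpow, mul_one, Real.log_one, add_zero] at h1
  have e := H.exp_eps_mul_div_beta (1 / 2)
  rw [show 4 * (1 / 2) * (1 + α) = 2 * (1 + α) by ring] at e
  rw [h1, ← e]
  gcongr
  linarith [Real.log_le_sub_one_of_pos (x := 1 + ε / 2) (by linarith)]

/-- The barrier is negligible on the points with slack `ε`. -/
theorem congestion_le {y : Fin n → ℝ} (hy : ∀ j, 0 ≤ y j) (hy' : ∀ i, A.mulVec y i ≤ 1 - ε) :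
    congestion A (beta A ε α) (penalty A ε α) y ≤ ε / (8 * width A) := by
  have hb := H.beta_pos
  have hw := H.scaled.one_le_width
  have hm := H.scaled.one_le_rows
  have hn := H.scaled.one_le_cols
  have h0 := H.eps_pos
  have hS := H.scale_pos
  have hA := H.scaled.nonneg
  rw [congestion, show penalty A ε α * beta A ε α / (1 + beta A ε α) =
    beta A ε α / (1 + beta A ε α) * penalty A ε α by ring, mul_assoc, Finset.mul_sum]
  calc _ ≤ beta A ε α / (1 + beta A ε α) * ∑ _i : Fin m, 1 / scale A ε ^ 2 := by
        refine mul_le_mul_of_nonneg_left (Finset.sum_le_sum fun i _ => ?_) (by positivity)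
        have h1 := mulVec_nonneg hA hy i
        rw [rpow_one_add_div hb h1, ← mul_assoc]
        have h2 := H.penalty_mul_le h1 (hy' i)
        have h3 : 0 ≤ penalty A ε α * A.mulVec y i ^ (1 / beta A ε α) :=
          mul_nonneg H.penalty_pos.le (Real.rpow_nonneg h1 _)
        nlinarith [hy' i]
    _ ≤ 1 * ∑ _i : Fin m, 1 / scale A ε ^ 2 := by
        gcongr
        rw [div_le_one (by positivity)]; linarith
    _ ≤ ε / (8 * width A) := by
        have h8 := H.eight_le_scale
        have h9 := H.scale_mul_eps
        rw [one_mul, Finset.sum_const, Finset.card_univ, Fintype.card_fin, nsmul_eq_mul, mul_one_div,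
          div_le_div_iff₀ (by positivity) (by positivity)]
        have : 8 * (scale A ε * ε) ≤ ε * scale A ε ^ 2 := by nlinarith [mul_pos h0 hS]
        have : (m : ℝ) * width A ≤ m * n * width A := by
          nlinarith [mul_nonneg (mul_nonneg (by linarith : (0:ℝ) ≤ m) (by linarith : 0 ≤ width A)) (by linarith : (0:ℝ) ≤ n - 1)]
        nlinarith

/-- Coordinates of a nearly tight row that are not tiny have large marginals. -/
theorem two_le_marginal {y : Fin n → ℝ} (hy : ∀ j, 0 < y j) {i : Fin m} {j : Fin n}
    (hi : 1 - ε / 8 ≤ A.mulVec y i) (hij : A i j ≠ 0) (hj : 1 / scale A ε ≤ y j) :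
    2 ≤ marginal A (beta A ε α) (penalty A ε α) α y j := by
  have hS := H.scale_pos
  have h8 := H.eight_le_scale
  have h1 : 1 ≤ A i j := (H.scaled.entry i j).resolve_left hij
  have h2 : scale A ε ^ (1 + α) ≤ price A (beta A ε α) (penalty A ε α) y j := by
    refine (H.le_penalty_mul hi).trans ?_
    have hnn : ∀ k, 0 ≤ penalty A ε α * A.mulVec y k ^ (1 / beta A ε α) := fun k =>
      mul_nonneg H.penalty_pos.le (Real.rpow_nonneg
        (mulVec_nonneg H.scaled.nonneg (fun j => (hy j).le) k) _)
    refine le_trans ?_ (Finset.single_le_sum (f := fun i => A i j *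
      (penalty A ε α * A.mulVec y i ^ (1 / beta A ε α)))
      (fun k _ => mul_nonneg (H.scaled.nonneg k j) (hnn k)) (Finset.mem_univ i))
    exact le_mul_of_one_le_left (hnn i) h1
  have h3 : (1 / scale A ε) ^ α ≤ y j ^ α := Real.rpow_le_rpow (by positivity) hj H.alpha_nonneg
  -- The exponent `1 + α` of the shadow price leaves one spare factor `scale A ε ≥ 8` after paying
  -- for `y j ^ α`.
  have h4 : (1 / scale A ε) ^ α * scale A ε ^ (1 + α) = scale A ε := by
    rw [one_div, Real.inv_rpow hS.le, Real.rpow_add hS, Real.rpow_one]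
    have := Real.rpow_pos_of_pos hS α
    field_simp
  have h5 := mul_le_mul h3 h2 (Real.rpow_nonneg hS.le _) (Real.rpow_nonneg (hy j).le _)
  rw [h4] at h5
  exact le_trans (by linarith) h5

/-- A small multiplicative step against the gradient preserves feasibility. -/
theorem isFeasible_step {y y' σ : Fin n → ℝ} (hy : ∀ j, 0 < y j) (hf : IsFeasible A y)
    (h : ∀ j, y' j = y j * Real.exp (-σ j)) {s : ℝ} (hs : 0 < s) (hs' : s ≤ beta A ε α / 4)
    (h1 : ∀ j, -(11 / 10 * s) ≤ σ j)
    (h2 : ∀ j, 2 ≤ marginal A (beta A ε α) (penalty A ε α) α y j → 0 ≤ σ j)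
    (h3 : ∀ j, 2 ≤ marginal A (beta A ε α) (penalty A ε α) α y j →
      (1 - ε) / (2 * (n * width A)) ≤ y j → 6 / 10 * s ≤ σ j) : IsFeasible A y' := by
  have h0 := H.eps_pos
  have h0' := H.eps_le
  have hbe := H.beta_le
  have hS := H.scale_pos
  have hw := H.scaled.one_le_width
  have hm := H.scaled.one_le_rows
  have hn := H.scaled.one_le_cols
  refine ⟨fun i => ?_, fun j => by rw [h j]; exact mul_nonneg (hy j).le (Real.exp_pos _).le⟩
  have hexp : ∀ j, Real.exp (-σ j) ≤ Real.exp (11 / 10 * s) := fun j =>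
    Real.exp_le_exp.2 (by linarith [h1 j])
  -- A row with slack grows at most by the factor `exp (11 s / 10)`, and `s ≤ β/4 ≤ ε/32`. A nearly
  -- tight row needs a cancellation between its coordinates.
  rcases le_or_gt (A.mulVec y i) (1 - ε / 8) with hi | hi
  · have h4 : A.mulVec y' i ≤ Real.exp (11 / 10 * s) * A.mulVec y i := by
      rw [mulVec_eq_sum, mulVec_eq_sum, Finset.mul_sum]
      refine Finset.sum_le_sum fun j _ => ?_
      rw [h j]
      have := mul_nonneg (H.scaled.nonneg i j) (hy j).le
      nlinarith [hexp j]
    have h5 : Real.exp (11 / 10 * s) * A.mulVec y i ≤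
        Real.exp (11 / 10 * s) * Real.exp (-(ε / 8)) := by
      gcongr
      linarith [Real.add_one_le_exp (-(ε / 8))]
    rw [← Real.exp_add] at h5
    refine h4.trans (h5.trans (Real.exp_le_one_iff.2 ?_))
    linarith
  · have hs1 : s ≤ 1 / 64 := by linarith
    have up : Real.exp (11 / 10 * s) - 1 ≤ 12 / 10 * s := by
      have := exp_neg_le (w := -(11 / 10 * s)) (by
        rw [abs_neg, abs_of_pos (by positivity)]; linarith)
      rw [neg_neg] at this
      nlinarith
    have down : Real.exp (-(6 / 10 * s)) - 1 ≤ -(s / 2) := by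
      have := exp_neg_le (w := 6 / 10 * s) (by rw [abs_of_pos (by positivity)]; linarith)
      nlinarith
    -- Summed over `j`, the row loses the fraction `s/2` of itself and gains at most `2s/5`; the
    -- value one is therefore not exceeded.
    have key : ∀ j, A i j * y' j ≤ A i j * y j - s / 2 * (A i j * y j) + 2 / 5 * s / n := by
      intro j
      have ha := H.scaled.nonneg i j
      have hay := mul_nonneg ha (hy j).le
      rcases eq_or_ne (A i j) 0 with hz | hz
      · rw [hz]; simp; positivity
      have haw := le_width A i j
      rw [h j]
      rcases lt_or_ge (y j) (1 / scale A ε) with hj | hj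
      -- A tiny coordinate may grow, but contributes at most `1/(8n)` to the row.
      · have h6 : A i j * y j ≤ 1 / (8 * n) := by
          have : A i j * y j ≤ width A * (1 / scale A ε) := by
            have := (hy j).le
            gcongr
          refine this.trans ?_
          rw [mul_one_div, div_le_div_iff₀ hS (by positivity)]
          have h9 := H.scale_mul_eps
          have : scale A ε * (1 / 2) ≥ scale A ε * ε := by gcongr
          nlinarith [mul_nonneg (mul_nonneg (by linarith : (0:ℝ) ≤ n) (by linarith : 0 ≤ width A)) (by linarith : (0:ℝ) ≤ m - 1)]
        have h7 : A i j * y j * (Real.exp (-σ j) - 1) ≤ A i j * y j * (12 / 10 * s) := by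
          gcongr
          linarith [hexp j]
        have h8 : s * (A i j * y j) ≤ s * (1 / (8 * n)) := by gcongr
        have h9 : 2 / 5 * s / n = 32 / 10 * (s * (1 / (8 * n))) := by field_simp; norm_num
        have : 0 ≤ s * (1 / (8 * n)) := by positivity
        nlinarith
      · have ht := H.two_le_marginal hy hi.le hz hj
        -- All remaining coordinates have marginal at least two. Those of middling size merely must
        -- not grow, having contribution at most `1/(2n)`; only the large ones must really shrink.
        -- The distinction matters for `α < 1`, where small coordinates move slowly.
        rcases lt_or_ge (y j) ((1 - ε) / (2 * (n * width A))) with hk | hk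
        · have h6 : A i j * y j ≤ 1 / (2 * n) := by
            have : A i j * y j ≤ width A * ((1 - ε) / (2 * (n * width A))) := by
              have := (hy j).le
              gcongr
            refine this.trans ?_
            rw [mul_div_assoc', div_le_div_iff₀ (by positivity) (by positivity)]
            nlinarith [mul_pos (mul_pos (by linarith : (0:ℝ) < n) (by linarith : 0 < width A)) h0]
          have h7 : Real.exp (-σ j) ≤ 1 := Real.exp_le_one_iff.2 (by linarith [h2 j ht])
          have h8 : s * (A i j * y j) ≤ s * (1 / (2 * n)) := by gcongr
          have h9 : 2 / 5 * s / n = 4 / 5 * (s * (1 / (2 * n))) := by field_simp; norm_num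
          have : 0 ≤ s * (1 / (2 * n)) := by positivity
          nlinarith
        · have h7 : Real.exp (-σ j) - 1 ≤ -(s / 2) := by
            refine le_trans ?_ down
            have := Real.exp_le_exp.2 (neg_le_neg (h3 j ht hk))
            linarith
          have : 0 ≤ 2 / 5 * s / n := by positivity
          nlinarith
    have hsum : A.mulVec y' i ≤ A.mulVec y i - s / 2 * A.mulVec y i + 2 / 5 * s := by
      have e : ∑ _j : Fin n, 2 / 5 * s / n = 2 / 5 * s := by
        rw [Finset.sum_const, Finset.card_univ, Fintype.card_fin, nsmul_eq_mul]; field_simp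
      rw [mulVec_eq_sum, mulVec_eq_sum, ← e, Finset.mul_sum, ← Finset.sum_sub_distrib,
        ← Finset.sum_add_distrib]
      exact Finset.sum_le_sum fun j _ => key j
    have := hf.1 i
    nlinarith

end Admissible

/-! ### The regime `α > 1` -/

theorem fair_of_ne {α : ℝ} (h : α ≠ 1) (v : ℝ) : fair α v = v ^ (1 - α) / (1 - α) := if_neg h

/-- The conjugate of the utility, relative to the point where the marginal is `t`. -/
theorem relative_utility_le {α w t : ℝ} (hα : 1 < α) (hw : 0 < w) (ht : 0 ≤ t) :
    (w ^ (1 - α) - 1) / (1 - α) - t * w ≤ (1 - α * t ^ (1 - 1 / α)) / (α - 1) := by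
  have h0 : 0 < α := by linarith
  have h1 : 0 < α - 1 := by linarith
  have h := Real.geom_mean_le_arith_mean2_weighted (w₁ := 1 / α) (w₂ := 1 - 1 / α)
    (p₁ := w ^ (1 - α)) (p₂ := t * w) (by positivity)
    (by rw [sub_nonneg, div_le_one h0]; exact hα.le) (Real.rpow_nonneg hw.le _)
    (by positivity) (by ring)
  -- The weights `1/α` and `1 - 1/α` are chosen so that the powers of `w` cancel in the geometric
  -- mean.
  have e : (w ^ (1 - α)) ^ (1 / α) * (t * w) ^ (1 - 1 / α) = t ^ (1 - 1 / α) := by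
    rw [Real.mul_rpow ht hw.le, ← Real.rpow_mul hw.le, mul_left_comm, ← Real.rpow_add hw,
      show (1 - α) * (1 / α) + (1 - 1 / α) = 0 by field_simp; ring, Real.rpow_zero, mul_one]
  rw [e] at h
  rw [le_div_iff₀ h1]
  have e2 : ((w ^ (1 - α) - 1) / (1 - α) - t * w) * (α - 1) =
      1 - α * (1 / α * w ^ (1 - α) + (1 - 1 / α) * (t * w)) := by
    have : 1 - α ≠ 0 := by linarith
    field_simp
    ring
  rw [e2]
  nlinarith

/-- The conjugate agrees with `-t` at `t = 1`, and the excess there is quadratic: `log t ≤ t - 1`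
gives `t ^ (-1/α) ≥ 1 - (t-1)/α`, hence excess at most `(t-1)²/(α-1)`. For `t > 2` the left side is
nonpositive. -/
theorem conjugate_le {α t : ℝ} (hα : 1 < α) (ht : 0 ≤ t) :
    (1 - α * t ^ (1 - 1 / α)) / (α - 1) ≤ progress t / min (α - 1) 1 - t := by
  have h0 : 0 < α := by linarith
  have h1 : 0 < α - 1 := by linarith
  have hμ : 0 < min (α - 1) 1 := lt_min h1 one_pos
  rcases ht.eq_or_lt with rfl | ht0
  · have : (1 : ℝ) - 1 / α ≠ 0 := by
      have : 1 / α < 1 := (div_lt_one h0).2 hα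
      linarith
    rw [Real.zero_rpow this, progress, if_pos (by norm_num)]
    norm_num
    exact inv_anti₀ hμ (min_le_left _ _)
  have h2 : t - 1 / α * (t * (t - 1)) ≤ t ^ (1 - 1 / α) := by
    have h3 : 1 - 1 / α * (t - 1) ≤ t ^ (-(1 / α)) := by
      rw [Real.rpow_def_of_pos ht0]
      refine le_trans ?_ (Real.add_one_le_exp _)
      have h4 := mul_le_mul_of_nonneg_left (Real.log_le_sub_one_of_pos ht0)
        (by positivity : 0 ≤ 1 / α)
      linarith
    rw [sub_eq_add_neg 1, Real.rpow_add ht0, Real.rpow_one]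
    nlinarith
  have h3 : α * t - t * (t - 1) ≤ α * t ^ (1 - 1 / α) := by
    have := mul_le_mul_of_nonneg_left h2 h0.le
    have e : α * (t - 1 / α * (t * (t - 1))) = α * t - t * (t - 1) := by field_simp
    linarith
  unfold progress
  split_ifs with h
  · have h4 : (t - 1) ^ 2 / (α - 1) ≤ (t - 1) ^ 2 / min (α - 1) 1 := by
      gcongr
      exact min_le_left _ _
    have h5 : (1 - α * t ^ (1 - 1 / α)) / (α - 1) ≤ (t - 1) ^ 2 / (α - 1) - t := by
      rw [div_le_iff₀ h1, sub_mul, div_mul_cancel₀ _ h1.ne']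
      nlinarith
    linarith
  · have h4 : t ≤ t / min (α - 1) 1 := by
      rw [le_div_iff₀ hμ]
      nlinarith [min_le_right (α - 1) 1]
    have h5 : 1 ≤ t ^ (1 - 1 / α) := Real.one_le_rpow (by linarith)
      (by rw [sub_nonneg, div_le_one h0]; exact hα.le)
    have h6 : (1 - α * t ^ (1 - 1 / α)) / (α - 1) ≤ 0 :=
      div_nonpos_of_nonpos_of_nonneg (by nlinarith) h1.le
    linarith

/-- The two preceding bounds after rescaling by `w = v/y`, with `G` in the role of the price of the
coordinate. -/
theorem fair_sub_fair_le {α y v G : ℝ} (hα : 1 < α) (hy : 0 < y) (hv : 0 < v) (hG : 0 ≤ G) :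
    fair α v - fair α y - G * v ≤
      y ^ (1 - α) * (progress (y ^ α * G) / min (α - 1) 1 - y ^ α * G) := by
  have ht : 0 ≤ y ^ α * G := mul_nonneg (Real.rpow_nonneg hy.le _) hG
  have h := (relative_utility_le hα (div_pos hv hy) ht).trans (conjugate_le hα ht)
  have hx := Real.rpow_pos_of_pos hy (1 - α)
  refine le_trans (le_of_eq ?_) (mul_le_mul_of_nonneg_left h hx.le)
  rw [fair_of_ne hα.ne', fair_of_ne hα.ne', Real.div_rpow hv.le hy.le]
  have e : y ^ (1 - α) * (y ^ α * G * (v / y)) = G * v := by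
    have : y ^ (1 - α) * y ^ α = y := by rw [← Real.rpow_add hy]; simp
    rw [← mul_assoc, ← mul_assoc, this]; field_simp
  rw [mul_sub, e]
  have : 1 - α ≠ 0 := by linarith
  field_simp

namespace Admissible
variable {A : Matrix (Fin m) (Fin n) ℝ} {ε α : ℝ} (H : Admissible A ε α)
include H

/-- Approximate complementary slackness: a row above `1 - ε` satisfies `1 ≤ (1 + 2ε)(A y)_i`, and
the other rows carry total shadow price at most `m / S² ≤ ε/8`. -/
theorem sum_shadow_le {y : Fin n → ℝ} (hy : ∀ j, 0 < y j) :
    ∑ i, penalty A ε α * A.mulVec y i ^ (1 / beta A ε α) ≤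
      (1 + 2 * ε) * ∑ j, y j ^ (1 - α) * marginal A (beta A ε α) (penalty A ε α) α y j +
        ε / 8 := by
  have h0 := H.eps_pos
  have h0' := H.eps_le
  simp only [← mul_price_eq (α := α) hy]
  rw [sum_mul_price, Finset.mul_sum]
  have h1 : ∀ i, penalty A ε α * A.mulVec y i ^ (1 / beta A ε α) ≤
      (1 + 2 * ε) * (penalty A ε α * A.mulVec y i ^ (1 / beta A ε α) * A.mulVec y i) +
        1 / scale A ε ^ 2 := by
    intro i
    have hs := mulVec_nonneg H.scaled.nonneg (fun j => (hy j).le) i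
    have hl : 0 ≤ penalty A ε α * A.mulVec y i ^ (1 / beta A ε α) :=
      mul_nonneg H.penalty_pos.le (Real.rpow_nonneg hs _)
    rcases le_or_gt (A.mulVec y i) (1 - ε) with hi | hi
    · have := H.penalty_mul_le hs hi
      have : 0 ≤ (1 + 2 * ε) * (penalty A ε α * A.mulVec y i ^ (1 / beta A ε α) * A.mulVec y i) := by
        positivity
      linarith
    · have : 1 ≤ (1 + 2 * ε) * A.mulVec y i := by nlinarith
      have h2 : 0 ≤ 1 / scale A ε ^ 2 := by positivity
      nlinarith
  refine (Finset.sum_le_sum fun i _ => h1 i).trans ?_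
  rw [Finset.sum_add_distrib]
  gcongr
  have hS := H.scale_pos
  rw [Finset.sum_const, Finset.card_univ, Fintype.card_fin, nsmul_eq_mul, mul_one_div,
    div_le_div_iff₀ (by positivity) (by norm_num)]
  have h9 := H.scale_mul_eps
  have h8 := H.eight_le_scale
  have hm := H.scaled.one_le_rows
  have := H.scaled.one_le_card_mul_width
  have : scale A ε * ε ≥ 4 * m := by rw [h9]; nlinarith
  nlinarith [mul_pos h0 hS]

/-- Lagrangian duality with the shadow prices as multipliers: a feasible `v` costs at most `∑ λ i`,
which nearly equals the cost `∑ y_j p_j` of `y`. The latter cancels the term `-t` in the conjugate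
bound. -/
theorem merit_add_le (hα : 1 < α) {y v : Fin n → ℝ} (hy : ∀ j, 0 < y j) (hv : ∀ j, 0 < v j)
    (hfv : IsFeasible A v) :
    merit A (beta A ε α) (penalty A ε α) α y + ∑ j, fair α (v j) ≤
      (∑ j, y j ^ (1 - α) * progress (marginal A (beta A ε α) (penalty A ε α) α y j)) /
          min (α - 1) 1 +
        (2 * ε + beta A ε α) *
          ∑ j, y j ^ (1 - α) * marginal A (beta A ε α) (penalty A ε α) α y j + ε / 8 := by
  set b := beta A ε α
  set C := penalty A ε α
  have hb : 0 < b := H.beta_pos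
  have hC : 0 < C := H.penalty_pos
  have hA := H.scaled.nonneg
  have h1 : ∀ j, fair α (v j) - fair α (y j) - price A b C y j * v j ≤ y j ^ (1 - α) *
      (progress (marginal A b C α y j) / min (α - 1) 1 - marginal A b C α y j) := fun j =>
    fair_sub_fair_le hα (hy j) (hv j) (price_nonneg hA hC.le (fun j => (hy j).le) j)
  have h2 := Finset.sum_le_sum fun j (_ : j ∈ Finset.univ) => h1 j
  have h3 : ∑ j, price A b C y j * v j ≤ ∑ i, C * A.mulVec y i ^ (1 / b) := by
    simp only [mul_comm (price A b C y _)]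
    rw [sum_mul_price]
    refine Finset.sum_le_sum fun i _ => mul_le_of_le_one_right ?_ (hfv.1 i)
    exact mul_nonneg hC.le (Real.rpow_nonneg (mulVec_nonneg hA (fun j => (hy j).le) i) _)
  have h4 := H.sum_shadow_le hy
  have h5 : congestion A b C y ≤ b * ∑ j, y j ^ (1 - α) * marginal A b C α y j := by
    rw [congestion_eq_sum_marginal (α := α) hb hA hy]
    refine mul_le_mul_of_nonneg_right ?_ (Finset.sum_nonneg fun j _ => mul_nonneg
      (Real.rpow_nonneg (hy j).le _) (marginal_nonneg hA hC.le (fun j => (hy j).le) j))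
    rw [div_le_iff₀ (by positivity)]
    nlinarith
  simp only [mul_sub, Finset.sum_sub_distrib, mul_div_assoc'] at h2
  rw [← Finset.sum_div] at h2
  rw [merit]
  linarith

/-- One iteration for `α > 1`. -/
theorem step_of_one_lt (hα : 1 < α) {y y' : Fin n → ℝ} (hy : ∀ j, 0 < y j) (hf : IsFeasible A y)
    {s : ℝ} (hs : s = beta A ε α / (4 * (1 + α * beta A ε α)))
    (h : ∀ j, y' j = y j * (1 + s * (α - 1) *
      clip (marginal A (beta A ε α) (penalty A ε α) α y j)) ^ (-1 / (α - 1))) :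
    (∀ j, 0 < y' j) ∧ IsFeasible A y' ∧
      s / 8 * ∑ j, y j ^ (1 - α) * progress (marginal A (beta A ε α) (penalty A ε α) α y j) ≤
        merit A (beta A ε α) (penalty A ε α) α y - merit A (beta A ε α) (penalty A ε α) α y' := by
  have hbm := H.beta_mul_le
  have h0 := H.eps_pos
  have h0' := H.eps_le
  have hA := H.scaled.nonneg
  have hb : 0 < beta A ε α := H.beta_pos
  have hC : 0 < penalty A ε α := H.penalty_pos
  set b := beta A ε α
  set C := penalty A ε α
  have hab : 0 < 1 + α * b := by positivity
  have hspos : 0 < s := by rw [hs]; positivity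
  have hsb : s ≤ b / 4 := by
    rw [hs]
    gcongr
    nlinarith
  have hsα : s * (α - 1) ≤ 1 / 64 := by nlinarith
  have ht : ∀ j, 0 ≤ marginal A b C α y j := marginal_nonneg hA hC.le fun j => (hy j).le
  have hα1 : 0 < α - 1 := by linarith
  have hu : ∀ j, |s * (α - 1) * clip (marginal A b C α y j)| ≤ 1 / 64 := fun j => by
    rw [abs_mul, abs_of_pos (by positivity)]
    have := abs_clip_le_one (ht j)
    have : 0 ≤ s * (α - 1) := by positivity
    nlinarith
  have hu' : ∀ j, |s * (α - 1) * clip (marginal A b C α y j)| ≤ 1 / 20 := fun j => by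
    linarith [hu j]
  have hpos : ∀ j, 0 < 1 + s * (α - 1) * clip (marginal A b C α y j) := fun j => by
    linarith [(abs_le.1 (hu j)).1]
  choose c hc hc' hlog using fun j => exists_log_one_add_eq_mul (hu' j)
  set σ : Fin n → ℝ := fun j => c j * s * clip (marginal A b C α y j) with hσ
  have hσlog : ∀ j, σ j = Real.log (1 + s * (α - 1) * clip (marginal A b C α y j)) / (α - 1) :=
    fun j => by
      rw [hlog j, hσ]
      field_simp
  have hy' : ∀ j, y' j = y j * Real.exp (-σ j) := fun j => by
    rw [h j, Real.rpow_def_of_pos (hpos j), hσlog j]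
    congr 2
    ring
  have hclip2 : ∀ j, 2 ≤ marginal A b C α y j → σ j = c j * s := fun j hj => by
    rw [hσ]; simp [clip_of_two_le hj]
  refine ⟨fun j => by rw [hy' j]; exact mul_pos (hy j) (Real.exp_pos _), ?_, ?_⟩
  · refine H.isFeasible_step hy hf hy' hspos hsb (fun j => ?_) (fun j hj => ?_) fun j hj _ => ?_
    · have := neg_one_le_clip (ht j)
      have h1 : 0 ≤ c j * s := mul_nonneg (by linarith [hc j]) hspos.le
      have h2 : c j * s ≤ 11 / 10 * s := by gcongr; exact hc' j
      simp only [hσ]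
      nlinarith
    · rw [hclip2 j hj]
      exact mul_nonneg (by linarith [hc j]) hspos.le
    · rw [hclip2 j hj]
      gcongr
      linarith [hc j]
  · have hbs : (1 + b) / b * s ≤ 1 / 4 := by
      rw [hs, div_mul_div_comm, div_le_div_iff₀ (by positivity) (by norm_num)]
      nlinarith [mul_pos hb hb]
    have key := merit_sub_le (α := α) hb hA hC.le hy (y' := y') (σ := σ)
      (κ := fun j => (1 + b) / b * s * c j)
      (e := fun j => 11 / 10 * (s ^ 2 * (α - 1) * clip (marginal A b C α y j) ^ 2)) hy'
      (fun j => by simp only [hσ]; ring)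
      (fun j => mul_nonneg (by positivity) (by linarith [hc j]))
      (fun j => by
        have : 0 ≤ (1 + b) / b * s := by positivity
        nlinarith [hc j, hc' j])
      (fun j => by
        have hx := Real.rpow_pos_of_pos (hy j) (1 - α)
        -- The utility is linear in `x = y ^ (1-α)`, so its change is exact. The error `e` comes
        -- only from `σ` being a logarithm of the update.
        have e1 : fair α (y' j) - fair α (y j) =
            -(y j ^ (1 - α) * (s * clip (marginal A b C α y j))) := by
          have h1 : 1 - α ≠ 0 := by linarith
          rw [fair_of_ne hα.ne', fair_of_ne hα.ne', h j, Real.mul_rpow (hy j).le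
            (Real.rpow_nonneg (hpos j).le _), ← Real.rpow_mul (hpos j).le,
            show -1 / (α - 1) * (1 - α) = 1 by field_simp; ring, Real.rpow_one]
          field_simp
          ring
        rw [e1, neg_le_neg_iff]
        refine mul_le_mul_of_nonneg_left ?_ hx.le
        have h2 := le_log_one_add (hu' j)
        have h3 : σ j * (α - 1) = Real.log (1 + s * (α - 1) * clip (marginal A b C α y j)) := by
          rw [hσlog j]; field_simp
        rw [← h3] at h2
        refine le_of_mul_le_mul_right ?_ hα1
        linarith)
    rw [Finset.mul_sum]
    have : ∑ j, y j ^ (1 - α) * (11 / 10 * (s ^ 2 * (α - 1) * clip (marginal A b C α y j) ^ 2) -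
        b / (1 + b) * ((1 + b) / b * s * c j * progress (marginal A b C α y j) / 5)) ≤
        -∑ j, s / 8 * (y j ^ (1 - α) * progress (marginal A b C α y j)) := by
      rw [← Finset.sum_neg_distrib]
      refine Finset.sum_le_sum fun j _ => ?_
      have hx := Real.rpow_pos_of_pos (hy j) (1 - α)
      have hp := clip_sq_le_progress (marginal A b C α y j)
      have e1 : b / (1 + b) * ((1 + b) / b * s * c j * progress (marginal A b C α y j) / 5) =
          s * c j * progress (marginal A b C α y j) / 5 := by
        field_simp
      have hpn := progress_nonneg (t := marginal A b C α y j)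
      rw [e1]
      -- The second-order loss is a small multiple of the gain because `s (α - 1) ≤ 1/64`.
      have e2 : s ^ 2 * (α - 1) * clip (marginal A b C α y j) ^ 2 ≤
          1 / 64 * (s * progress (marginal A b C α y j)) := by
        have h5 : s * (α - 1) * (s * clip (marginal A b C α y j) ^ 2) ≤
            1 / 64 * (s * progress (marginal A b C α y j)) := by gcongr
        linarith
      have e3 : 9 / 10 * (s * progress (marginal A b C α y j)) ≤
          s * c j * progress (marginal A b C α y j) := by
        have := mul_le_mul_of_nonneg_right (hc j) (mul_nonneg hspos.le hpn)
        linarith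
      have e4 : 0 ≤ s * progress (marginal A b C α y j) := by positivity
      have : 11 / 10 * (s ^ 2 * (α - 1) * clip (marginal A b C α y j) ^ 2) -
          s * c j * progress (marginal A b C α y j) / 5 ≤
          -(s / 8 * progress (marginal A b C α y j)) := by linarith
      have := mul_le_mul_of_nonneg_left this hx.le
      linarith
    linarith

theorem eps_mul_sub_one_le : ε * (α - 1) ≤ 1 / 10 := by
  have := mul_le_mul_of_nonneg_left (le_abs_self (α - 1)) H.eps_pos.le
  linarith [H.eps_mul_le]

/-- Away from the target accuracy, an iteration for `α > 1` removes a constant fraction of the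
gap. -/
theorem contraction_of_one_lt (hα : 1 < α) {y v : Fin n → ℝ} (hy : ∀ j, 0 < y j)
    (hv : ∀ j, 0 < v j) (hfv : IsFeasible A v) (hU : 1 ≤ ∑ j, v j ^ (1 - α)) {s E E' : ℝ}
    (hs : 0 < s) (hE : E = merit A (beta A ε α) (penalty A ε α) α y + ∑ j, fair α (v j))
    (hdesc : s / 8 * ∑ j, y j ^ (1 - α) * progress (marginal A (beta A ε α) (penalty A ε α) α y j) ≤
      E - E') :
    s * min (α - 1) 1 / 50 * (E - 10 * ε * ∑ j, v j ^ (1 - α)) ≤ E - E' := by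
  have heps := H.eps_pos
  have hA := H.scaled.nonneg
  have hble := H.beta_le
  have hεα := H.eps_mul_sub_one_le
  have hα1 : 0 < α - 1 := by linarith
  have hb : 0 < beta A ε α := H.beta_pos
  have hC : 0 < penalty A ε α := H.penalty_pos
  have h1 := H.merit_add_le hα hy hv hfv
  rw [← hE] at h1
  -- Bounds `∑ y_j ^ (1-α)` by the gap and the optimum; for `α > 1` this sum is not controlled by
  -- feasibility.
  have h3 : (α - 1) * merit A (beta A ε α) (penalty A ε α) α y ≥ ∑ j, y j ^ (1 - α) := by
    have h4 := congestion_nonneg hb hA hC.le fun j => (hy j).le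
    rw [merit]
    simp only [fair_of_ne hα.ne']
    rw [← Finset.sum_div, mul_sub]
    have : (α - 1) * ((∑ j, y j ^ (1 - α)) / (1 - α)) = -∑ j, y j ^ (1 - α) := by
      have : 1 - α ≠ 0 := by linarith
      field_simp
      ring
    nlinarith
  have h3v : (α - 1) * ∑ j, fair α (v j) = -∑ j, v j ^ (1 - α) := by
    simp only [fair_of_ne hα.ne']
    rw [← Finset.sum_div]
    have : 1 - α ≠ 0 := by linarith
    field_simp
    ring
  have h2 : ∑ j, y j ^ (1 - α) * marginal A (beta A ε α) (penalty A ε α) α y j ≤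
      2 * ∑ j, y j ^ (1 - α) +
        ∑ j, y j ^ (1 - α) * progress (marginal A (beta A ε α) (penalty A ε α) α y j) := by
    rw [Finset.mul_sum, ← Finset.sum_add_distrib]
    refine Finset.sum_le_sum fun j _ => ?_
    have := mul_le_mul_of_nonneg_left
      (le_two_add_progress (marginal A (beta A ε α) (penalty A ε α) α y j))
      (Real.rpow_nonneg (hy j).le (1 - α))
    linarith
  have hT : 0 ≤ ∑ j, y j ^ (1 - α) * marginal A (beta A ε α) (penalty A ε α) α y j :=
    Finset.sum_nonneg fun j _ => mul_nonneg (Real.rpow_nonneg (hy j).le _)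
      (marginal_nonneg hA hC.le (fun j => (hy j).le) j)
  have hP : 0 ≤ ∑ j, y j ^ (1 - α) * progress (marginal A (beta A ε α) (penalty A ε α) α y j) :=
    Finset.sum_nonneg fun j _ => mul_nonneg (Real.rpow_nonneg (hy j).le _) progress_nonneg
  generalize ∑ j, y j ^ (1 - α) * progress (marginal A (beta A ε α) (penalty A ε α) α y j) = P at *
  generalize ∑ j, y j ^ (1 - α) * marginal A (beta A ε α) (penalty A ε α) α y j = T at *
  generalize ∑ j, y j ^ (1 - α) = X at *
  generalize ∑ j, v j ^ (1 - α) = U at *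
  have hX : X ≤ (α - 1) * E + U := by rw [hE]; linarith
  have hμ : 0 < min (α - 1) 1 := lt_min hα1 one_pos
  have hμ1 : min (α - 1) 1 ≤ 1 := min_le_right _ _
  generalize min (α - 1) 1 = μ at *
  have hPμ : P ≤ P / μ := by rw [le_div_iff₀ hμ]; nlinarith
  have h4 : E ≤ 3 * (P / μ) + 17 / 4 * ε * X + ε / 8 := by
    have h5 : (2 * ε + beta A ε α) * T ≤ 17 / 8 * ε * (2 * X + P) := by
      calc (2 * ε + beta A ε α) * T ≤ 17 / 8 * ε * T := by gcongr; linarith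
        _ ≤ _ := by gcongr
    have h6 : ε * P ≤ 1 / 2 * P := by gcongr; exact H.eps_le
    linarith
  -- With a negative gap the left side is nonpositive and monotonicity is enough. The next steps
  -- need the sign of `E`.
  rcases lt_or_ge E 0 with hE0 | hE0
  · have h6 : 0 ≤ s / 8 * P := by positivity
    have h7 : E - 10 * ε * U ≤ 0 := by
      have : 0 ≤ ε * U := by positivity
      linarith
    have := mul_nonpos_of_nonneg_of_nonpos (by positivity : 0 ≤ s * μ / 50) h7
    linarith
  -- Here `ε (α - 1) ≤ 1/10` is used: the part of the error proportional to the gap is absorbed on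
  -- the left.
  have h5 : 17 / 4 * ε * X ≤ 17 / 40 * E + 17 / 4 * ε * U := by
    have h6 : ε * X ≤ ε * ((α - 1) * E + U) := by gcongr
    have h7 : ε * (α - 1) * E ≤ 1 / 10 * E := by gcongr
    linarith
  have hεU : ε ≤ ε * U := by nlinarith
  have h6 : 48 / 100 * (E - 10 * ε * U) ≤ 3 * (P / μ) := by linarith
  have h8 : s * μ / 24 * (3 * (P / μ)) = s / 8 * P := by field_simp; ring
  have h9 := mul_le_mul_of_nonneg_left h6 (by positivity : 0 ≤ s * μ / 24)
  linarith

theorem sum_fair_init_ge (hα : 1 < α) :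
    -(n * ((2 * (n * width A)) ^ (α - 1) / (α - 1))) ≤
      ∑ _j : Fin n, fair α ((1 - ε) / (n * width A)) := by
  have heps' := H.eps_le
  have hnw := H.scaled.one_le_card_mul_width
  have hα1 : 0 < α - 1 := by linarith
  have h0 : 0 ≤ (1 - ε) / (n * width A) := by apply div_nonneg <;> linarith
  rw [Finset.sum_const, Finset.card_univ, Fintype.card_fin, nsmul_eq_mul, fair_of_ne hα.ne',
    ← neg_sub α 1, div_neg, mul_neg, neg_le_neg_iff]
  gcongr
  rw [Real.rpow_neg h0, ← Real.inv_rpow h0]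
  refine Real.rpow_le_rpow (inv_nonneg.2 h0) ?_ hα1.le
  rw [inv_div, div_le_iff₀ (by linarith)]
  nlinarith

/-- The iterates for `α > 1` are feasible. -/
theorem isFeasible_of_one_lt (hα : 1 < α) {y : ℕ → Fin n → ℝ}
    (h0 : ∀ j, y 0 j = (1 - ε) / (n * width A))
    (h : ∀ k j, y (k + 1) j = y k j * (1 + beta A ε α / (4 * (1 + α * beta A ε α)) * (α - 1) *
      clip (marginal A (beta A ε α) (penalty A ε α) α (y k) j)) ^ (-1 / (α - 1))) (k : ℕ) :
    (∀ j, 0 < y k j) ∧ IsFeasible A (y k) := by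
  have heps := H.eps_pos
  have heps' := H.eps_le
  have hnw := H.scaled.one_le_card_mul_width
  induction k with
  | zero =>
    have : ∀ j, 0 < y 0 j := fun j => by rw [h0 j]; exact div_pos (by linarith) (by linarith)
    exact ⟨this, fun i => (H.scaled.mulVec_const_le (by linarith) (fun j => (h0 j).le) i).trans
      (by linarith), fun j => (this j).le⟩
  | succ k ih =>
    have := H.step_of_one_lt hα ih.1 ih.2 rfl (h k)
    exact ⟨this.1, this.2.1⟩

/-- Linear convergence for `α > 1`. -/
theorem merit_le_of_one_lt (hα : 1 < α) {y : ℕ → Fin n → ℝ}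
    (h0 : ∀ j, y 0 j = (1 - ε) / (n * width A))
    (h : ∀ k j, y (k + 1) j = y k j * (1 + beta A ε α / (4 * (1 + α * beta A ε α)) * (α - 1) *
      clip (marginal A (beta A ε α) (penalty A ε α) α (y k) j)) ^ (-1 / (α - 1)))
    {v : Fin n → ℝ} (hv : ∀ j, 0 < v j) (hfv : IsFeasible A v) {k : ℕ}
    (hk : (α - 1) * Real.log (2 * (n * width A)) + Real.log (1 / (ε * (α - 1))) ≤
      beta A ε α * min (α - 1) 1 * k / 250) :
    merit A (beta A ε α) (penalty A ε α) α (y k) + ∑ j, fair α (v j) ≤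
      12 * ε * ∑ j, v j ^ (1 - α) := by
  have heps := H.eps_pos
  have heps' := H.eps_le
  have hnw := H.scaled.one_le_card_mul_width
  have hw := H.scaled.one_le_width
  have hn := H.scaled.one_le_cols
  have hble := H.beta_le
  have hab := H.alpha_mul_beta_le
  have hα1 : 0 < α - 1 := by linarith
  have hb : 0 < beta A ε α := H.beta_pos
  have hfeas := H.isFeasible_of_one_lt hα h0 h
  have hstep := fun k => (H.step_of_one_lt hα (hfeas k).1 (hfeas k).2 rfl (h k)).2.2
  obtain ⟨s, hs⟩ : ∃ s, s = beta A ε α / (4 * (1 + α * beta A ε α)) := ⟨_, rfl⟩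
  rw [← hs] at hstep
  have hμ : 0 < min (α - 1) 1 := lt_min hα1 one_pos
  have hμ1 : min (α - 1) 1 ≤ 1 := min_le_right _ _
  have hspos : 0 < s := by rw [hs]; positivity
  have hs5 : beta A ε α / 5 ≤ s := by
    rw [hs, div_le_div_iff₀ (by norm_num) (by positivity)]
    nlinarith
  have hsb : s ≤ beta A ε α / 4 := by
    rw [hs]
    gcongr
    nlinarith
  have hUn : (n : ℝ) ≤ ∑ j, v j ^ (1 - α) := by
    have : ∀ j, 1 ≤ v j ^ (1 - α) := fun j =>
      Real.one_le_rpow_of_pos_of_le_one_of_nonpos (hv j) (hfv.le_one H.scaled j) (by linarith)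
    calc (n : ℝ) = ∑ _j : Fin n, (1 : ℝ) := by simp
      _ ≤ _ := Finset.sum_le_sum fun j _ => this j
  have hvneg : ∑ j, fair α (v j) ≤ 0 := Finset.sum_nonpos fun j _ => by
    rw [fair_of_ne hα.ne']
    exact div_nonpos_of_nonneg_of_nonpos (Real.rpow_nonneg (hv j).le _) (by linarith)
  obtain ⟨E, hE⟩ : ∃ E : ℕ → ℝ, ∀ k, E k =
    merit A (beta A ε α) (penalty A ε α) α (y k) + ∑ j, fair α (v j) := ⟨_, fun _ => rfl⟩
  have hcontr := fun k => H.contraction_of_one_lt hα (hfeas k).1 hv hfv (hn.trans hUn) hspos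
    (hE k) (E' := E (k + 1)) (by rw [hE, hE]; linarith [hstep k])
  have hE0 : E 0 ≤ n * ((2 * (n * width A)) ^ (α - 1) / (α - 1)) + ε := by
    have h1 : congestion A (beta A ε α) (penalty A ε α) (y 0) ≤ ε := by
      refine (H.congestion_le (fun j => ((hfeas 0).1 j).le)
        (fun i => H.scaled.mulVec_const_le (by linarith) (fun j => (h0 j).le) i)).trans ?_
      rw [div_le_iff₀ (by positivity)]
      nlinarith
    have h2 := H.sum_fair_init_ge hα
    rw [hE, merit]
    simp only [h0]
    linarith
  rw [← hE]
  generalize ∑ j, v j ^ (1 - α) = U at *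
  have hU0 : 0 ≤ U := by linarith
  generalize hμd : min (α - 1) 1 = μ at *
  generalize beta A ε α = b at *
  clear hE hstep hvneg h hs hfeas h0 hμd
  have hsμ : s * μ ≤ 1 := by nlinarith
  -- Geometric decay of the excess over `10 ε U`, started from the gap of the uniform point.
  have hind : ∀ k, E k ≤ 10 * ε * U + Real.exp (-(s * μ * k / 50)) *
      (n * ((2 * (n * width A)) ^ (α - 1) / (α - 1)) + ε) := by
    intro k
    induction k with
    | zero =>
      have : 0 ≤ ε * U := by positivity
      simp only [Nat.cast_zero, mul_zero, zero_div, neg_zero, Real.exp_zero, one_mul]; linarith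
    | succ k ih =>
      have h1 : 1 - s * μ / 50 ≤ Real.exp (-(s * μ / 50)) := by
        linarith [Real.add_one_le_exp (-(s * μ / 50))]
      have h2 : Real.exp (-(s * μ * ((k + 1 : ℕ) : ℝ) / 50)) =
          Real.exp (-(s * μ / 50)) * Real.exp (-(s * μ * k / 50)) := by
        rw [← Real.exp_add]; push_cast; ring_nf
      rw [h2, mul_assoc (Real.exp _)]
      have h3 : 0 ≤ Real.exp (-(s * μ * k / 50)) *
        (n * ((2 * (n * width A)) ^ (α - 1) / (α - 1)) + ε) := by positivity
      generalize Real.exp (-(s * μ * k / 50)) *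
        (n * ((2 * (n * width A)) ^ (α - 1) / (α - 1)) + ε) = W at *
      have h4 := hcontr k
      have h5 : (1 - s * μ / 50) * (E k - 10 * ε * U) ≤ (1 - s * μ / 50) * W := by
        refine mul_le_mul_of_nonneg_left ?_ ?_ <;> linarith
      have h6 : (1 - s * μ / 50) * W ≤ Real.exp (-(s * μ / 50)) * W := by gcongr
      linarith
  refine (hind k).trans ?_
  have hexp : Real.exp (-(s * μ * k / 50)) ≤ Real.exp (-(b * μ * k / 250)) := by
    refine Real.exp_le_exp.2 (neg_le_neg ?_)
    have : b / 5 * (μ * k) ≤ s * (μ * k) := by gcongr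
    linarith
  -- The assumption on `k` compares the decay with the logarithm of the initial gap per coordinate,
  -- measured in units of `ε`.
  have hpow : (2 * (n * width A)) ^ (α - 1) / (α - 1) =
      ε * Real.exp ((α - 1) * Real.log (2 * (n * width A)) + Real.log (1 / (ε * (α - 1)))) := by
    rw [Real.exp_add, Real.exp_log (by positivity), Real.rpow_def_of_pos (by positivity),
      mul_comm (Real.log _)]
    field_simp
  have h1 : Real.exp (-(s * μ * k / 50)) * ((2 * (n * width A)) ^ (α - 1) / (α - 1)) ≤ ε := by
    calc _ ≤ Real.exp (-(b * μ * k / 250)) * ((2 * (n * width A)) ^ (α - 1) / (α - 1)) := by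
          gcongr
      _ ≤ Real.exp (-(b * μ * k / 250)) * (ε * Real.exp (b * μ * k / 250)) := by
          rw [hpow]; gcongr
      _ = ε := by
          rw [mul_left_comm, ← Real.exp_add]; simp
  have h2 : Real.exp (-(s * μ * k / 50)) * ε ≤ 1 * ε := by
    gcongr
    refine Real.exp_le_one_iff.2 (neg_nonpos.2 (by positivity))
  have h3 := mul_le_mul_of_nonneg_left h1 (by linarith : (0 : ℝ) ≤ n)
  have h4 : ε * n ≤ ε * U := by gcongr
  rw [mul_add, mul_left_comm]
  nlinarith

end Admissible

/-! ### The regime `α = 1` -/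

theorem fair_one (v : ℝ) : fair 1 v = Real.log v := if_pos rfl

theorem neg_two_mul_le_log_one_sub {ε : ℝ} (h : 0 < ε) (h' : ε ≤ 1 / 2) :
    -(2 * ε) ≤ Real.log (1 - ε) := by
  have h1 : 0 < 1 - ε := by linarith
  refine le_trans ?_ (Real.one_sub_inv_le_log_of_pos h1)
  rw [show 1 - (1 - ε)⁻¹ = -(ε / (1 - ε)) by field_simp; ring, neg_le_neg_iff, div_le_iff₀ h1]
  nlinarith

/-- For `t ≤ 2` this is the arithmetic-geometric inequality. The free parameter `η` is later tied to
the current gap. -/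
theorem abs_sub_one_le {t η : ℝ} (ht : 0 ≤ t) (hη : 0 < η) (hη' : η ≤ 1) :
    |t - 1| ≤ progress t / η + η / 4 := by
  unfold progress
  split_ifs with h
  · rw [← sub_le_iff_le_add, le_div_iff₀ hη, ← sq_abs (t - 1)]
    nlinarith [sq_nonneg (|t - 1| - η / 2)]
  · rw [abs_of_pos (by linarith)]
    have : t ≤ t / η := by rw [le_div_iff₀ hη]; nlinarith
    linarith

/-- Convexity of `merit` in `log y`: the tangent inequality of the barrier, then `log r ≤ r - 1` for
`r = v_j / y_j`. -/
theorem merit_one_sub_le {A : Matrix (Fin m) (Fin n) ℝ} {b C : ℝ} {y v : Fin n → ℝ} (hb : 0 < b)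
    (hA : ∀ i j, 0 ≤ A i j) (hC : 0 ≤ C) (hy : ∀ j, 0 < y j) (hv : ∀ j, 0 < v j) :
    merit A b C 1 y - merit A b C 1 v ≤
      ∑ j, (marginal A b C 1 y j - 1) * (Real.log (y j) - Real.log (v j)) := by
  have h := congestion_add_le hb hA hC (fun j => (hy j).le) fun j => (hv j).le
  have h2 : ∑ j, marginal A b C 1 y j * (Real.log (v j) - Real.log (y j)) ≤
      ∑ j, price A b C y j * (v j - y j) := by
    refine Finset.sum_le_sum fun j _ => ?_
    rw [marginal, Real.rpow_one, ← Real.log_div (hv j).ne' (hy j).ne']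
    have h3 := Real.log_le_sub_one_of_pos (div_pos (hv j) (hy j))
    have h4 := mul_nonneg (hy j).le (price_nonneg (b := b) hA hC (fun j => (hy j).le) j)
    refine (mul_le_mul_of_nonneg_left h3 h4).trans (le_of_eq ?_)
    have := (hy j).ne'
    field_simp
  have h3 : ∑ j, (marginal A b C 1 y j - 1) * (Real.log (y j) - Real.log (v j)) =
      -∑ j, marginal A b C 1 y j * (Real.log (v j) - Real.log (y j)) -
        ∑ j, Real.log (y j) + ∑ j, Real.log (v j) := by
    rw [← Finset.sum_neg_distrib, ← Finset.sum_sub_distrib, ← Finset.sum_add_distrib]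
    exact Finset.sum_congr rfl fun j _ => by ring
  rw [h3, merit, merit]
  simp only [fair_one]
  linarith

namespace Admissible

section
variable {A : Matrix (Fin m) (Fin n) ℝ} {ε α : ℝ} (H : Admissible A ε α)
include H

theorem price_le {y : Fin n → ℝ} (hy : ∀ j, 0 ≤ y j) {q : ℝ}
    (hq : ∀ i, penalty A ε α * A.mulVec y i ^ (1 / beta A ε α) ≤ q) (j : Fin n) :
    price A (beta A ε α) (penalty A ε α) y j ≤ m * (width A * q) := by
  calc _ ≤ ∑ _i : Fin m, width A * q := by
        refine Finset.sum_le_sum fun i _ => mul_le_mul (le_width A i j) (hq i)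
          (mul_nonneg H.penalty_pos.le (Real.rpow_nonneg (mulVec_nonneg H.scaled.nonneg hy i) _))
          (by linarith [H.scaled.one_le_width])
    _ = _ := by simp

theorem card_mul_width_le_scale : n * width A / ε ≤ scale A ε / 4 := by
  have h0 := H.eps_pos
  have hm := H.scaled.one_le_rows
  have := H.scaled.one_le_card_mul_width
  rw [div_le_iff₀ h0, div_mul_eq_mul_div, H.scale_mul_eps]
  nlinarith

theorem rows_mul_width_le_scale : m * width A ≤ scale A ε := by
  have h0 := H.eps_pos
  have h1 := H.eps_le
  have hm := H.scaled.one_le_rows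
  have hn := H.scaled.one_le_cols
  have hw := H.scaled.one_le_width
  rw [scale, le_div_iff₀ h0]
  have : m * width A * ε ≤ m * width A * 1 := by gcongr; linarith
  nlinarith [mul_nonneg (mul_nonneg (by linarith : (0:ℝ) ≤ m) (by linarith : 0 ≤ width A)) (by linarith : (0:ℝ) ≤ n - 1)]

end

variable {A : Matrix (Fin m) (Fin n) ℝ} {ε : ℝ} (H : Admissible A ε 1)
include H

theorem step_of_eq_one {y y' : Fin n → ℝ} (hy : ∀ j, 0 < y j) (hf : IsFeasible A y)
    (h : ∀ j, y' j = y j * Real.exp (-(beta A ε 1 / (4 * (1 + beta A ε 1)) *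
      clip (marginal A (beta A ε 1) (penalty A ε 1) 1 y j)))) :
    (∀ j, 0 < y' j) ∧ IsFeasible A y' ∧
      beta A ε 1 / 25 * ∑ j, progress (marginal A (beta A ε 1) (penalty A ε 1) 1 y j) ≤
        merit A (beta A ε 1) (penalty A ε 1) 1 y - merit A (beta A ε 1) (penalty A ε 1) 1 y' := by
  have h0 := H.eps_pos
  have h0' := H.eps_le
  have hble := H.beta_le
  have hA := H.scaled.nonneg
  have hb : 0 < beta A ε 1 := H.beta_pos
  have hC : 0 < penalty A ε 1 := H.penalty_pos
  set b := beta A ε 1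
  set C := penalty A ε 1
  obtain ⟨s, hs⟩ : ∃ s, s = b / (4 * (1 + b)) := ⟨_, rfl⟩
  rw [← hs] at h
  have hspos : 0 < s := by rw [hs]; positivity
  have hsb : s ≤ b / 4 := by
    rw [hs]
    gcongr
    linarith
  have hs5 : b / 5 ≤ s := by
    rw [hs, div_le_div_iff₀ (by norm_num) (by positivity)]
    nlinarith
  have ht : ∀ j, 0 ≤ marginal A b C 1 y j := marginal_nonneg hA hC.le fun j => (hy j).le
  refine ⟨fun j => by rw [h j]; exact mul_pos (hy j) (Real.exp_pos _), ?_, ?_⟩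
  · refine H.isFeasible_step hy hf h hspos hsb (fun j => ?_) (fun j hj => ?_) fun j hj _ => ?_
    · nlinarith [neg_one_le_clip (ht j)]
    · rw [clip_of_two_le hj]; linarith
    · rw [clip_of_two_le hj]; linarith
  · have key := merit_sub_le (α := 1) hb hA hC.le hy (y' := y') (κ := fun _ => 1 / 4)
      (e := fun _ => 0) h
      (fun j => by rw [hs]; field_simp)
      (fun j => by norm_num) (fun j => by norm_num)
      (fun j => by rw [h j, add_zero]; exact fair_sub_ge le_rfl (hy j))
    have : ∑ j, y j ^ ((1 : ℝ) - 1) * (0 - b / (1 + b) * (1 / 4 * progress (marginal A b C 1 y j) / 5)) =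
        -(s / 5 * ∑ j, progress (marginal A b C 1 y j)) := by
      rw [Finset.mul_sum, ← Finset.sum_neg_distrib]
      refine Finset.sum_congr rfl fun j _ => ?_
      rw [sub_self, Real.rpow_zero, hs]
      field_simp
      ring
    rw [this] at key
    have h3 : 0 ≤ ∑ j, progress (marginal A b C 1 y j) := Finset.sum_nonneg fun _ _ => progress_nonneg
    nlinarith

/-- A coordinate decreases only if its marginal exceeds one. Prices are at most `S ^ 5`, so then
`log y_j ≥ -5 log S`, and one short step cannot use up the remaining margin. -/
theorem log_ge_of_step {y y' : Fin n → ℝ} (hy : ∀ j, 0 < y j) (hf : IsFeasible A y)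
    (h : ∀ j, y' j = y j * Real.exp (-(beta A ε 1 / (4 * (1 + beta A ε 1)) *
      clip (marginal A (beta A ε 1) (penalty A ε 1) 1 y j)))) (j : Fin n)
    (hyj : -(6 * Real.log (2 * scale A ε)) ≤ Real.log (y j)) :
    -(6 * Real.log (2 * scale A ε)) ≤ Real.log (y' j) := by
  have h0 := H.eps_pos
  have h0' := H.eps_le
  have hble := H.beta_le
  have hA := H.scaled.nonneg
  have hb : 0 < beta A ε 1 := H.beta_pos
  have hC : 0 < penalty A ε 1 := H.penalty_pos
  have hS := H.scale_pos
  have hS8 := H.eight_le_scale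
  rw [h j, Real.log_mul (hy j).ne' (Real.exp_pos _).ne', Real.log_exp]
  set t := marginal A (beta A ε 1) (penalty A ε 1) 1 y j with htdef
  obtain ⟨s, hs⟩ : ∃ s, s = beta A ε 1 / (4 * (1 + beta A ε 1)) := ⟨_, rfl⟩
  rw [← hs]
  have hspos : 0 < s := by rw [hs]; positivity
  have hsb : s ≤ beta A ε 1 / 4 := by
    rw [hs]
    gcongr
    linarith
  rcases le_or_gt t 1 with ht | ht
  · have : clip t ≤ 0 := (min_le_left _ _).trans (by linarith)
    nlinarith
  · have hp : price A (beta A ε 1) (penalty A ε 1) y j ≤ scale A ε ^ 5 := by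
      have h1 : ∀ i, penalty A ε 1 * A.mulVec y i ^ (1 / beta A ε 1) ≤ scale A ε ^ 4 := fun i => by
        have h2 := H.penalty_le
        rw [show (2 : ℝ) * (1 + 1) = (4 : ℕ) by norm_num, Real.rpow_natCast] at h2
        have h3 : A.mulVec y i ^ (1 / beta A ε 1) ≤ 1 :=
          Real.rpow_le_one (mulVec_nonneg hA (fun j => (hy j).le) i) (hf.1 i) (by positivity)
        nlinarith
      refine (H.price_le (fun j => (hy j).le) h1 j).trans ?_
      rw [← mul_assoc, pow_succ' _ 4]
      exact mul_le_mul_of_nonneg_right H.rows_mul_width_le_scale (by positivity)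
    have h1 : 1 ≤ y j * scale A ε ^ 5 := by
      rw [htdef, marginal, Real.rpow_one] at ht
      exact ht.le.trans (mul_le_mul_of_nonneg_left hp (hy j).le)
    have h2 := Real.log_nonneg h1
    rw [Real.log_mul (hy j).ne' (by positivity), Real.log_pow] at h2
    push_cast at h2
    rw [Real.log_mul (by norm_num) hS.ne']
    have := clip_le_one t
    have := H.two_le_log_scale
    have := Real.log_nonneg (by norm_num : (1 : ℝ) ≤ 2)
    nlinarith

theorem log_scale_facts {x : ℝ} (hx : 1 / (2 * scale A ε) ≤ x) :
    -(6 * Real.log (2 * scale A ε)) ≤ Real.log x := by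
  have hS := H.scale_pos
  have h1 := Real.log_le_log (by positivity) hx
  rw [one_div, Real.log_inv] at h1
  have := Real.log_nonneg (x := 2 * scale A ε) (by linarith [H.eight_le_scale])
  linarith

/-- Sublinear convergence for `α = 1`. -/
theorem sum_fair_le_of_eq_one {y : ℕ → Fin n → ℝ} (h0 : ∀ j, y 0 j = (1 - ε) / (n * width A))
    (h : ∀ k j, y (k + 1) j = y k j * Real.exp (-(beta A ε 1 / (4 * (1 + beta A ε 1)) *
      clip (marginal A (beta A ε 1) (penalty A ε 1) 1 (y k) j))))
    {v : Fin n → ℝ} (hv : ∀ j, 0 < v j) (hfv : IsFeasible A v) (k : ℕ) :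
    (∀ j, 0 < y k j) ∧ IsFeasible A (y k) ∧
      (10 * Real.log (2 * scale A ε) ^ 2 / (ε * beta A ε 1) ≤ k →
        ∑ j, fair 1 (v j) - ∑ j, fair 1 (y k j) ≤ 250 * (ε * n)) := by
  have heps := H.eps_pos
  have heps' := H.eps_le
  have hnw := H.scaled.one_le_card_mul_width
  have hw := H.scaled.one_le_width
  have hn := H.scaled.one_le_cols
  have hA := H.scaled.nonneg
  have hb : 0 < beta A ε 1 := H.beta_pos
  have hC : 0 < penalty A ε 1 := H.penalty_pos
  have hS := H.scale_pos
  have hnws : n * width A ≤ scale A ε * ε / 4 := by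
    have := H.card_mul_width_le_scale
    rw [div_le_iff₀ heps] at this
    linarith
  have hL : 2 ≤ Real.log (2 * scale A ε) :=
    H.two_le_log_scale.trans (Real.log_le_log hS (by linarith))
  have hfeas : ∀ k, ((∀ j, 0 < y k j) ∧ IsFeasible A (y k)) ∧
      ∀ j, -(6 * Real.log (2 * scale A ε)) ≤ Real.log (y k j) := by
    intro k
    induction k with
    | zero =>
      have : ∀ j, 0 < y 0 j := fun j => by rw [h0 j]; exact div_pos (by linarith) (by linarith)
      refine ⟨⟨this, fun i => (H.scaled.mulVec_const_le (by linarith) (fun j => (h0 j).le) i).trans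
        (by linarith), fun j => (this j).le⟩, fun j => H.log_scale_facts ?_⟩
      rw [h0 j, div_le_div_iff₀ (by positivity) (by positivity)]
      nlinarith
    | succ k ih =>
      have := H.step_of_eq_one ih.1.1 ih.1.2 (h k)
      exact ⟨⟨this.1, this.2.1⟩, fun j => H.log_ge_of_step ih.1.1 ih.1.2 (h k) j (ih.2 j)⟩
  refine ⟨(hfeas k).1.1, (hfeas k).1.2, fun hk => ?_⟩
  have hdesc := fun k => (H.step_of_eq_one (hfeas k).1.1 (hfeas k).1.2 (h k)).2.2
  -- The comparator is mixed with the uniform point, to bound its logarithms from below, and then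
  -- shrunk by `1 - ε`, to create slack. Each operation costs at most `2ε` per coordinate.
  obtain ⟨w, hw'⟩ : ∃ w : Fin n → ℝ, w = fun j =>
    (1 - ε) * ((1 - ε) * v j + ε / (n * width A)) := ⟨_, rfl⟩
  have hwj : ∀ j, w j = (1 - ε) * ((1 - ε) * v j + ε / (n * width A)) := fun j => by rw [hw']
  have hdpos : 0 < ε / (n * width A) := by positivity
  have he1 : 0 < 1 - ε := by linarith
  have hwpos : ∀ j, 0 < w j := fun j => by
    rw [hwj]; exact mul_pos he1 (add_pos (mul_pos he1 (hv j)) hdpos)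
  have hwslack : ∀ i, A.mulVec w i ≤ 1 - ε := fun i => by
    have h1 : A.mulVec w i = (1 - ε) * ((1 - ε) * A.mulVec v i +
        A.mulVec (fun _ => ε / (n * width A)) i) := by
      simp only [mulVec_eq_sum, hwj, Finset.mul_sum, ← Finset.sum_add_distrib]
      exact Finset.sum_congr rfl fun j _ => by ring
    have h2 := H.scaled.mulVec_const_le heps.le (y := fun _ => ε / (n * width A))
      (fun j => le_rfl) i
    have h3 := mul_le_mul_of_nonneg_left (hfv.1 i) he1.le
    rw [h1]
    nlinarith
  have hwfeas : IsFeasible A w := ⟨fun i => (hwslack i).trans (by linarith), fun j => (hwpos j).le⟩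
  have hwlog : ∀ j, -(6 * Real.log (2 * scale A ε)) ≤ Real.log (w j) := fun j => by
    refine H.log_scale_facts ?_
    have h1 : 1 / 2 * (ε / (n * width A)) ≤ w j := by
      rw [hwj]
      have := mul_nonneg he1.le (hv j).le
      exact mul_le_mul (by linarith) (by linarith) hdpos.le he1.le
    refine le_trans ?_ h1
    rw [div_mul_div_comm, div_le_div_iff₀ (by positivity) (by positivity)]
    nlinarith
  have hwv : ∑ j, Real.log (v j) - 4 * (ε * n) ≤ ∑ j, Real.log (w j) := by
    have h1 : ∀ j, Real.log (v j) - 4 * ε ≤ Real.log (w j) := fun j => by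
      have h2 : (1 - ε) * ((1 - ε) * v j) ≤ w j := by
        rw [hwj]; exact mul_le_mul_of_nonneg_left (by linarith) he1.le
      have h3 := Real.log_le_log (mul_pos he1 (mul_pos he1 (hv j))) h2
      rw [Real.log_mul he1.ne' (mul_pos he1 (hv j)).ne', Real.log_mul he1.ne' (hv j).ne'] at h3
      linarith [neg_two_mul_le_log_one_sub heps heps']
    have h4 := Finset.sum_le_sum fun j (_ : j ∈ Finset.univ) => h1 j
    rw [Finset.sum_sub_distrib, Finset.sum_const, Finset.card_univ, Fintype.card_fin,
      nsmul_eq_mul] at h4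
    linarith
  have hφw := H.congestion_le (fun j => (hwpos j).le) hwslack
  have hwε : ε / (8 * width A) ≤ ε / 8 := by gcongr; linarith
  obtain ⟨L, hLdef⟩ : ∃ L, L = Real.log (2 * scale A ε) := ⟨_, rfl⟩
  rw [← hLdef] at hL hk hwlog hfeas
  obtain ⟨a, ha⟩ : ∃ a : ℕ → ℝ, ∀ k, a k = merit A (beta A ε 1) (penalty A ε 1) 1 (y k) -
    merit A (beta A ε 1) (penalty A ε 1) 1 w := ⟨_, fun _ => rfl⟩
  have hmono : ∀ k, a (k + 1) ≤ a k := fun k => by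
    have : 0 ≤ beta A ε 1 / 25 *
        ∑ j, progress (marginal A (beta A ε 1) (penalty A ε 1) 1 (y k) j) :=
      mul_nonneg (by positivity) (Finset.sum_nonneg fun _ _ => progress_nonneg)
    rw [ha, ha]
    linarith [hdesc k]
  have ha0 : a 0 ≤ 12 * L * n := by
    have h1 : congestion A (beta A ε 1) (penalty A ε 1) (y 0) ≤ ε / (8 * width A) :=
      H.congestion_le (fun j => ((hfeas 0).1.1 j).le)
        (fun i => H.scaled.mulVec_const_le (by linarith) (fun j => (h0 j).le) i)
    have h2 := congestion_nonneg hb hA hC.le fun j => (hwpos j).le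
    have h3 : ∑ j, fair 1 (w j) ≤ 0 := Finset.sum_nonpos fun j _ => by
      rw [fair_one]; exact Real.log_nonpos (hwpos j).le (hwfeas.le_one H.scaled j)
    have h4 : -∑ j, fair 1 (y 0 j) ≤ 6 * L * n := by
      rw [← Finset.sum_neg_distrib]
      calc _ ≤ ∑ _j : Fin n, 6 * L := Finset.sum_le_sum fun j _ => by
            rw [fair_one]; linarith [(hfeas 0).2 j]
        _ = _ := by simp [mul_comm]
    rw [ha, merit, merit]
    nlinarith
  have hak : ∀ k, a k ≤ 12 * L * n := fun k => by
    induction k with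
    | zero => exact ha0
    | succ k ih => exact (hmono k).trans ih
  -- Any factor at least `(8/7) * 72 * 25 < 2200` would do in front of `L² n / β`.
  have hsq : ∀ k, 0 ≤ a k → a k ^ 2 ≤ 2200 * L ^ 2 * n / beta A ε 1 * (a k - a (k + 1)) := by
    intro k hak0
    rcases hak0.eq_or_lt with h1 | hpos
    · have := mul_nonneg (by positivity : 0 ≤ 2200 * L ^ 2 * n / beta A ε 1)
        (sub_nonneg.2 (hmono k))
      rw [← h1] at this ⊢
      simpa using this
    have hgap := merit_one_sub_le hb hA hC.le (hfeas k).1.1 hwpos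
    rw [← ha] at hgap
    have hd := hdesc k
    have hP0 : 0 ≤ ∑ j, progress (marginal A (beta A ε 1) (penalty A ε 1) 1 (y k) j) :=
      Finset.sum_nonneg fun _ _ => progress_nonneg
    -- With this `η` the term `6 L n η / 4` is an eighth of the gap. The bound `η ≤ 1` holds because
    -- the gap never exceeds its initial bound `12 L n`.
    obtain ⟨η, hη⟩ : ∃ η, η = a k / (12 * L * n) := ⟨_, rfl⟩
    have hden : 0 < 12 * L * n := by positivity
    have hη0 : 0 < η := by rw [hη]; positivity
    have hη1 : η ≤ 1 := by rw [hη, div_le_one hden]; exact hak k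
    have hgap2 : a k ≤ 6 * L * ((∑ j, progress (marginal A (beta A ε 1) (penalty A ε 1) 1 (y k) j)) /
        η + n * (η / 4)) := by
      refine hgap.trans ?_
      have e : (∑ j, progress (marginal A (beta A ε 1) (penalty A ε 1) 1 (y k) j)) / η + n * (η / 4)
        = ∑ j, (progress (marginal A (beta A ε 1) (penalty A ε 1) 1 (y k) j) / η + η / 4) := by
        rw [Finset.sum_add_distrib, Finset.sum_div]; simp
      rw [e, Finset.mul_sum]
      refine Finset.sum_le_sum fun j _ => ?_
      have ht := marginal_nonneg (b := beta A ε 1) (C := penalty A ε 1) (α := 1) hA hC.le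
        (fun j => ((hfeas k).1.1 j).le) j
      refine (le_abs_self _).trans ?_
      rw [abs_mul, mul_comm]
      refine mul_le_mul ?_ (abs_sub_one_le ht hη0 hη1) (abs_nonneg _) (by positivity)
      have h1 := Real.log_nonpos ((hfeas k).1.1 j).le ((hfeas k).1.2.le_one H.scaled j)
      have h2 := Real.log_nonpos (hwpos j).le (hwfeas.le_one H.scaled j)
      have h3 := (hfeas k).2 j
      have h4 := hwlog j
      rw [abs_le]
      constructor <;> linarith
    have hd' : beta A ε 1 / 25 * ∑ j, progress (marginal A (beta A ε 1) (penalty A ε 1) 1 (y k) j) ≤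
        a k - a (k + 1) := by rw [ha, ha]; linarith
    generalize ∑ j, progress (marginal A (beta A ε 1) (penalty A ε 1) 1 (y k) j) = P at *
    have e1 : 6 * L * (n * (η / 4)) = a k / 8 := by rw [hη]; field_simp; norm_num
    have e2 : 6 * L * (P / η) = 72 * L ^ 2 * n * P / a k := by rw [hη]; field_simp; ring
    rw [mul_add, e1, e2] at hgap2
    have h5 : 7 / 8 * a k ^ 2 ≤ 72 * L ^ 2 * n * P := by
      have h6 : 7 / 8 * a k ≤ 72 * L ^ 2 * n * P / a k := by linarith
      rw [le_div_iff₀ hpos] at h6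
      linarith
    have h7 := mul_le_mul_of_nonneg_left hd' (by positivity : 0 ≤ 2200 * L ^ 2 * n / beta A ε 1)
    refine le_trans ?_ h7
    have e3 : 2200 * L ^ 2 * n / beta A ε 1 * (beta A ε 1 / 25 * P) = 88 * L ^ 2 * n * P := by
      field_simp; ring
    rw [e3]
    have : 0 ≤ L ^ 2 * n * P := by positivity
    linarith
  have hM := mul_le_of_sq_le_mul_sub (by positivity) hsq hmono k
  have hkpos : 0 < 10 * L ^ 2 / (ε * beta A ε 1) := by positivity
  have hfin : a k ≤ 220 * (ε * n) := by
    rcases lt_or_ge (a k) 0 with h1 | h1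
    · exact h1.le.trans (by positivity)
    have h2 := (mul_le_mul_of_nonneg_left hk h1).trans hM
    have e : 2200 * L ^ 2 * n / beta A ε 1 =
        220 * (ε * n) * (10 * L ^ 2 / (ε * beta A ε 1)) := by field_simp; norm_num
    rw [e] at h2
    exact le_of_mul_le_mul_right h2 hkpos
  have h1 := congestion_nonneg hb hA hC.le fun j => ((hfeas k).1.1 j).le
  rw [ha, merit, merit] at hfin
  simp only [fair_one] at *
  have : ε ≤ ε * n := by nlinarith
  linarith

end Admissible

/-! ### The regime `α < 1` -/

theorem exp_le_of_le {x c : ℝ} (h : x ≤ c) (hc : c < 1) : Real.exp x ≤ 1 / (1 - c) := by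
  have h1 : 0 < 1 - c := by linarith
  have h2 : 1 - c ≤ Real.exp (-x) := by linarith [Real.add_one_le_exp (-x)]
  rw [Real.exp_neg] at h2
  rw [le_div_iff₀ h1]
  have := mul_le_mul_of_nonneg_left h2 (Real.exp_pos x).le
  rwa [mul_inv_cancel₀ (Real.exp_pos x).ne'] at this

theorem one_sub_le_rpow {ε a : ℝ} (h : 0 < ε) (h' : ε ≤ 1 / 2) (ha : 0 ≤ a) :
    1 - 2 * a * ε ≤ (1 - ε) ^ a := by
  rw [Real.rpow_def_of_pos (by linarith)]
  refine le_trans ?_ (Real.add_one_le_exp _)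
  nlinarith [neg_two_mul_le_log_one_sub h h']

/-- Convexity of `merit` in `x = y ^ (1-α)`: the tangent inequality of the barrier combined with
Bernoulli's inequality for the concave power `1 - α`. -/
theorem mul_merit_sub_le {A : Matrix (Fin m) (Fin n) ℝ} {b C α : ℝ} {y v : Fin n → ℝ} (hb : 0 < b)
    (hA : ∀ i j, 0 ≤ A i j) (hC : 0 ≤ C) (hα0 : 0 ≤ α) (hα : α < 1) (hy : ∀ j, 0 < y j)
    (hv : ∀ j, 0 ≤ v j) :
    (1 - α) * (merit A b C α y - merit A b C α v) ≤
      ∑ j, (marginal A b C α y j - 1) * (y j ^ (1 - α) - v j ^ (1 - α)) := by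
  have ha : 0 < 1 - α := by linarith
  have h := mul_le_mul_of_nonneg_left
    (congestion_add_le hb hA hC (fun j => (hy j).le) hv) ha.le
  have h2 : ∑ j, marginal A b C α y j * (v j ^ (1 - α) - y j ^ (1 - α)) ≤
      (1 - α) * ∑ j, price A b C y j * (v j - y j) := by
    rw [Finset.mul_sum]
    refine Finset.sum_le_sum fun j _ => ?_
    have hp := price_nonneg (b := b) hA hC (fun j => (hy j).le) j
    have h3 := rpow_one_add_le_one_add_mul_self (s := v j / y j - 1)
      (by linarith [div_nonneg (hv j) (hy j).le]) ha.le (by linarith : 1 - α ≤ 1)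
    rw [add_sub_cancel, Real.div_rpow (hv j) (hy j).le] at h3
    have hx := Real.rpow_pos_of_pos (hy j) (1 - α)
    have hxy : y j ^ α * y j ^ (1 - α) = y j := by rw [← Real.rpow_add (hy j)]; simp
    have h4 : v j ^ (1 - α) - y j ^ (1 - α) ≤ y j ^ (1 - α) * ((1 - α) * (v j / y j - 1)) := by
      rw [div_le_iff₀ hx] at h3
      linarith
    rw [marginal]
    have h5 := mul_le_mul_of_nonneg_left h4 (mul_nonneg (Real.rpow_nonneg (hy j).le α) hp)
    refine h5.trans (le_of_eq ?_)
    calc y j ^ α * price A b C y j * (y j ^ (1 - α) * ((1 - α) * (v j / y j - 1)))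
        = (y j ^ α * y j ^ (1 - α)) * price A b C y j * ((1 - α) * (v j / y j - 1)) := by ring
      _ = _ := by
        rw [hxy]
        have := (hy j).ne'
        field_simp
  have h3 : ∑ j, (marginal A b C α y j - 1) * (y j ^ (1 - α) - v j ^ (1 - α)) =
      -∑ j, marginal A b C α y j * (v j ^ (1 - α) - y j ^ (1 - α)) -
        ∑ j, y j ^ (1 - α) + ∑ j, v j ^ (1 - α) := by
    rw [← Finset.sum_neg_distrib, ← Finset.sum_sub_distrib, ← Finset.sum_add_distrib]
    exact Finset.sum_congr rfl fun j _ => by ring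
  have h4 : ∀ z : Fin n → ℝ, (1 - α) * ∑ j, fair α (z j) = ∑ j, z j ^ (1 - α) := fun z => by
    simp only [fair_of_ne hα.ne]
    rw [← Finset.sum_div]
    field_simp
  rw [h3, merit, merit, ← h4, ← h4]
  linarith

/-- One step of mirror descent along a coordinate with potential `-Z ^ (1 - 1/D) / (1/D - 1)`. -/
theorem mirror_step_le {D Z δ : ℝ} (hD : 0 < D) (hD' : D ≤ 1 / 4) (hZ : 1 ≤ Z)
    (hδ : |δ| ≤ D / 20) :
    δ * Z ^ (-1 / D) ≤ (Z ^ (-(1 / D - 1)) - (Z + δ) ^ (-(1 / D - 1))) / (1 / D - 1) +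
      2 * Z ^ (-1 / D) * δ ^ 2 / (D * Z) := by
  have hZ0 : 0 < Z := by linarith
  have hq : 3 ≤ 1 / D - 1 := by
    have : 4 ≤ 1 / D := by rw [le_div_iff₀ hD]; linarith
    linarith
  obtain ⟨q, hqd⟩ : ∃ q, q = 1 / D - 1 := ⟨_, rfl⟩
  rw [← hqd] at hq ⊢
  have hq0 : 0 < q := by linarith
  have hv : |δ / Z| ≤ |δ| := by
    rw [abs_div, abs_of_pos hZ0]
    exact div_le_self (abs_nonneg _) hZ
  have hδ2 : |δ| ≤ 1 / 20 := by linarith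
  have hpos : 0 ≤ 1 + δ / Z := by linarith [(abs_le.1 (hv.trans hδ2)).1]
  -- Second-order expansion of the potential with `q = 1/D - 1`. The bound `|δ| ≤ D/20` keeps `q
  -- |δ/Z|` small although `q` is large.
  have h := one_add_rpow_neg_le hq0 (hv.trans hδ2) (by
    have : q * |δ / Z| ≤ (1 / D) * (D / 20) := by
      refine mul_le_mul (by linarith) (hv.trans hδ) (abs_nonneg _) (by positivity)
    have e : (1 / D) * (D / 20) = 1 / 20 := by field_simp
    linarith)
  have e1 : (Z + δ) ^ (-q) = Z ^ (-q) * (1 + δ / Z) ^ (-q) := by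
    rw [← Real.mul_rpow hZ0.le hpos]
    congr 1
    field_simp
  have e2 : Z ^ (-q) = Z ^ (-1 / D) * Z := by
    rw [show -q = -1 / D + 1 by rw [hqd]; ring, Real.rpow_add hZ0, Real.rpow_one]
  have hx := Real.rpow_pos_of_pos hZ0 (-1 / D)
  have hDq : D = 1 / (q + 1) := by rw [hqd]; field_simp; ring
  rw [e1, e2]
  have h2 := mul_le_mul_of_nonneg_left h (mul_nonneg hx.le hZ0.le)
  have h3 : Z ^ (-1 / D) * Z * (1 - q * (δ / Z) + 2 * q * (q + 1) * (δ / Z) ^ 2) =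
      Z ^ (-1 / D) * Z - q * (δ * Z ^ (-1 / D)) + q * (2 * Z ^ (-1 / D) * δ ^ 2 / (D * Z)) := by
    generalize Z ^ (-1 / D) = x
    rw [hDq]
    field_simp
  rw [h3] at h2
  rw [← sub_le_iff_le_add, le_div_iff₀ hq0]
  linarith

namespace Admissible
variable {A : Matrix (Fin m) (Fin n) ℝ} {ε α : ℝ} (H : Admissible A ε α)
include H

theorem eps_le_log : ε ≤ Real.log (n * width A / (1 - ε)) := by
  have h0 := H.eps_pos
  have h1 := H.eps_le
  have h2 := H.scaled.one_le_card_mul_width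
  have h3 : 0 < 1 - ε := by linarith
  refine le_trans ?_ (Real.log_le_log (by positivity)
    (div_le_div_of_nonneg_right h2 h3.le))
  rw [one_div, Real.log_inv]
  linarith [Real.log_le_sub_one_of_pos h3]

theorem betaDual_mul_log : betaDual A ε α * Real.log (n * width A / (1 - ε)) =
    (1 - α) * (ε / 4) := by
  have h1 := H.eps_le_log
  have h2 := H.eps_pos
  rw [betaDual, div_mul_cancel₀ _ (by linarith)]

theorem betaDual_pos (hα : α < 1) : 0 < betaDual A ε α := by
  have := H.eps_le_log
  have := H.eps_pos
  have : 0 < 1 - α := by linarith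
  rw [betaDual]
  exact div_pos (by positivity) (by linarith)

theorem betaDual_le (hα : α < 1) : betaDual A ε α ≤ (1 - α) / 4 := by
  have h1 := H.eps_le_log
  have h2 := H.eps_pos
  have : 0 < 1 - α := by linarith
  rw [betaDual, div_le_iff₀ (by linarith)]
  nlinarith

theorem betaDual_le_of_two_le (hα : α < 1) (hn : 2 ≤ n * width A) :
    betaDual A ε α ≤ 37 / 100 * ε * (1 - α) := by
  have h2 := H.eps_pos
  have h3 := H.eps_le
  have : 0 < 1 - α := by linarith
  have h1 : 69 / 100 ≤ Real.log (n * width A / (1 - ε)) := by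
    have : Real.log 2 ≤ Real.log (n * width A / (1 - ε)) := by
      refine Real.log_le_log (by norm_num) ?_
      rw [le_div_iff₀ (by linarith)]
      linarith
    linarith [Real.log_two_gt_d9]
  rw [betaDual, div_le_iff₀ (by linarith)]
  have : 0 < ε * (1 - α) := by positivity
  nlinarith

/-- Coordinates at least half the uniform point have bounded `Z`, since `log Z` is multiplied by the
small factor `β' (1-α)`. This bounds below the step length `s / Z` in the feasibility argument. -/
theorem dual_le (hα : α < 1) {Z : ℝ} (hZ : 0 < Z)
    (h : (1 - ε) / (2 * (n * width A)) ≤ Z ^ (-1 / (betaDual A ε α * (1 - α)))) : Z ≤ 10 / 7 := by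
  have h0 := H.eps_pos
  have h0' := H.eps_le
  have hα0 := H.alpha_nonneg
  have hD := H.betaDual_pos hα
  have hD4 := H.betaDual_le hα
  have hDL := H.betaDual_mul_log
  have hnw := H.scaled.one_le_card_mul_width
  have ha : 0 < 1 - α := by linarith
  generalize betaDual A ε α = D at *
  have hDa : 0 < D * (1 - α) := by positivity
  have hDa4 : D * (1 - α) ≤ 1 / 4 := by nlinarith
  have h1 := Real.log_le_log (by apply div_pos <;> linarith) h
  rw [Real.log_rpow hZ] at h1
  have h2 : Real.log ((1 - ε) / (2 * (n * width A))) =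
      -(Real.log 2 + Real.log (n * width A / (1 - ε))) := by
    rw [← Real.log_mul (by norm_num) (by apply ne_of_gt; apply div_pos <;> linarith),
      ← Real.log_inv]
    congr 1
    have : 1 - ε ≠ 0 := by linarith
    field_simp
  rw [h2] at h1
  have h3 : Real.log Z ≤ D * (1 - α) * (Real.log 2 + Real.log (n * width A / (1 - ε))) := by
    have := mul_le_mul_of_nonneg_left h1 hDa.le
    have e : D * (1 - α) * (-1 / (D * (1 - α)) * Real.log Z) = -Real.log Z := by
      field_simp
    rw [e] at this
    linarith
  have h4 : Real.log Z ≤ 3 / 10 := by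
    have h5 : (1 - α) * (D * Real.log (n * width A / (1 - ε))) ≤ ε / 4 := by
      rw [hDL]
      have h6 : (1 - α) * (1 - α) ≤ 1 := by nlinarith
      nlinarith
    nlinarith [Real.log_two_lt_d9, Real.log_two_gt_d9]
  have h5 := exp_le_of_le h4 (by norm_num)
  rw [Real.exp_log hZ] at h5
  linarith

/-- One iteration for `α < 1`. -/
theorem step_of_lt_one (hα : α < 1) {Z Z' y y' : Fin n → ℝ} (hZ : ∀ j, 1 ≤ Z j)
    (hf : IsFeasible A y) {s θ : ℝ} (hs : s = beta A ε α / (16 * (1 + α * beta A ε α)))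
    (hθ : θ = s * (betaDual A ε α * (1 - α)))
    (hy : ∀ j, y j = Z j ^ (-1 / (betaDual A ε α * (1 - α))))
    (hy' : ∀ j, y' j = Z' j ^ (-1 / (betaDual A ε α * (1 - α))))
    (hZ' : ∀ j, Z' j = Z j + θ * clip (marginal A (beta A ε α) (penalty A ε α) α y j)) :
    (∀ j, 1 ≤ Z' j) ∧ IsFeasible A y' ∧
      ∑ j, y j ^ (1 - α) *
          (s / Z j * progress (marginal A (beta A ε α) (penalty A ε α) α y j) / 6) ≤
        merit A (beta A ε α) (penalty A ε α) α y - merit A (beta A ε α) (penalty A ε α) α y' := by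
  have h0 := H.eps_pos
  have h0' := H.eps_le
  have hα0 := H.alpha_nonneg
  have hble := H.beta_le
  have hA := H.scaled.nonneg
  have hb : 0 < beta A ε α := H.beta_pos
  have hC : 0 < penalty A ε α := H.penalty_pos
  have hD : 0 < betaDual A ε α := H.betaDual_pos hα
  have hD4 := H.betaDual_le hα
  have hDL := H.betaDual_mul_log
  have hnw := H.scaled.one_le_card_mul_width
  have hdual := fun (Z : ℝ) (hZ : 0 < Z) => H.dual_le hα hZ
  have hstep := fun (y' σ : Fin n → ℝ) (hy : ∀ j, 0 < y j) (hσ : ∀ j, y' j = y j * Real.exp (-σ j)) =>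
    H.isFeasible_step hy hf hσ (s := s)
  have hsc := H.scaled
  clear H
  generalize beta A ε α = b at *
  generalize penalty A ε α = C at *
  generalize betaDual A ε α = D at *
  have ha : 0 < 1 - α := by linarith
  have hab : 0 ≤ α * b := by positivity
  have hspos : 0 < s := by rw [hs]; positivity
  have hsb : s ≤ b / 16 := by
    rw [hs]
    gcongr
    linarith
  have hDa : 0 < D * (1 - α) := by positivity
  have hDa4 : D * (1 - α) ≤ 1 / 4 := by nlinarith
  have hθpos : 0 < θ := by rw [hθ]; positivity
  have hθs : θ ≤ s := by rw [hθ]; nlinarith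
  have hZ0 : ∀ j, 0 < Z j := fun j => by linarith [hZ j]
  have hy0 : ∀ j, 0 < y j := fun j => by rw [hy]; exact Real.rpow_pos_of_pos (hZ0 j) _
  have ht : ∀ j, 0 ≤ marginal A b C α y j := marginal_nonneg hA hC.le fun j => (hy0 j).le
  have hu : ∀ j, |θ * clip (marginal A b C α y j) / Z j| ≤ 1 / 20 := fun j => by
    rw [abs_div, abs_mul, abs_of_pos hθpos, abs_of_pos (hZ0 j), div_le_iff₀ (hZ0 j)]
    have := abs_clip_le_one (ht j)
    nlinarith [hZ j]
  have hpos : ∀ j, 0 < 1 + θ * clip (marginal A b C α y j) / Z j := fun j => by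
    linarith [(abs_le.1 (hu j)).1]
  have hZmul : ∀ j, Z' j = Z j * (1 + θ * clip (marginal A b C α y j) / Z j) := fun j => by
    have := (hZ0 j).ne'
    rw [hZ']; field_simp
  have hZ'0 : ∀ j, 0 < Z' j := fun j => by rw [hZmul]; exact mul_pos (hZ0 j) (hpos j)
  choose c hc hc' hlog using fun j => exists_log_one_add_eq_mul (hu j)
  obtain ⟨σ, hσ⟩ : ∃ σ : Fin n → ℝ, ∀ j, σ j = c j * (s / Z j) * clip (marginal A b C α y j) :=
    ⟨_, fun _ => rfl⟩
  have hyσ : ∀ j, y' j = y j * Real.exp (-σ j) := fun j => by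
    rw [hy', hy, hZmul, Real.mul_rpow (hZ0 j).le (hpos j).le, Real.rpow_def_of_pos (hpos j), hlog,
      hσ, hθ]
    congr 2
    field_simp
  have hcs : ∀ j, 0 ≤ c j * (s / Z j) := fun j =>
    mul_nonneg (by linarith [hc j]) (div_nonneg hspos.le (hZ0 j).le)
  have hsZ : ∀ j, s / Z j ≤ s := fun j => div_le_self hspos.le (hZ j)
  have hcs' : ∀ j, c j * (s / Z j) ≤ 11 / 10 * s := fun j =>
    mul_le_mul (hc' j) (hsZ j) (div_nonneg hspos.le (hZ0 j).le) (by norm_num)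
  have hfeas : IsFeasible A y' := by
    refine hstep _ _ hy0 hyσ hspos (by linarith) (fun j => ?_) (fun j hj => ?_)
      fun j hj hj2 => ?_
    · rw [hσ]
      nlinarith [neg_one_le_clip (ht j), hcs j, hcs' j]
    · rw [hσ, clip_of_two_le hj, mul_one]
      exact hcs j
    · rw [hσ, clip_of_two_le hj, mul_one]
      have hZle : Z j ≤ 10 / 7 := hdual _ (hZ0 j) (hy j ▸ hj2)
      -- Together with `c j ≥ 9/10` this gives `0.63 s`, above the `0.6 s` required for large
      -- coordinates.
      have h1 : 7 / 10 * s ≤ s / Z j := by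
        rw [le_div_iff₀ (hZ0 j)]
        nlinarith
      have := hc j
      nlinarith
  refine ⟨fun j => ?_, hfeas, ?_⟩
  -- The bound `Z' ≥ 1` comes from feasibility: `Z' < 1` would make the primal coordinate exceed
  -- one.
  · by_contra! hlt
    have h1 := hfeas.le_one hsc j
    rw [hy'] at h1
    have := Real.one_lt_rpow_of_pos_of_lt_one_of_neg (hZ'0 j) hlt
      (div_neg_of_neg_of_pos (by norm_num : (-1 : ℝ) < 0) hDa)
    linarith
  · have hbs : (1 + b) / b * s ≤ 1 / 8 := by
      rw [hs, div_mul_div_comm, div_le_div_iff₀ (by positivity) (by norm_num)]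
      nlinarith [mul_pos hb hb]
    have key := merit_sub_le (α := α) hb hA hC.le hy0 (y' := y') (σ := σ)
      (κ := fun j => (1 + b) / b * (c j * (s / Z j))) (e := fun _ => 0) hyσ
      (fun j => by rw [hσ]; ring)
      (fun j => mul_nonneg (by positivity) (hcs j))
      (fun j => by
        have h1 := mul_le_mul_of_nonneg_left (hcs' j) (by positivity : 0 ≤ (1 + b) / b)
        linarith)
      (fun j => by rw [hyσ, add_zero]; exact fair_sub_ge hα.le (hy0 j))
    have : ∑ j, y j ^ (1 - α) * (s / Z j * progress (marginal A b C α y j) / 6) ≤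
        -∑ j, y j ^ (1 - α) * (0 - b / (1 + b) *
          ((1 + b) / b * (c j * (s / Z j)) * progress (marginal A b C α y j) / 5)) := by
      rw [← Finset.sum_neg_distrib]
      refine Finset.sum_le_sum fun j _ => ?_
      rw [← mul_neg]
      refine mul_le_mul_of_nonneg_left ?_ (Real.rpow_nonneg (hy0 j).le _)
      have e1 : b / (1 + b) * ((1 + b) / b * (c j * (s / Z j)) *
          progress (marginal A b C α y j) / 5) =
          c j * (s / Z j * progress (marginal A b C α y j)) / 5 := by field_simp
      rw [e1]
      have h1 : 0 ≤ s / Z j * progress (marginal A b C α y j) :=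
        mul_nonneg (div_nonneg hspos.le (hZ0 j).le) progress_nonneg
      nlinarith [hc j]
    linarith

/-- The regret of one coordinate in one iteration for `α < 1`. -/
theorem regret_step_le (hα : α < 1) {Z t u s θ M : ℝ} (hZ : 1 ≤ Z) (hZM : Z ≤ M) (ht : 0 ≤ t)
    (hu : 0 ≤ u) (hs : s = beta A ε α / (16 * (1 + α * beta A ε α)))
    (hθ : θ = s * (betaDual A ε α * (1 - α))) :
    θ * ((t - 1) * (Z ^ (-1 / betaDual A ε α) - u)) ≤
      (Z ^ (-(1 / betaDual A ε α - 1)) - (Z + θ * clip t) ^ (-(1 / betaDual A ε α - 1))) /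
        (1 / betaDual A ε α - 1) - u * (Z + θ * clip t - Z) +
      (12 * θ * (1 - α) + 6 * (betaDual A ε α * (1 - α)) * M) *
        (Z ^ (-1 / betaDual A ε α) * (s / Z * progress t / 6)) := by
  have h0 := H.eps_pos
  have h0' := H.eps_le
  have hα0 := H.alpha_nonneg
  have hble := H.beta_le
  have hb : 0 < beta A ε α := H.beta_pos
  have hD : 0 < betaDual A ε α := H.betaDual_pos hα
  have hD4 := H.betaDual_le hα
  have ha : 0 < 1 - α := by linarith
  have hspos : 0 < s := by rw [hs]; positivity
  have hsb : s ≤ beta A ε α / 16 := by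
    rw [hs]
    gcongr
    nlinarith [mul_nonneg hα0 hb.le]
  have hθpos : 0 < θ := by rw [hθ]; positivity
  have hZ0 : 0 < Z := by linarith
  generalize betaDual A ε α = D at *
  have hθD : θ ≤ D / 20 := by
    have : s * (D * (1 - α)) ≤ 1 / 20 * (D * 1) := by gcongr <;> linarith
    linarith
  have h1 := mirror_step_le hD (by linarith) hZ (δ := θ * clip t) (by
    rw [abs_mul, abs_of_pos hθpos]
    nlinarith [abs_clip_le_one ht])
  have hx := Real.rpow_pos_of_pos hZ0 (-1 / D)
  generalize Z ^ (-1 / D) = x at *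
  have hp := progress_nonneg (t := t)
  -- The quadratic error of mirror descent is charged to the decrease of `merit`, writing `θ² = θ s
  -- D (1-α)`.
  have h2 : 2 * x * (θ * clip t) ^ 2 / (D * Z) ≤
      12 * θ * (1 - α) * (x * (s / Z * progress t / 6)) := by
    have e : 2 * x * (θ * clip t) ^ 2 / (D * Z) =
        2 * (θ * (1 - α) * (x * (s / Z))) * clip t ^ 2 := by
      have : θ ^ 2 = θ * (s * (D * (1 - α))) := by rw [← hθ]; ring
      rw [mul_pow, this]
      field_simp
    have h3 := mul_le_mul_of_nonneg_left (clip_sq_le_progress t)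
      (by positivity : 0 ≤ 2 * (θ * (1 - α) * (x * (s / Z))))
    rw [e]
    linarith
  -- The truncation error at the current point is also charged to the decrease; the factor `M`
  -- compensates for the division by `Z` in the step length.
  have h3 : θ * ((t - 1 - clip t) * x) ≤
      6 * (D * (1 - α)) * M * (x * (s / Z * progress t / 6)) := by
    have h4 : θ * ((t - 1 - clip t) * x) ≤ θ * (progress t * x) := by
      gcongr
      exact sub_one_sub_clip_le_progress t
    refine h4.trans ?_
    have e : 6 * (D * (1 - α)) * M * (x * (s / Z * progress t / 6)) =
        θ * (progress t * x) * (M / Z) := by rw [hθ]; field_simp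
    rw [e]
    refine le_mul_of_one_le_right (by positivity) ?_
    rw [le_div_iff₀ hZ0]
    linarith
  -- At the comparator the truncation error has the favourable sign, because truncation only lowers
  -- the gradient and `u ≥ 0`.
  have h4 : 0 ≤ θ * ((t - 1 - clip t) * u) := by
    have : clip t ≤ t - 1 := min_le_left _ _
    exact mul_nonneg hθpos.le (mul_nonneg (by linarith) hu)
  linarith

end Admissible

/-- The point whose dual variables are `Z`, for `α < 1`. -/
def primal (D α : ℝ) (Z : Fin n → ℝ) : Fin n → ℝ := fun j => Z j ^ (-1 / (D * (1 - α)))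

theorem primal_rpow {D α : ℝ} {Z : Fin n → ℝ} (hα : α < 1) {j : Fin n} (hZ : 0 < Z j) :
    primal D α Z j ^ (1 - α) = Z j ^ (-1 / D) := by
  have : 1 - α ≠ 0 := by linarith
  rw [primal, ← Real.rpow_mul hZ.le]
  congr 1
  field_simp

/-- The arithmetic of the regret bound, with `a = 1 - α`, `X` the optimal sum, `d` the total
decrease of `merit`, `I` the initial potential terms, `N` the number of iterates and `4/a` the bound
on `Z`. The dominant error is `48 (D/a) X`, whence the need for `D ≤ O(ε a)`. -/
theorem gap_le_of_regret {ε a θ D X g d S I N : ℝ} (ha : 0 < a) (hθ : 0 < θ) (hX : 0 ≤ X)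
    (hS : N * g ≤ S) (hN : 2 ≤ N * (a * θ)) (hd : d ≤ 2 * X / a)
    (hθ' : θ ≤ ε / 128) (hD : D / a ≤ 37 / 100 * ε) (hI : I ≤ 3 / 2 * (ε * X)) (hD0 : 0 ≤ D)
    (h : θ * a * S ≤ I + (12 * θ * a + 6 * (D * a) * (4 / a)) * d) (hg : 0 < g) :
    g ≤ 20 * (ε * X) := by
  have h1 : 2 * g ≤ N * (a * θ) * g := by gcongr
  have h2 := mul_le_mul_of_nonneg_left hS (by positivity : 0 ≤ θ * a)
  have h3 : (12 * θ * a + 6 * (D * a) * (4 / a)) * d ≤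
      (12 * θ * a + 6 * (D * a) * (4 / a)) * (2 * X / a) := by gcongr
  have h4 : (12 * θ * a + 6 * (D * a) * (4 / a)) * (2 * X / a) =
      24 * θ * X + 48 * (D / a) * X := by
    field_simp
    ring
  have h6 : 48 * (D / a) * X ≤ 48 * (37 / 100 * ε) * X := by gcongr
  have h7 : 24 * θ * X ≤ 24 * (ε / 128) * X := by gcongr
  linarith

/-! ### The regret summed over the run for `α < 1` -/

namespace Admissible
variable {A : Matrix (Fin m) (Fin n) ℝ} {ε α : ℝ} (H : Admissible A ε α)
include H

theorem eps_mul_stepSize : ε * stepSize A ε α =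
    beta A ε α / (16 * (1 + α * beta A ε α)) * (betaDual A ε α * (1 - α)) := by
  have h0 := H.eps_pos
  have hα0 := H.alpha_nonneg
  have hb := H.beta_pos
  rw [stepSize]
  field_simp

/-- The initial dual value corresponds to `((1-ε)/(nρ)) ^ (1/(1-α)²)`, whose exponent is at least
one. -/
theorem primal_init_le (hα : α < 1) (j : Fin n) :
    primal (betaDual A ε α) α (fun _ : Fin n => Real.exp (ε / 4)) j ≤ (1 - ε) / (n * width A) := by
  have h0 := H.eps_pos
  have h0' := H.eps_le
  have hα0 := H.alpha_nonneg
  have hD := H.betaDual_pos hα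
  have hL := H.eps_le_log
  have hDL := H.betaDual_mul_log
  have ha : 0 < 1 - α := by linarith
  have hpos : 0 < n * width A / (1 - ε) :=
    div_pos (by linarith [H.scaled.one_le_card_mul_width]) (by linarith)
  rw [primal, ← Real.exp_mul, ← inv_div (n * width A), ← Real.exp_log hpos, ← Real.exp_neg, Real.exp_le_exp]
  have e : ε / 4 * (-1 / (betaDual A ε α * (1 - α))) =
      -(ε / 4 / (betaDual A ε α * (1 - α))) := by ring
  rw [e, neg_le_neg_iff, le_div_iff₀ (by positivity)]
  have e2 : Real.log (n * width A / (1 - ε)) * (betaDual A ε α * (1 - α)) =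
      (1 - α) * (1 - α) * (ε / 4) := by
    rw [mul_comm, mul_right_comm, hDL]; ring
  rw [e2]
  have : (1 - α) * (1 - α) ≤ 1 := by nlinarith
  nlinarith

theorem isFeasible_of_lt_one (hα : α < 1) {Z : ℕ → Fin n → ℝ}
    (h0 : ∀ j, Z 0 j = Real.exp (ε / 4))
    (h : ∀ k j, Z (k + 1) j = Z k j + ε * stepSize A ε α *
      clip (marginal A (beta A ε α) (penalty A ε α) α (primal (betaDual A ε α) α (Z k)) j))
    (k : ℕ) : (∀ j, 1 ≤ Z k j) ∧ IsFeasible A (primal (betaDual A ε α) α (Z k)) := by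
  have heps := H.eps_pos
  have heps' := H.eps_le
  induction k with
  | zero =>
    have hZ : Z 0 = fun _ => Real.exp (ε / 4) := funext h0
    rw [hZ]
    refine ⟨fun j => Real.one_le_exp (by positivity), fun i =>
      (H.scaled.mulVec_const_le (by linarith) (H.primal_init_le hα) i).trans (by linarith),
      fun j => Real.rpow_nonneg (Real.exp_pos _).le _⟩
  | succ k ih =>
    have := H.step_of_lt_one hα ih.1 ih.2 rfl H.eps_mul_stepSize (fun _ => rfl) (fun _ => rfl)
      (h k)
    exact ⟨this.1, this.2.1⟩

/-- The regret bound: the total gap of the first `k` iterates. -/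
theorem sum_gap_le (hα : α < 1) {Z : ℕ → Fin n → ℝ}
    (h0 : ∀ j, Z 0 j = Real.exp (ε / 4))
    (h : ∀ k j, Z (k + 1) j = Z k j + ε * stepSize A ε α *
      clip (marginal A (beta A ε α) (penalty A ε α) α (primal (betaDual A ε α) α (Z k)) j))
    {w : Fin n → ℝ} (hw : ∀ j, 0 ≤ w j) {M : ℝ} (k : ℕ) (hM : ∀ l < k, ∀ j, Z l j ≤ M) :
    ε * stepSize A ε α * (1 - α) * ∑ l ∈ Finset.range k,
        (merit A (beta A ε α) (penalty A ε α) α (primal (betaDual A ε α) α (Z l)) -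
          merit A (beta A ε α) (penalty A ε α) α w) ≤
      ∑ j, (Z 0 j ^ (-(1 / betaDual A ε α - 1)) / (1 / betaDual A ε α - 1) +
        w j ^ (1 - α) * (Z 0 j - Z k j)) - (∑ j, Z k j ^ (-(1 / betaDual A ε α - 1))) /
          (1 / betaDual A ε α - 1) +
      (12 * (ε * stepSize A ε α) * (1 - α) + 6 * (betaDual A ε α * (1 - α)) * M) *
        (merit A (beta A ε α) (penalty A ε α) α (primal (betaDual A ε α) α (Z 0)) -
          merit A (beta A ε α) (penalty A ε α) α (primal (betaDual A ε α) α (Z k))) := by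
  have heps := H.eps_pos
  have hα0 := H.alpha_nonneg
  have hA := H.scaled.nonneg
  have hb := H.beta_pos
  have hC := H.penalty_pos
  have hD := H.betaDual_pos hα
  have ha : 0 < 1 - α := by linarith
  have hfeas := H.isFeasible_of_lt_one hα h0 h
  induction k with
  | zero =>
    simp [Finset.sum_div]
  | succ k ih =>
    have ih' := ih fun l hl j => hM l (hl.trans k.lt_succ_self) j
    have hθpos : 0 < ε * stepSize A ε α := by
      rw [H.eps_mul_stepSize]; positivity
    have hZ1 := (hfeas k).1
    have hZpos : ∀ j, 0 < Z k j := fun j => by linarith [hZ1 j]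
    have hypos : ∀ j, 0 < primal (betaDual A ε α) α (Z k) j := fun j =>
      Real.rpow_pos_of_pos (hZpos j) _
    have ht := marginal_nonneg (α := α) (b := beta A ε α) hA hC.le fun j => (hypos j).le
    have hgap := mul_merit_sub_le hb hA hC.le hα0 hα hypos hw
    have hstep := (H.step_of_lt_one hα hZ1 (hfeas k).2 rfl H.eps_mul_stepSize (fun _ => rfl)
      (fun _ => rfl) (h k)).2.2
    change _ ≤ _ - merit A _ _ α (primal (betaDual A ε α) α (Z (k + 1))) at hstep
    have hreg := Finset.sum_le_sum fun j (_ : j ∈ Finset.univ) =>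
      H.regret_step_le hα (hZ1 j) (hM k k.lt_succ_self j) (ht j)
        (Real.rpow_nonneg (hw j) (1 - α)) rfl H.eps_mul_stepSize
    simp only [← h] at hreg
    rw [← Finset.mul_sum, Finset.sum_add_distrib, Finset.sum_sub_distrib, ← Finset.mul_sum,
      ← Finset.sum_div, Finset.sum_sub_distrib] at hreg
    simp only [primal_rpow hα (hZpos _)] at hgap hstep
    rw [Finset.sum_range_succ, mul_add]
    have h2 := mul_le_mul_of_nonneg_left hgap hθpos.le
    have hM0 : ∀ j : Fin n, 0 ≤ M := fun j => by linarith [hZ1 j, hM k k.lt_succ_self j]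
    have hM' : 0 ≤ M := hM0 (Classical.choice (by
      obtain ⟨i, j, _⟩ := H.scaled.exists_one; exact ⟨j⟩))
    have h3 := mul_le_mul_of_nonneg_left hstep
      -- The error coefficient does not depend on the iteration, so multiplied by the decrease of
      -- `merit` it telescopes, just as the potential does.
      (by positivity : 0 ≤ 12 * (ε * stepSize A ε α) * (1 - α) + 6 * (betaDual A ε α * (1 - α)) * M)
    have h4 : ∑ j, (Z 0 j ^ (-(1 / betaDual A ε α - 1)) / (1 / betaDual A ε α - 1) +
        w j ^ (1 - α) * (Z 0 j - Z (k + 1) j)) =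
        ∑ j, (Z 0 j ^ (-(1 / betaDual A ε α - 1)) / (1 / betaDual A ε α - 1) +
        w j ^ (1 - α) * (Z 0 j - Z k j)) - ∑ j, w j ^ (1 - α) * (Z (k + 1) j - Z k j) := by
      rw [← Finset.sum_sub_distrib]
      exact Finset.sum_congr rfl fun j _ => by ring
    rw [h4]
    rw [sub_div] at hreg
    linarith

theorem merit_antitone_of_lt_one (hα : α < 1) {Z : ℕ → Fin n → ℝ}
    (h0 : ∀ j, Z 0 j = Real.exp (ε / 4))
    (h : ∀ k j, Z (k + 1) j = Z k j + ε * stepSize A ε α *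
      clip (marginal A (beta A ε α) (penalty A ε α) α (primal (betaDual A ε α) α (Z k)) j)) :
    Antitone fun k => merit A (beta A ε α) (penalty A ε α) α (primal (betaDual A ε α) α (Z k)) := by
  have hfeas := H.isFeasible_of_lt_one hα h0 h
  have hb := H.beta_pos
  have hα0 := H.alpha_nonneg
  refine antitone_nat_of_succ_le fun k => ?_
  have hstep := (H.step_of_lt_one hα (hfeas k).1 (hfeas k).2 rfl H.eps_mul_stepSize
    (fun _ => rfl) (fun _ => rfl) (h k)).2.2
  refine sub_nonneg.1 (le_trans (Finset.sum_nonneg fun j _ => ?_) hstep)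
  have := (hfeas k).1 j
  refine mul_nonneg (Real.rpow_nonneg ((hfeas k).2.2 j) _)
    (div_nonneg (mul_nonneg (div_nonneg (by positivity) (by linarith)) progress_nonneg)
      (by norm_num))

/-- The uniform point is feasible and `c ≤ c ^ (1-α)` for `c ≤ 1`. It makes the absolute barrier
error `ε/(8ρ)` small relative to the optimum, which may itself be as small as `1/ρ`. -/
theorem inv_width_le {X : ℝ}
    (hopt : ∀ w, IsFeasible A w → ∑ j, w j ^ (1 - α) ≤ X) : 1 / width A ≤ X := by
  have hnw := H.scaled.one_le_card_mul_width
  have hn := H.scaled.one_le_cols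
  have hw := H.scaled.one_le_width
  have hα0 := H.alpha_nonneg
  have hpos : 0 < 1 / (n * width A) := by positivity
  refine le_trans ?_ (hopt (fun _ => 1 / (n * width A))
    ⟨H.scaled.mulVec_const_le zero_le_one fun _ => le_rfl, fun _ => hpos.le⟩)
  rw [Finset.sum_const, Finset.card_univ, Fintype.card_fin, nsmul_eq_mul]
  have h1 : 1 / (n * width A) ≤ (1 / (n * width A)) ^ (1 - α) :=
    Real.self_le_rpow_of_le_one hpos.le (by rw [div_le_one (by positivity)]; exact hnw)
      (by linarith)
  refine le_trans (le_of_eq ?_) (mul_le_mul_of_nonneg_left h1 (by linarith))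
  field_simp

theorem dual_growth_le (hα : α < 1) {Z : ℕ → Fin n → ℝ} (h0 : ∀ j, Z 0 j = Real.exp (ε / 4))
    (h : ∀ k j, Z (k + 1) j = Z k j + ε * stepSize A ε α *
      clip (marginal A (beta A ε α) (penalty A ε α) α (primal (betaDual A ε α) α (Z k)) j))
    (k : ℕ) (j : Fin n) : Z k j ≤ 1 + ε / 2 + k * (ε * stepSize A ε α) := by
  have heps := H.eps_pos
  have heps' := H.eps_le
  induction k with
  | zero =>
    have h1 := exp_le_of_le (le_refl (ε / 4)) (by linarith)
    rw [h0]
    refine h1.trans ?_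
    rw [div_le_iff₀ (by linarith)]
    push_cast
    nlinarith
  | succ k ih =>
    have hθpos : 0 ≤ ε * stepSize A ε α := by
      have := H.betaDual_pos hα
      have := H.beta_pos
      have := H.alpha_nonneg
      have : 0 < 1 - α := by linarith
      rw [H.eps_mul_stepSize]; positivity
    rw [h]
    have := clip_le_one (marginal A (beta A ε α) (penalty A ε α) α
      (primal (betaDual A ε α) α (Z k)) j)
    push_cast
    nlinarith

/-- The potential at `Z` is `x Z / (1/β' - 1)`, and `β' ≤ ε/2` once `nρ ≥ 2`. -/
theorem sum_dual_init_le (hα : α < 1) (hnw : 2 ≤ n * width A) {Z : Fin n → ℝ}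
    (h0 : ∀ j, Z j = Real.exp (ε / 4)) :
    ∑ j, Z j ^ (-(1 / betaDual A ε α - 1)) / (1 / betaDual A ε α - 1) ≤
      ε * ∑ j, primal (betaDual A ε α) α Z j ^ (1 - α) := by
  have heps := H.eps_pos
  have heps' := H.eps_le
  have hα0 := H.alpha_nonneg
  have hD := H.betaDual_pos hα
  have hD4 := H.betaDual_le hα
  have hDε := H.betaDual_le_of_two_le hα hnw
  have hZpos : ∀ j, 0 < Z j := fun j => by rw [h0]; exact Real.exp_pos _
  rw [Finset.mul_sum]
  refine Finset.sum_le_sum fun j _ => ?_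
  have hZ : Z j ≤ 8 / 7 := by
    rw [h0]
    refine (exp_le_of_le (c := 1 / 8) (by linarith) (by norm_num)).trans (by norm_num)
  rw [primal_rpow hα (hZpos j)]
  have hx := Real.rpow_pos_of_pos (hZpos j) (-1 / betaDual A ε α)
  rw [show -(1 / betaDual A ε α - 1) = -1 / betaDual A ε α + 1 by ring, Real.rpow_add (hZpos j),
    Real.rpow_one]
  generalize betaDual A ε α = D at *
  have hD1 : D ≤ 1 / 4 := by linarith
  have hq : 0 < 1 / D - 1 := by
    have : 4 ≤ 1 / D := by rw [le_div_iff₀ hD]; linarith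
    linarith
  rw [div_le_iff₀ hq, mul_comm ε, mul_assoc]
  refine mul_le_mul_of_nonneg_left ?_ hx.le
  have h1 : 2 * D ≤ ε := by
    have : 0 ≤ ε * α := by positivity
    linarith
  have h2 : ε * (1 / D - 1) ≥ 3 / 2 := by
    rw [ge_iff_le, div_sub_one hD.ne', mul_div_assoc', le_div_iff₀ hD]
    nlinarith
  linarith

/-- A point of slack `ε` whose utility is close to that of `v`. -/
theorem exists_comparator (hα : α < 1) {v : Fin n → ℝ} (hv : IsFeasible A v) :
    ∃ w, IsFeasible A w ∧
      congestion A (beta A ε α) (penalty A ε α) w ≤ ε / (8 * width A) ∧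
      ∑ j, fair α (v j) - 2 * (ε * ∑ j, v j ^ (1 - α)) ≤ ∑ j, fair α (w j) := by
  have heps := H.eps_pos
  have heps' := H.eps_le
  have ha : 0 < 1 - α := by linarith
  obtain ⟨w, hwdef⟩ : ∃ w : Fin n → ℝ, w = fun j => (1 - ε) * v j := ⟨_, rfl⟩
  have he1 : 0 < 1 - ε := by linarith
  have hw : ∀ j, 0 ≤ w j := fun j => by rw [hwdef]; exact mul_nonneg he1.le (hv.2 j)
  have hwslack : ∀ i, A.mulVec w i ≤ 1 - ε := fun i => by
    have : A.mulVec w i = (1 - ε) * A.mulVec v i := by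
      simp only [mulVec_eq_sum, hwdef, Finset.mul_sum]
      exact Finset.sum_congr rfl fun j _ => by ring
    rw [this]
    exact mul_le_of_le_one_right he1.le (hv.1 i)
  have hwfeas : IsFeasible A w := ⟨fun i => (hwslack i).trans (by linarith), hw⟩
  have hfairsum : ∀ z : Fin n → ℝ, ∑ j, fair α (z j) = (∑ j, z j ^ (1 - α)) / (1 - α) := fun z => by
    simp only [fair_of_ne hα.ne]
    rw [← Finset.sum_div]
  have hwv : ∑ j, fair α (v j) - 2 * (ε * ∑ j, v j ^ (1 - α)) ≤ ∑ j, fair α (w j) := by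
    rw [hfairsum, hfairsum, le_div_iff₀ ha, sub_mul, div_mul_cancel₀ _ ha.ne', hwdef]
    have h1 : ∀ j, (1 - 2 * (1 - α) * ε) * v j ^ (1 - α) ≤ ((1 - ε) * v j) ^ (1 - α) := fun j => by
      rw [Real.mul_rpow he1.le (hv.2 j)]
      exact mul_le_mul_of_nonneg_right (one_sub_le_rpow heps heps' ha.le)
        (Real.rpow_nonneg (hv.2 j) _)
    have h2 := Finset.sum_le_sum fun j (_ : j ∈ Finset.univ) => h1 j
    rw [← Finset.mul_sum] at h2
    linarith
  exact ⟨w, hwfeas, H.congestion_le hw hwslack, hwv⟩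

/-- The total budget available for the mirror descent and truncation errors: the barrier starts
negligible, and the utility gains at most its optimum. -/
theorem merit_drop_le (hα : α < 1) {Z : ℕ → Fin n → ℝ} (h0 : ∀ j, Z 0 j = Real.exp (ε / 4))
    (h : ∀ k j, Z (k + 1) j = Z k j + ε * stepSize A ε α *
      clip (marginal A (beta A ε α) (penalty A ε α) α (primal (betaDual A ε α) α (Z k)) j))
    {X : ℝ} (hopt : ∀ w, IsFeasible A w → ∑ j, w j ^ (1 - α) ≤ X) (k : ℕ) :
    merit A (beta A ε α) (penalty A ε α) α (primal (betaDual A ε α) α (Z 0)) -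
      merit A (beta A ε α) (penalty A ε α) α (primal (betaDual A ε α) α (Z k)) ≤
      2 * X / (1 - α) := by
  have heps := H.eps_pos
  have heps' := H.eps_le
  have ha : 0 < 1 - α := by linarith
  have hα0 := H.alpha_nonneg
  have hfeas := H.isFeasible_of_lt_one hα h0 h
  have hφ0 := H.congestion_le (fun j => (hfeas 0).2.2 j)
    (fun i => H.scaled.mulVec_const_le (by linarith) (fun j => by
      have : Z 0 = fun _ => Real.exp (ε / 4) := funext h0
      rw [this]; exact H.primal_init_le hα j) i)
  have hφK := congestion_nonneg H.beta_pos H.scaled.nonneg H.penalty_pos.le (hfeas k).2.2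
  have hX := H.inv_width_le hopt
  have hw1 := H.scaled.one_le_width
  have hoptK := hopt _ (hfeas k).2
  have hX0 : 0 ≤ X := (by positivity : 0 ≤ 1 / width A).trans hX
  have hfairsum : ∀ z : Fin n → ℝ, ∑ j, fair α (z j) = (∑ j, z j ^ (1 - α)) / (1 - α) := fun z => by
    simp only [fair_of_ne hα.ne]
    rw [← Finset.sum_div]
  rw [merit, merit, hfairsum, hfairsum]
  have h1 : (∑ j, primal (betaDual A ε α) α (Z k) j ^ (1 - α)) / (1 - α) ≤ X / (1 - α) := by
    gcongr
  have h2 : 0 ≤ (∑ j, primal (betaDual A ε α) α (Z 0) j ^ (1 - α)) / (1 - α) :=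
    div_nonneg (Finset.sum_nonneg fun j _ => Real.rpow_nonneg ((hfeas 0).2.2 j) _) ha.le
  have h3 : X ≤ X / (1 - α) := by
    rw [le_div_iff₀ ha]; nlinarith
  have h4 : ε / (8 * width A) ≤ 1 / width A := by
    rw [div_le_div_iff₀ (by positivity) (by positivity)]
    nlinarith
  rw [mul_div_assoc]
  linarith

/-- Convergence of the last iterate for `α < 1`. -/
theorem sum_fair_le_of_lt_one (hα : α < 1) (hnw : 2 ≤ n * width A) {Z : ℕ → Fin n → ℝ}
    (h0 : ∀ j, Z 0 j = Real.exp (ε / 4))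
    (h : ∀ k j, Z (k + 1) j = Z k j + ε * stepSize A ε α *
      clip (marginal A (beta A ε α) (penalty A ε α) α (primal (betaDual A ε α) α (Z k)) j))
    {v : Fin n → ℝ} (hv : IsFeasible A v)
    (hopt : ∀ w, IsFeasible A w → ∑ j, w j ^ (1 - α) ≤ ∑ j, v j ^ (1 - α)) {k : ℕ}
    (hk : 2 / ((1 - α) * stepSize A ε α * ε) ≤ k + 1)
    (hk' : k ≤ 2 / ((1 - α) * stepSize A ε α * ε)) :
    ∑ j, fair α (v j) - ∑ j, fair α (primal (betaDual A ε α) α (Z k) j) ≤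
      25 * (ε * ∑ j, v j ^ (1 - α)) := by
  have heps := H.eps_pos
  have heps' := H.eps_le
  have hα0 := H.alpha_nonneg
  have hA := H.scaled.nonneg
  have hb := H.beta_pos
  have hble := H.beta_le
  have hC := H.penalty_pos
  have hD := H.betaDual_pos hα
  have hD4 := H.betaDual_le hα
  have hDε := H.betaDual_le_of_two_le hα hnw
  have ha : 0 < 1 - α := by linarith
  have hw1 := H.scaled.one_le_width
  have hfeas := H.isFeasible_of_lt_one hα h0 h
  have hθdef := H.eps_mul_stepSize
  have hθpos : 0 < ε * stepSize A ε α := by rw [hθdef]; positivity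
  have hgrow := H.dual_growth_le hα h0 h
  have hanti := H.merit_antitone_of_lt_one hα h0 h
  have hinit := H.sum_dual_init_le hα hnw h0
  have hX := H.inv_width_le hopt
  rw [show (1 - α) * stepSize A ε α * ε = (1 - α) * (ε * stepSize A ε α) by ring] at hk hk'
  have hθD : ε * stepSize A ε α ≤ ε / 128 := by
    rw [hθdef]
    have h1 : beta A ε α / (16 * (1 + α * beta A ε α)) ≤ beta A ε α / 16 := by
      gcongr
      nlinarith [mul_nonneg hα0 hb.le]
    have h2 : betaDual A ε α * (1 - α) ≤ 1 := by nlinarith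
    have h3 : 0 ≤ beta A ε α / (16 * (1 + α * beta A ε α)) := by positivity
    nlinarith
  obtain ⟨w, hwfeas, hφw, hwv⟩ := H.exists_comparator hα hv
  have hw := hwfeas.2
  have hkθ : k * (ε * stepSize A ε α) ≤ 2 / (1 - α) := by
    rw [le_div_iff₀ (by positivity)] at hk' ⊢
    linarith
  -- A dual coordinate grows by at most `ε h` per step, and `k ε h ≤ 2/(1-α)`; this is where the
  -- upper bound on `k` enters.
  have hM : ∀ l < k + 1, ∀ j, Z l j ≤ 4 / (1 - α) := fun l hl j => by
    have h1 := hgrow l j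
    have h2 : (l : ℝ) * (ε * stepSize A ε α) ≤ k * (ε * stepSize A ε α) := by
      have : (l : ℝ) ≤ k := by exact_mod_cast Nat.lt_succ_iff.1 hl
      gcongr
    have h3 : 2 ≤ 2 / (1 - α) := by rw [le_div_iff₀ ha]; linarith
    have h4 : 4 / (1 - α) = 2 / (1 - α) + 2 / (1 - α) := by ring
    linarith
  have hreg := H.sum_gap_le hα h0 h hw (k + 1) hM
  have hφk := congestion_nonneg hb hA hC.le (hfeas k).2.2
  have hwε : ε / (8 * width A) ≤ ε * ∑ j, v j ^ (1 - α) := by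
    have h1 := mul_le_mul_of_nonneg_left hX heps.le
    refine le_trans ?_ h1
    rw [mul_one_div]
    gcongr
    linarith
  have hopt0 := hopt _ (hfeas 0).2
  have hX0 : 0 ≤ ∑ j, v j ^ (1 - α) := (by positivity : 0 ≤ 1 / width A).trans hX
  -- The linear part of the telescoped potential: `Z 0 ≤ 1 + ε/2`, while later dual variables are at
  -- least one.
  have hZKw : ∑ j, w j ^ (1 - α) * (Z 0 j - Z (k + 1) j) ≤ ε / 2 * ∑ j, v j ^ (1 - α) := by
    refine le_trans ?_ (mul_le_mul_of_nonneg_left (hopt w hwfeas) (by positivity))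
    rw [Finset.mul_sum]
    refine Finset.sum_le_sum fun j _ => ?_
    have h1 := hgrow 0 j
    have h2 := (hfeas (k + 1)).1 j
    have h3 := Real.rpow_nonneg (hw j) (1 - α)
    push_cast at h1
    nlinarith
  have hZnn : 0 ≤ (∑ j, Z (k + 1) j ^ (-(1 / betaDual A ε α - 1))) / (1 / betaDual A ε α - 1) := by
    refine div_nonneg (Finset.sum_nonneg fun j _ => Real.rpow_nonneg ?_ _) ?_
    · linarith [(hfeas (k + 1)).1 j]
    · rw [sub_nonneg, le_div_iff₀ hD]; linarith
  have hdrop := H.merit_drop_le hα h0 h hopt (k + 1)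
  have hgap : merit A (beta A ε α) (penalty A ε α) α (primal (betaDual A ε α) α (Z k)) -
      merit A (beta A ε α) (penalty A ε α) α w ≤ 20 * (ε * ∑ j, v j ^ (1 - α)) := by
    rcases le_or_gt (merit A (beta A ε α) (penalty A ε α) α (primal (betaDual A ε α) α (Z k)) -
      merit A (beta A ε α) (penalty A ε α) α w) 0 with hneg | hpos
    · exact hneg.trans (by positivity)
    -- By monotonicity of `merit` the last gap is the smallest of the `k + 1` gaps.
    have hsum : (k + 1) *
        (merit A (beta A ε α) (penalty A ε α) α (primal (betaDual A ε α) α (Z k)) -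
          merit A (beta A ε α) (penalty A ε α) α w) ≤ ∑ l ∈ Finset.range (k + 1),
        (merit A (beta A ε α) (penalty A ε α) α (primal (betaDual A ε α) α (Z l)) -
          merit A (beta A ε α) (penalty A ε α) α w) := by
      have := Finset.card_nsmul_le_sum (Finset.range (k + 1)) (fun l =>
        merit A (beta A ε α) (penalty A ε α) α (primal (betaDual A ε α) α (Z l)) -
          merit A (beta A ε α) (penalty A ε α) α w)
        (merit A (beta A ε α) (penalty A ε α) α (primal (betaDual A ε α) α (Z k)) -
          merit A (beta A ε α) (penalty A ε α) α w) (fun l hl => sub_le_sub_right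
            (hanti (Nat.lt_succ_iff.1 (Finset.mem_range.1 hl))) _)
      rw [Finset.card_range, nsmul_eq_mul] at this
      push_cast at this
      exact this
    rw [Finset.sum_add_distrib] at hreg
    refine gap_le_of_regret ha hθpos hX0 hsum ?_ hdrop hθD ?_ ?_ hD.le
      (hreg.trans (add_le_add (sub_le_self _ hZnn) le_rfl)) hpos
    · rwa [div_le_iff₀ (by positivity)] at hk
    · rwa [div_le_iff₀ ha]
    · have h1 := mul_le_mul_of_nonneg_left hopt0 heps.le
      linarith
  have hεX := mul_nonneg heps.le hX0
  rw [merit, merit] at hgap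
  linarith

/-! ### The case of one variable for `α < 1` -/

theorem single_marginal_le {y : Fin n → ℝ} (hy : ∀ j, 0 < y j)
    (hy' : ∀ j, y j ≤ (1 - ε) / (n * width A)) (j : Fin n) :
    marginal A (beta A ε α) (penalty A ε α) α y j ≤ 1 / 2 := by
  have heps := H.eps_pos
  have heps' := H.eps_le
  have hS := H.eight_le_scale
  have hS0 := H.scale_pos
  have hnw := H.scaled.one_le_card_mul_width
  have h1 := H.price_le (fun j => (hy j).le) (fun i => H.penalty_mul_le
    (mulVec_nonneg H.scaled.nonneg (fun j => (hy j).le) i)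
    (H.scaled.mulVec_const_le (by linarith) hy' i)) j
  have h2 : m * (width A * (1 / scale A ε ^ 2)) ≤ 1 / 2 := by
    rw [← mul_assoc, mul_one_div, div_le_div_iff₀ (by positivity) (by norm_num)]
    nlinarith [H.rows_mul_width_le_scale]
  have hy1 : y j ≤ 1 := by
    refine (hy' j).trans ?_
    rw [div_le_one (by linarith)]
    linarith
  have h3 : y j ^ α ≤ 1 := Real.rpow_le_one (hy j).le hy1 H.alpha_nonneg
  have h4 := price_nonneg (b := beta A ε α) H.scaled.nonneg H.penalty_pos.le (fun j => (hy j).le) j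
  rw [marginal]
  nlinarith

theorem stepSize_mul_le (hα : α < 1) : 0 < ε * stepSize A ε α ∧ ε * stepSize A ε α ≤
    ε / 128 * (betaDual A ε α * (1 - α)) := by
  have hb := H.beta_pos
  have hble := H.beta_le
  have hα0 := H.alpha_nonneg
  have hD := H.betaDual_pos hα
  have ha : 0 < 1 - α := by linarith
  have h1 : beta A ε α / (16 * (1 + α * beta A ε α)) ≤ beta A ε α / 16 := by
    gcongr
    nlinarith [mul_nonneg hα0 hb.le]
  rw [H.eps_mul_stepSize]
  refine ⟨by positivity, mul_le_mul_of_nonneg_right (by linarith) (by positivity)⟩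

/-- While the coordinate lies below `(1-ε)/(nρ)`, whose dual value is `W`, its marginal is at most
`1/2` and `Z` falls by at least half a step length. Once `Z ≤ W`, it can overshoot by one step only.
-/
theorem single_dual_le (hα : α < 1) (hn : n = 1) {Z : ℕ → Fin n → ℝ}
    (h0 : ∀ j, Z 0 j = Real.exp (ε / 4))
    (h : ∀ k j, Z (k + 1) j = Z k j + ε * stepSize A ε α *
      clip (marginal A (beta A ε α) (penalty A ε α) α (primal (betaDual A ε α) α (Z k)) j))
    {W : ℝ} (hW : 0 < W)
    (hWy : W ^ (-1 / (betaDual A ε α * (1 - α))) = (1 - ε) / (n * width A)) (k : ℕ) (j : Fin n) :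
    Z k j ≤ W + ε * stepSize A ε α ∨ Z k j ≤ Real.exp (ε / 4) - k * (ε * stepSize A ε α / 2) := by
  have hfeas := H.isFeasible_of_lt_one hα h0 h
  have hD := H.betaDual_pos hα
  have ha : 0 < 1 - α := by linarith
  obtain ⟨hθ, -⟩ := H.stepSize_mul_le hα
  induction k with
  | zero => right; simp [h0]
  | succ k ih =>
    have hZpos : ∀ j, 0 < Z k j := fun j => by linarith [(hfeas k).1 j]
    rw [h]
    rcases le_or_gt (Z k j) W with hle | hlt
    · left
      nlinarith [clip_le_one (marginal A (beta A ε α) (penalty A ε α) α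
        (primal (betaDual A ε α) α (Z k)) j)]
    · have hsub : ∀ j', j' = j := fun j' => by
        subst hn; exact Subsingleton.elim _ _
      have ht := H.single_marginal_le (α := α) (y := primal (betaDual A ε α) α (Z k))
        (fun j => Real.rpow_pos_of_pos (hZpos j) _)
        (fun j' => by
          rw [← hWy, hsub j']
          exact Real.rpow_le_rpow_of_nonpos hW hlt.le
            (div_nonpos_of_nonpos_of_nonneg (by norm_num) (by positivity))) j
      have hc : clip (marginal A (beta A ε α) (penalty A ε α) α
          (primal (betaDual A ε α) α (Z k)) j) ≤ -(1 / 2) := (min_le_left _ _).trans (by linarith)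
      push_cast
      rcases ih with ih | ih
      · left; nlinarith
      · right; nlinarith

/-- Convergence for `α < 1` when a single variable is present. -/
theorem single_fair_le (hα : α < 1) (hnw : n * width A < 2) {Z : ℕ → Fin n → ℝ}
    (h0 : ∀ j, Z 0 j = Real.exp (ε / 4))
    (h : ∀ k j, Z (k + 1) j = Z k j + ε * stepSize A ε α *
      clip (marginal A (beta A ε α) (penalty A ε α) α (primal (betaDual A ε α) α (Z k)) j))
    {v : Fin n → ℝ} (hv : IsFeasible A v) {k : ℕ}
    (hk : 2 / ((1 - α) * stepSize A ε α * ε) ≤ k + 1) :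
    ∑ j, fair α (v j) - ∑ j, fair α (primal (betaDual A ε α) α (Z k) j) ≤
      25 * (ε * ∑ j, v j ^ (1 - α)) := by
  have heps := H.eps_pos
  have heps' := H.eps_le
  have hα0 := H.alpha_nonneg
  have hw := H.scaled.one_le_width
  have hD := H.betaDual_pos hα
  have hD4 := H.betaDual_le hα
  have ha : 0 < 1 - α := by linarith
  have hn : n = 1 := by
    have h1 := H.scaled.one_le_cols
    have h2 : (n : ℝ) < 2 := by nlinarith
    have h3 : n < 2 := by exact_mod_cast h2
    have h4 : 1 ≤ n := by exact_mod_cast h1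
    omega
  have hnw1 := H.scaled.one_le_card_mul_width
  have hfeas := H.isFeasible_of_lt_one hα h0 h
  obtain ⟨hθ, hθ'⟩ := H.stepSize_mul_le hα
  have hr : 0 < betaDual A ε α * (1 - α) := by positivity
  have he1 : 0 < 1 - ε := by linarith
  have hypos : 0 < (1 - ε) / (n * width A) := div_pos he1 (by linarith)
  obtain ⟨W, hWdef⟩ : ∃ W, W = ((1 - ε) / (n * width A)) ^ (-(betaDual A ε α * (1 - α))) :=
    ⟨_, rfl⟩
  have hW1 : 1 ≤ W := by
    rw [hWdef]
    refine Real.one_le_rpow_of_pos_of_le_one_of_nonpos hypos ?_ (by linarith)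
    rw [div_le_one (by linarith)]
    linarith
  have hWy : W ^ (-1 / (betaDual A ε α * (1 - α))) = (1 - ε) / (n * width A) := by
    rw [hWdef, ← Real.rpow_mul hypos.le,
      show -(betaDual A ε α * (1 - α)) * (-1 / (betaDual A ε α * (1 - α))) = 1 by field_simp,
      Real.rpow_one]
  have hr1 : betaDual A ε α * (1 - α) ≤ 1 := by nlinarith
  have hZ : ∀ j, Z k j ≤ W + ε * stepSize A ε α := fun j => by
    rcases H.single_dual_le hα hn h0 h (by linarith) hWy k j with h1 | h1
    · exact h1
    · exfalso
      have h2 := (hfeas k).1 j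
      have h3 : Real.exp (ε / 4) ≤ 8 / 7 :=
        (exp_le_of_le (c := 1 / 8) (by linarith) (by norm_num)).trans (by norm_num)
      -- The run is so long that the second alternative would push `Z` below one.
      rw [show (1 - α) * stepSize A ε α * ε = (1 - α) * (ε * stepSize A ε α) by ring,
        div_le_iff₀ (by positivity)] at hk
      have h4 : (k + 1) * ((1 - α) * (ε * stepSize A ε α)) ≤ (k + 1) * (ε * stepSize A ε α) := by
        refine mul_le_mul_of_nonneg_left ?_ (by positivity)
        nlinarith
      nlinarith
  -- One factor `1 - ε` is the distance of the target from the optimum `1/(nρ)`, the other pays for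
  -- the overshoot `ε h ≤ (ε/128) β' (1-α)`.
  have hkey : ∀ j, (1 - ε) ^ 2 * v j ≤ primal (betaDual A ε α) α (Z k) j := fun j => by
    have hZj := (hfeas k).1 j
    have hvj : v j ≤ 1 / (n * width A) := by
      subst hn
      have : Nonempty (Fin m × Fin 1) := by
        obtain ⟨i, j, _⟩ := H.scaled.exists_one
        exact ⟨(i, j)⟩
      obtain ⟨p, hp⟩ := exists_eq_ciSup_of_finite (f := fun p : Fin m × Fin 1 => A p.1 p.2)
      have h1 := hv.1 p.1
      rw [mulVec_eq_sum, Finset.univ_unique, Finset.sum_singleton, Subsingleton.elim default p.2,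
        Subsingleton.elim p.2 j] at h1
      rw [Subsingleton.elim p.2 j] at hp
      change A p.1 j = width A at hp
      rw [hp] at h1
      rw [le_div_iff₀ (by linarith)]
      push_cast
      linarith
    have h1 : Z k j ≤ W * (1 + ε * stepSize A ε α) := by nlinarith [hZ j]
    have h2 : (W * (1 + ε * stepSize A ε α)) ^ (-1 / (betaDual A ε α * (1 - α))) ≤
        primal (betaDual A ε α) α (Z k) j :=
      Real.rpow_le_rpow_of_nonpos (by linarith) h1
        (div_nonpos_of_nonpos_of_nonneg (by norm_num) hr.le)
    rw [Real.mul_rpow (by linarith) (by linarith), hWy] at h2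
    have h3 : 1 - ε ≤ (1 + ε * stepSize A ε α) ^ (-1 / (betaDual A ε α * (1 - α))) := by
      rw [Real.rpow_def_of_pos (by linarith)]
      refine le_trans ?_ (Real.add_one_le_exp _)
      have h4 : Real.log (1 + ε * stepSize A ε α) ≤ ε * stepSize A ε α := by
        linarith [Real.log_le_sub_one_of_pos (x := 1 + ε * stepSize A ε α) (by linarith)]
      have h5 : Real.log (1 + ε * stepSize A ε α) * (-1 / (betaDual A ε α * (1 - α))) =
          -(Real.log (1 + ε * stepSize A ε α) / (betaDual A ε α * (1 - α))) := by ring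
      have h6 : Real.log (1 + ε * stepSize A ε α) / (betaDual A ε α * (1 - α)) ≤ ε := by
        rw [div_le_iff₀ hr]
        nlinarith [mul_pos heps hr]
      rw [h5]
      linarith
    refine le_trans ?_ h2
    calc (1 - ε) ^ 2 * v j ≤ (1 - ε) ^ 2 * (1 / (n * width A)) := by gcongr
      _ = (1 - ε) / (n * width A) * (1 - ε) := by ring
      _ ≤ _ := by gcongr
  rw [← Finset.sum_sub_distrib, Finset.mul_sum, Finset.mul_sum]
  refine Finset.sum_le_sum fun j _ => ?_
  have hvj := Real.rpow_nonneg (hv.2 j) (1 - α)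
  have h1 := Real.rpow_le_rpow (mul_nonneg (sq_nonneg _) (hv.2 j)) (hkey j) ha.le
  rw [Real.mul_rpow (sq_nonneg _) (hv.2 j), ← Real.rpow_natCast, ← Real.rpow_mul he1.le] at h1
  have h2 := one_sub_le_rpow heps heps' (a := ((2 : ℕ) : ℝ) * (1 - α)) (by positivity)
  have h3 := (mul_le_mul_of_nonneg_right h2 hvj).trans h1
  rw [fair_of_ne hα.ne, fair_of_ne hα.ne, ← sub_div, div_le_iff₀ ha]
  push_cast at h3
  have : 0 ≤ ε * v j ^ (1 - α) * (1 - α) := by positivity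
  linarith

end Admissible

/-! ### The truncated gradient -/

theorem transform_of_ne {α : ℝ} (h : α ≠ 1) (x : Fin n → ℝ) (j : Fin n) :
    transform α x j = x j ^ (1 / (1 - α)) := if_neg h

theorem transform_one (x : Fin n → ℝ) (j : Fin n) : transform 1 x j = Real.exp (x j) := if_pos rfl

theorem transform_pos {α : ℝ} {x : Fin n → ℝ} (hx : α ≠ 1 → ∀ j, 0 < x j) (j : Fin n) :
    0 < transform α x j := by
  by_cases h : α = 1
  · subst h; rw [transform_one]; exact Real.exp_pos _
  · rw [transform_of_ne h]; exact Real.rpow_pos_of_pos (hx h j) _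

theorem hasDerivAt_transform {α : ℝ} {x : Fin n → ℝ} (hx : α ≠ 1 → ∀ j, 0 < x j) (j : Fin n) :
    HasDerivAt (fun t => transform α (Function.update x j t))
      (Pi.single j ((if α = 1 then 1 else 1 / (1 - α)) * transform α x j ^ α)) (x j) := by
  rw [hasDerivAt_pi]
  intro k
  have hu := hasDerivAt_pi.1 (hasDerivAt_update x j (x j)) k
  by_cases h : α = 1
  · subst h
    simp only [transform_one, if_true, Real.rpow_one, one_mul]
    have := hu.exp
    rw [Function.update_eq_self] at this
    refine this.congr_deriv ?_
    rcases eq_or_ne k j with rfl | hk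
    · simp
    · simp [hk]
  · simp only [transform_of_ne h, if_neg h]
    have hne : 1 - α ≠ 0 := fun h' => h (by linarith)
    have := hu.rpow_const (p := 1 / (1 - α)) (Or.inl (by
      rw [Function.update_eq_self]; exact (hx h k).ne'))
    rw [Function.update_eq_self] at this
    refine this.congr_deriv ?_
    rcases eq_or_ne k j with rfl | hk
    · simp only [Pi.single_eq_same, one_mul]
      rw [← Real.rpow_mul (hx h k).le]
      congr 2
      field_simp
      ring
    · simp [hk]

/-- Chain rule: the derivative of `F_α` is `y ^ α / (1-α)` (`y` if `α = 1`), and the scaling factor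
in front removes the denominator. -/
theorem partialDeriv_regularized {A : Matrix (Fin m) (Fin n) ℝ} {ε α : ℝ} (H : Admissible A ε α)
    {x : Fin n → ℝ} (hx : α ≠ 1 → ∀ j, 0 < x j) (j : Fin n) :
    (if α = 1 then 1 else 1 - α) * partialDeriv (regularized A ε α) j x =
      marginal A (beta A ε α) (penalty A ε α) α (transform α x) j - 1 := by
  have hb := H.beta_pos
  have hypos := transform_pos hx
  set F : ℝ := (if α = 1 then 1 else 1 / (1 - α)) with hF
  have hlin : HasDerivAt (fun t => linearObjective α (Function.update x j t)) F (x j) := by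
    have hsum : HasDerivAt (fun t => ∑ k, Function.update x j t k) 1 (x j) := by
      have := HasDerivAt.fun_sum (u := Finset.univ) fun k (_ : k ∈ Finset.univ) =>
        hasDerivAt_pi.1 (hasDerivAt_update x j (x j)) k
      simpa using this
    unfold linearObjective
    rw [hF]
    split_ifs with h
    · exact hsum
    · exact hsum.div_const _
  have hrow : ∀ i, HasDerivAt (fun t => A.mulVec (transform α (Function.update x j t)) i)
      (A i j * (F * transform α x j ^ α)) (x j) := fun i => by
    simp only [mulVec_eq_sum]
    have := HasDerivAt.fun_sum (u := Finset.univ) fun k (_ : k ∈ Finset.univ) =>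
        (hasDerivAt_pi.1 (hasDerivAt_transform hx j) k).const_mul (A i k)
    refine this.congr_deriv ?_
    rw [Finset.sum_eq_single j]
    · simp [hF]
    · intro k _ hk; simp [hk]
    · simp
  have hreg : HasDerivAt (fun t => regularized A ε α (Function.update x j t))
      (-F + F * marginal A (beta A ε α) (penalty A ε α) α (transform α x) j) (x j) := by
    have hp : 1 ≤ (1 + beta A ε α) / beta A ε α := by rw [le_div_iff₀ hb]; linarith
    have hpow := HasDerivAt.fun_sum (u := Finset.univ) fun i (_ : i ∈ Finset.univ) =>
      (hrow i).rpow_const (p := (1 + beta A ε α) / beta A ε α) (Or.inr hp)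
    refine (hlin.neg.add (hpow.const_mul
      (penalty A ε α * beta A ε α / (1 + beta A ε α)))).congr_deriv ?_
    congr 1
    rw [Function.update_eq_self, marginal, price, Finset.mul_sum, Finset.mul_sum, Finset.mul_sum]
    refine Finset.sum_congr rfl fun i _ => ?_
    have e : (1 + beta A ε α) / beta A ε α - 1 = 1 / beta A ε α := by field_simp; ring
    rw [e]
    field_simp
  rw [partialDeriv, hreg.deriv, hF]
  split_ifs with h
  · ring
  · have hne : 1 - α ≠ 0 := fun h' => h (by linarith)
    field_simp
    ring

/-- As `t - 1 ≥ -1` always, the default value one is taken only when the derivative is too large. -/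
theorem truncate_eq_clip {t : ℝ} (ht : 0 ≤ t) :
    (if -1 ≤ t - 1 ∧ t - 1 ≤ 1 then t - 1 else 1) = clip t := by
  split_ifs with h
  · exact (min_eq_left h.2).symm
  · exact (min_eq_right (by
      by_contra! h2
      exact h ⟨by linarith, h2.le⟩)).symm

theorem state_succ (A : Matrix (Fin m) (Fin n) ℝ) (ε α : ℝ) (k : ℕ) :
    state A ε α (k + 1) = step A ε α (state A ε α k) :=
  Function.iterate_succ_apply' _ _ _

namespace Admissible
variable {A : Matrix (Fin m) (Fin n) ℝ} {ε α : ℝ} (H : Admissible A ε α)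
include H

theorem truncGrad_eq {x : Fin n → ℝ} (hx : α ≠ 1 → ∀ j, 0 < x j) (j : Fin n) :
    truncGrad A ε α x j =
      clip (marginal A (beta A ε α) (penalty A ε α) α (transform α x) j) := by
  simp only [truncGrad]
  rw [partialDeriv_regularized H hx j]
  exact truncate_eq_clip (marginal_nonneg H.scaled.nonneg H.penalty_pos.le
    (fun j => (transform_pos hx j).le) j)

theorem init_value_pos : 0 < (1 - ε) / (n * width A) :=
  div_pos (by linarith [H.eps_le]) (by linarith [H.scaled.one_le_card_mul_width])

/-! ### The iterates in the original variables -/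

theorem state_pos_of_one_lt (hα : 1 < α) (k : ℕ) (j : Fin n) : 0 < (state A ε α k).x j := by
  induction k generalizing j with
  | zero =>
    simp only [state, Function.iterate_zero, id, init, if_neg hα.ne']
    exact Real.rpow_pos_of_pos H.init_value_pos _
  | succ k ih =>
    rw [state_succ]
    simp only [step, if_neg hα.not_gt, if_neg hα.ne']
    rw [H.truncGrad_eq fun _ => ih]
    refine mul_pos ?_ (ih j)
    have hb := H.beta_pos
    have ht := abs_clip_le_one (marginal_nonneg (b := beta A ε α) (α := α) H.scaled.nonneg
      H.penalty_pos.le (fun j => (transform_pos (α := α) (fun _ => ih) j).le) j)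
    have h1 := abs_le.1 ht
    have hbm := H.beta_mul_le
    rw [sub_pos, div_lt_one (by have := H.alpha_nonneg; positivity)]
    have h2 : 0 < beta A ε α * (α - 1) := mul_pos hb (by linarith)
    nlinarith [H.eps_le, mul_nonneg H.alpha_nonneg hb.le]

theorem solution_zero_of_one_le (hα : 1 ≤ α) (j : Fin n) :
    solution A ε α 0 j = (1 - ε) / (n * width A) := by
  have h := H.init_value_pos
  simp only [solution, state, Function.iterate_zero, id, init, transform]
  split_ifs with h1
  · exact Real.exp_log h
  · have : 1 - α ≠ 0 := fun h' => h1 (by linarith)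
    rw [← Real.rpow_mul h.le, mul_one_div_cancel this, Real.rpow_one]

theorem solution_succ_of_one_lt (hα : 1 < α) (k : ℕ) (j : Fin n) :
    solution A ε α (k + 1) j = solution A ε α k j *
      (1 + beta A ε α / (4 * (1 + α * beta A ε α)) * (α - 1) *
        clip (marginal A (beta A ε α) (penalty A ε α) α (solution A ε α k) j)) ^
          (-1 / (α - 1)) := by
  have hpos := H.state_pos_of_one_lt hα
  have hk := hpos (k + 1) j
  rw [state_succ] at hk
  simp only [solution, transform_of_ne hα.ne']
  rw [state_succ]
  simp only [step, if_neg hα.not_gt, if_neg hα.ne'] at hk ⊢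
  rw [H.truncGrad_eq fun _ => hpos k] at hk ⊢
  -- Positivity of the update factor, read off from that of two successive states, lets the power be
  -- distributed over the product.
  have h1 := (pos_iff_pos_of_mul_pos hk).2 (hpos k j)
  rw [Real.mul_rpow h1.le (hpos k j).le, mul_comm]
  congr 1
  have e1 : 1 / (1 - α) = -1 / (α - 1) := by
    rw [← neg_sub α 1, div_neg, neg_div]
  rw [e1]
  congr 1
  have e2 : (fun j => transform α (state A ε α k).x j) = transform α (state A ε α k).x := rfl
  rw [← e2]
  simp only [transform_of_ne hα.ne', e1]
  ring

/-- The index shift: the algorithm computes `x⁽ᵏ⁺¹⁾` from `z⁽ᵏ⁾`, so after `k + 1` passes it holds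
the primal point of the dual vector `Z k = 1 + z⁽ᵏ⁾`. The initial `x` is never used. -/
theorem solution_succ_of_lt_one {Z : ℕ → Fin n → ℝ} (hα : α < 1)
    (h0 : ∀ j, Z 0 j = Real.exp (ε / 4))
    (h : ∀ k j, Z (k + 1) j = Z k j + ε * stepSize A ε α *
      clip (marginal A (beta A ε α) (penalty A ε α) α (primal (betaDual A ε α) α (Z k)) j))
    (k : ℕ) : (∀ j, 0 < (state A ε α (k + 1)).x j) ∧
      solution A ε α (k + 1) = primal (betaDual A ε α) α (Z k) := by
  have hfeas := H.isFeasible_of_lt_one hα h0 h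
  have hprimal : ∀ k, (fun j => (Z k j ^ (-1 / betaDual A ε α)) ^ (1 / (1 - α))) =
      primal (betaDual A ε α) α (Z k) := fun k => by
    funext j
    rw [primal, ← Real.rpow_mul (by linarith [(hfeas k).1 j])]
    congr 1
    rw [div_mul_div_comm, mul_one]
  have hxz : ∀ k, (∀ j, 1 + (state A ε α k).z j = Z k j) ∧
      ∀ j, (state A ε α (k + 1)).x j = Z k j ^ (-1 / betaDual A ε α) := by
    intro k
    have hx : ∀ k, (∀ j, 1 + (state A ε α k).z j = Z k j) →
        ∀ j, (state A ε α (k + 1)).x j = Z k j ^ (-1 / betaDual A ε α) := fun k hz j => by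
      rw [state_succ]
      simp only [step, if_pos hα]
      rw [hz]
    induction k with
    | zero =>
      have hz : ∀ j, 1 + (state A ε α 0).z j = Z 0 j := fun j => by
        rw [h0]; simp [state, init]
      exact ⟨hz, hx 0 hz⟩
    | succ k ih =>
      have hz : ∀ j, 1 + (state A ε α (k + 1)).z j = Z (k + 1) j := fun j => by
        rw [state_succ, h, ← hprimal]
        simp only [step, if_pos hα, ih.1]
        rw [H.truncGrad_eq fun _ j => Real.rpow_pos_of_pos (by linarith [(hfeas k).1 j]) _,
          ← add_assoc, ih.1]
        congr 4
        funext j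
        rw [transform_of_ne hα.ne]
      exact ⟨hz, hx _ hz⟩
  refine ⟨fun j => by
    rw [(hxz k).2]; exact Real.rpow_pos_of_pos (by linarith [(hfeas k).1 j]) _, ?_⟩
  rw [← hprimal]
  funext j
  rw [solution, transform_of_ne hα.ne, (hxz k).2]

end Admissible

/-- The dual sequence of the algorithm for `α < 1`. -/
def dualSeq (A : Matrix (Fin m) (Fin n) ℝ) (ε α : ℝ) : ℕ → Fin n → ℝ
  | 0 => fun _ => Real.exp (ε / 4)
  | k + 1 => fun j => dualSeq A ε α k j + ε * stepSize A ε α *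
      clip (marginal A (beta A ε α) (penalty A ε α) α (primal (betaDual A ε α) α (dualSeq A ε α k)) j)

theorem Admissible.solution_succ_of_eq_one {A : Matrix (Fin m) (Fin n) ℝ} {ε : ℝ}
    (H : Admissible A ε 1) (k : ℕ) (j : Fin n) :
    solution A ε 1 (k + 1) j = solution A ε 1 k j *
      Real.exp (-(beta A ε 1 / (4 * (1 + beta A ε 1)) *
        clip (marginal A (beta A ε 1) (penalty A ε 1) 1 (solution A ε 1 k) j))) := by
  simp only [solution, transform_one]
  rw [state_succ]
  simp only [step, lt_irrefl, if_false, if_true]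
  rw [H.truncGrad_eq fun h => absurd rfl h, ← Real.exp_add, ← sub_eq_add_neg]

/-! ### Objective and optimal solutions -/

theorem utility_eq {α x : ℝ} (h : ¬(1 ≤ α ∧ x = 0)) : utility α x = ((fair α x : ℝ) : EReal) := by
  unfold utility fair
  rw [if_neg h]
  split_ifs <;> rfl

theorem coe_sum_ereal {ι : Type*} (s : Finset ι) (f : ι → ℝ) :
    ∑ i ∈ s, (f i : EReal) = ((∑ i ∈ s, f i : ℝ) : EReal) := by
  classical
  induction s using Finset.induction_on with
  | empty => simp
  | insert a s ha ih => rw [Finset.sum_insert ha, Finset.sum_insert ha, ih, EReal.coe_add]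

theorem objective_eq {α : ℝ} {x : Fin n → ℝ} (h : 1 ≤ α → ∀ j, x j ≠ 0) :
    objective α x = ((∑ j, fair α (x j) : ℝ) : EReal) := by
  rw [objective, ← coe_sum_ereal]
  exact Finset.sum_congr rfl fun j _ => utility_eq fun hj => h hj.1 j hj.2

theorem objective_eq_bot {α : ℝ} {x : Fin n → ℝ} (hα : 1 ≤ α) {j : Fin n} (h : x j = 0) :
    objective α x = ⊥ := by
  rw [objective, ← Finset.add_sum_erase _ _ (Finset.mem_univ j), utility, if_pos ⟨hα, h⟩,
    EReal.bot_add]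

theorem exists_fair_le {α : ℝ} (hα : 1 ≤ α) (B : ℝ) : ∃ δ, 0 < δ ∧ fair α δ ≤ B := by
  rcases hα.eq_or_lt with rfl | h
  · exact ⟨Real.exp B, Real.exp_pos B, by rw [fair_one, Real.log_exp]⟩
  · have h1 : 0 < α - 1 := by linarith
    have h0 : 0 < (α - 1) * (|B| + 1) := by positivity
    refine ⟨((α - 1) * (|B| + 1)) ^ (1 / (1 - α)), Real.rpow_pos_of_pos h0 _, ?_⟩
    have h2 : 1 - α ≠ 0 := by linarith
    rw [fair_of_ne h.ne', ← Real.rpow_mul h0.le, one_div_mul_cancel h2, Real.rpow_one]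
    have : (α - 1) * (|B| + 1) / (1 - α) = -(|B| + 1) := by field_simp; ring
    rw [this]
    linarith [neg_abs_le B]

theorem fair_mono {α x y : ℝ} (hα : 1 ≤ α) (hx : 0 < x) (hxy : x ≤ y) : fair α x ≤ fair α y := by
  rcases hα.eq_or_lt with rfl | h
  · rw [fair_one, fair_one]; exact Real.log_le_log hx hxy
  · rw [fair_of_ne h.ne', fair_of_ne h.ne']
    exact div_le_div_of_nonpos_of_le (by linarith)
      (Real.rpow_le_rpow_of_nonpos hx hxy (by linarith))

theorem fair_nonpos {α x : ℝ} (hα : 1 ≤ α) (hx : 0 < x) (hx1 : x ≤ 1) : fair α x ≤ 0 := by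
  refine (fair_mono hα hx hx1).trans ?_
  rcases hα.eq_or_lt with rfl | h
  · simp [fair_one]
  · rw [fair_of_ne h.ne', Real.one_rpow]
    exact div_nonpos_of_nonneg_of_nonpos zero_le_one (by linarith)

theorem isCompact_feasible {A : Matrix (Fin m) (Fin n) ℝ} (hA : IsScaled A) {δ : ℝ} (hδ : 0 ≤ δ) :
    IsCompact {y : Fin n → ℝ | IsFeasible A y ∧ ∀ j, δ ≤ y j} := by
  have hsub : {y : Fin n → ℝ | IsFeasible A y ∧ ∀ j, δ ≤ y j} =
      Set.Icc (fun _ => δ) (fun _ => 1) ∩ {y | ∀ i, A.mulVec y i ≤ 1} := by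
    ext y
    constructor
    · rintro ⟨h1, h2⟩
      exact ⟨⟨h2, fun j => h1.le_one hA j⟩, h1.1⟩
    · rintro ⟨⟨h1, _⟩, h2⟩
      exact ⟨⟨h2, fun j => hδ.trans (h1 j)⟩, h1⟩
  rw [hsub]
  refine isCompact_Icc.inter_right ?_
  simp only [Set.ofPred_forall, mulVec_eq_sum]
  exact isClosed_iInter fun i => isClosed_le (by fun_prop) continuous_const

/-- Compactness; the bound `δ` keeps away from the boundary, where the utility is discontinuous for
`α ≥ 1`. -/
theorem exists_isMaxOn_fair {A : Matrix (Fin m) (Fin n) ℝ} (hA : IsScaled A) {α δ : ℝ}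
    (hδ : 0 ≤ δ) (h : α < 1 ∨ 0 < δ) (hne : ∃ y, IsFeasible A y ∧ ∀ j, δ ≤ y j) :
    ∃ v, (IsFeasible A v ∧ ∀ j, δ ≤ v j) ∧
      ∀ u, IsFeasible A u → (∀ j, δ ≤ u j) → ∑ j, fair α (u j) ≤ ∑ j, fair α (v j) := by
  have hcont : ContinuousOn (fun y : Fin n → ℝ => ∑ j, fair α (y j))
      {y : Fin n → ℝ | IsFeasible A y ∧ ∀ j, δ ≤ y j} := by
    refine continuousOn_finsetSum _ fun j _ => ?_
    have hj : ContinuousOn (fun y : Fin n → ℝ => y j)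
      {y : Fin n → ℝ | IsFeasible A y ∧ ∀ j, δ ≤ y j} := (continuous_apply j).continuousOn
    by_cases h1 : α = 1
    · subst h1
      simp only [fair_one]
      exact hj.log fun y hy => by
        have := h.resolve_left (lt_irrefl _)
        linarith [hy.2 j]
    · simp only [fair_of_ne h1]
      refine (hj.rpow_const fun y hy => ?_).div_const _
      rcases h with h | h
      · right; linarith
      · left; linarith [hy.2 j]
  obtain ⟨v, hv, hmax⟩ := (isCompact_feasible hA hδ).exists_isMaxOn hne hcont
  exact ⟨v, hv, fun u hu hu' => hmax ⟨hu, hu'⟩⟩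

theorem exists_isOptimal {A : Matrix (Fin m) (Fin n) ℝ} (hA : IsScaled A) (α : ℝ) :
    ∃ v, IsOptimal A α v := by
  have hnw := hA.one_le_card_mul_width
  have hc : 0 < 1 / (n * width A) := by positivity
  have hcf : IsFeasible A fun _ => 1 / (n * width A) :=
    ⟨hA.mulVec_const_le zero_le_one fun _ => le_rfl, fun _ => hc.le⟩
  rcases lt_or_ge α 1 with hα | hα
  · obtain ⟨v, hv, hmax⟩ := exists_isMaxOn_fair hA le_rfl (Or.inl hα) ⟨_, hcf, fun _ => hc.le⟩
    refine ⟨v, hv.1, fun u hu => ?_⟩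
    rw [objective_eq fun h => absurd h hα.not_ge, objective_eq fun h => absurd h hα.not_ge]
    exact_mod_cast hmax u hu hu.2
  -- A coordinate below `δ₀` alone makes the objective worse than at the uniform point, since the
  -- other utilities are nonpositive on feasible points. The maximum over the truncated compact set
  -- is then global.
  · obtain ⟨δ₀, hδ₀, hB⟩ := exists_fair_le hα (∑ _j : Fin n, fair α (1 / (n * width A)))
    have hδ : 0 < min δ₀ (1 / (n * width A)) := lt_min hδ₀ hc
    obtain ⟨v, hv, hmax⟩ := exists_isMaxOn_fair (α := α) hA hδ.le (Or.inr hδ)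
      ⟨_, hcf, fun _ => min_le_right _ _⟩
    have hvc := hmax _ hcf fun _ => min_le_right _ _
    have hvpos : ∀ j, 0 < v j := fun j => hδ.trans_le (hv.2 j)
    refine ⟨v, hv.1, fun u hu => ?_⟩
    by_cases hu0 : ∃ j, u j = 0
    · obtain ⟨j, hj⟩ := hu0
      rw [objective_eq_bot hα hj]
      exact bot_le
    push Not at hu0
    have hupos : ∀ j, 0 < u j := fun j => lt_of_le_of_ne (hu.2 j) (hu0 j).symm
    rw [objective_eq fun _ => hu0, objective_eq fun _ j => (hvpos j).ne', EReal.coe_le_coe_iff]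
    by_cases hδu : ∀ j, min δ₀ (1 / (n * width A)) ≤ u j
    · exact hmax u hu hδu
    push Not at hδu
    obtain ⟨j, hj⟩ := hδu
    refine le_trans ?_ hvc
    refine le_trans ?_ hB
    rw [← Finset.add_sum_erase _ _ (Finset.mem_univ j)]
    have h1 : fair α (u j) ≤ fair α δ₀ := fair_mono hα (hupos j) (hj.le.trans (min_le_left _ _))
    have h2 : ∑ k ∈ Finset.univ.erase j, fair α (u k) ≤ 0 :=
      Finset.sum_nonpos fun k _ => fair_nonpos hα (hupos k) (hu.le_one hA k)
    linarith

theorem IsOptimal.pos {A : Matrix (Fin m) (Fin n) ℝ} (hA : IsScaled A) {α : ℝ} (hα : 1 ≤ α)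
    {v : Fin n → ℝ} (hv : IsOptimal A α v) (j : Fin n) : 0 < v j := by
  refine lt_of_le_of_ne (hv.1.2 j) fun h => ?_
  have hnw := hA.one_le_card_mul_width
  have hc : 0 < 1 / (n * width A) := by positivity
  have := hv.2 (fun _ => 1 / (n * width A))
    ⟨hA.mulVec_const_le zero_le_one fun _ => le_rfl, fun _ => hc.le⟩
  rw [objective_eq_bot hα h.symm, objective_eq fun _ _ => hc.ne', le_bot_iff] at this
  exact EReal.coe_ne_bot _ this

/-! ### Work per iteration -/

namespace Timed
variable {τ υ : Type}

theorem val_bind (a : Timed τ) (f : τ → Timed υ) : (a >>= f).val = (f a.val).val := rfl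
theorem ops_bind (a : Timed τ) (f : τ → Timed υ) : (a >>= f).ops = a.ops + (f a.val).ops := rfl
theorem val_pure (a : τ) : (pure a : Timed τ).val = a := rfl
theorem ops_pure (a : τ) : (pure a : Timed τ).ops = 0 := rfl

theorem val_ite (p : Prop) [Decidable p] (a b : Timed τ) :
    (if p then a else b).val = if p then a.val else b.val := by split_ifs <;> rfl

theorem ops_ite (p : Prop) [Decidable p] (a b : Timed τ) :
    (if p then a else b).ops = if p then a.ops else b.ops := by split_ifs <;> rfl

end Timed

theorem sum_rowSupport (A : Matrix (Fin m) (Fin n) ℝ) (y : Fin n → ℝ) (i : Fin m) :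
    ∑ j ∈ rowSupport A i, A i j * y j = A.mulVec y i := by
  rw [mulVec_eq_sum, rowSupport, Finset.sum_filter]
  refine Finset.sum_congr rfl fun j _ => ?_
  split_ifs with h
  · rfl
  · rw [not_not.1 h, zero_mul]

theorem sum_colSupport (A : Matrix (Fin m) (Fin n) ℝ) (y : Fin m → ℝ) (j : Fin n) :
    ∑ i ∈ colSupport A j, A i j * y i = ∑ i, A i j * y i := by
  rw [colSupport, Finset.sum_filter]
  refine Finset.sum_congr rfl fun i _ => ?_
  split_ifs with h
  · rfl
  · rw [not_not.1 h, zero_mul]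

theorem mem_nonzeroRows {A : Matrix (Fin m) (Fin n) ℝ} {i : Fin m} {j : Fin n} (h : A i j ≠ 0) :
    i ∈ nonzeroRows A :=
  Finset.mem_filter.2 ⟨Finset.mem_univ _, j, Finset.mem_filter.2 ⟨Finset.mem_univ _, h⟩⟩

theorem truncGradProgram_val {A : Matrix (Fin m) (Fin n) ℝ} {ε α : ℝ} (H : Admissible A ε α)
    {x : Fin n → ℝ} (hx : α ≠ 1 → ∀ j, 0 < x j) :
    (truncGradProgram A ε α x).val = truncGrad A ε α x := by
  funext j
  rw [H.truncGrad_eq hx]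
  have hv : (fun j => if α = 1 then Real.exp (x j) else x j ^ (1 / (1 - α))) = transform α x := rfl
  have hprice : ∑ i ∈ colSupport A j, A i j * (if i ∈ nonzeroRows A then penalty A ε α *
      (∑ k ∈ rowSupport A i, A i k * transform α x k) ^ (1 / beta A ε α) else 0) =
      price A (beta A ε α) (penalty A ε α) (transform α x) j := by
    rw [price, ← sum_colSupport]
    refine Finset.sum_congr rfl fun i hi => ?_
    rw [if_pos (mem_nonzeroRows (Finset.mem_filter.1 hi).2), sum_rowSupport]
  have hw : (if α = 1 then Real.exp (x j) else x j ^ (α / (1 - α))) = transform α x j ^ α := by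
    split_ifs with h
    · subst h; rw [transform_one, Real.rpow_one]
    · rw [transform_of_ne h, ← Real.rpow_mul (hx h j).le]; ring_nf
  rw [← truncate_eq_clip (marginal_nonneg H.scaled.nonneg H.penalty_pos.le
    (fun j => (transform_pos hx j).le) j), marginal, ← hprice, ← hw]
  simp only [truncGradProgram, Timed.val_bind, Timed.arrayOver, Timed.sumOver, Timed.mul, Timed.pow,
    Timed.exp, Timed.sub, Timed.le, Timed.val_ite, Finset.mem_univ, if_true, hv, Timed.val_pure,
    Bool.and_eq_true, decide_eq_true_eq]
  by_cases h : α = 1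
  · simp only [if_pos h]
  · simp only [if_neg h]

theorem sum_card_colSupport (A : Matrix (Fin m) (Fin n) ℝ) :
    ∑ j, (colSupport A j).card = nnz A := by
  simp only [nnz, colSupport, Finset.card_filter]
  rw [Fintype.sum_prod_type, Finset.sum_comm]

theorem sum_card_rowSupport (A : Matrix (Fin m) (Fin n) ℝ) :
    ∑ i, (rowSupport A i).card = nnz A := by
  simp only [nnz, rowSupport, Finset.card_filter]
  rw [Fintype.sum_prod_type]

theorem card_nonzeroRows_le (A : Matrix (Fin m) (Fin n) ℝ) : (nonzeroRows A).card ≤ nnz A := by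
  rw [← sum_card_rowSupport, nonzeroRows, Finset.card_filter]
  refine Finset.sum_le_sum fun i _ => ?_
  split_ifs with h
  · exact Finset.card_pos.2 h
  · exact Nat.zero_le _

/-- Absorbs the work linear in `n`; it rests on the absence of zero columns. -/
theorem IsScaled.cols_le_nnz {A : Matrix (Fin m) (Fin n) ℝ} (hA : IsScaled A) : n ≤ nnz A := by
  rw [← sum_card_colSupport]
  calc n = ∑ _j : Fin n, 1 := by simp
    _ ≤ _ := Finset.sum_le_sum fun j _ => by
      obtain ⟨i, hi⟩ := hA.column_ne_zero j
      exact Finset.card_pos.2 ⟨i, Finset.mem_filter.2 ⟨Finset.mem_univ _, hi⟩⟩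

theorem truncGradProgram_ops {A : Matrix (Fin m) (Fin n) ℝ} (hA : IsScaled A) (ε α : ℝ)
    (x : Fin n → ℝ) : (truncGradProgram A ε α x).ops ≤ 15 * nnz A := by
  have h1 : (truncGradProgram A ε α x).ops = n * 2 +
      (∑ i ∈ nonzeroRows A, ((rowSupport A i).card * 2 + 3) +
        ∑ j : Fin n, ((colSupport A j).card * 2 + 6)) := by
    simp only [truncGradProgram, Timed.ops_bind, Timed.arrayOver, Timed.sumOver, Timed.mul,
      Timed.pow, Timed.exp, Timed.sub, Timed.le, Timed.ops_ite, Timed.ops_pure, ite_self,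
      Finset.sum_const, smul_eq_mul, Finset.card_univ, Fintype.card_fin]
  have h2 : ∑ i ∈ nonzeroRows A, ((rowSupport A i).card * 2 + 3) ≤ nnz A * 2 + nnz A * 3 := by
    rw [Finset.sum_add_distrib, Finset.sum_const, smul_eq_mul, ← Finset.sum_mul]
    refine Nat.add_le_add (Nat.mul_le_mul_right _ ?_) (Nat.mul_le_mul_right _ (card_nonzeroRows_le A))
    rw [← sum_card_rowSupport]
    exact Finset.sum_le_univ_sum_of_nonneg fun _ => Nat.zero_le _
  have h3 : ∑ j : Fin n, ((colSupport A j).card * 2 + 6) = nnz A * 2 + n * 6 := by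
    rw [Finset.sum_add_distrib, Finset.sum_const, smul_eq_mul, ← Finset.sum_mul,
      sum_card_colSupport, Finset.card_univ, Fintype.card_fin]
  have := hA.cols_le_nnz
  omega

theorem stepProgram_ops {A : Matrix (Fin m) (Fin n) ℝ} (hA : IsScaled A) (ε α : ℝ) (s : State n) :
    (stepProgram A ε α s).ops ≤ 21 * nnz A := by
  have hn := hA.cols_le_nnz
  unfold stepProgram
  split_ifs with h1 h2
  · simp only [Timed.ops_bind, Timed.ops_pure, Timed.arrayOver, Timed.add, Timed.pow, Timed.mul,
      Timed.val_bind, Finset.sum_const, smul_eq_mul, Finset.card_univ, Fintype.card_fin,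
      Finset.mem_univ, if_true]
    have := truncGradProgram_ops hA ε α fun j => (1 + s.z j) ^ (-1 / betaDual A ε α)
    omega
  · simp only [Timed.ops_bind, Timed.ops_pure, Timed.arrayOver, Timed.sub, Timed.mul,
      Finset.sum_const, smul_eq_mul, Finset.card_univ, Fintype.card_fin]
    have := truncGradProgram_ops hA ε α s.x
    omega
  · simp only [Timed.ops_bind, Timed.ops_pure, Timed.arrayOver, Timed.sub, Timed.mul,
      Finset.sum_const, smul_eq_mul, Finset.card_univ, Fintype.card_fin]
    have := truncGradProgram_ops hA ε α s.x
    omega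

/-- Only states along the run are considered: for `α ≠ 1` the gradient program agrees with the
derivative at points with positive coordinates. -/
theorem stepProgram_val {A : Matrix (Fin m) (Fin n) ℝ} {ε α : ℝ} (H : Admissible A ε α) (k : ℕ) :
    (stepProgram A ε α (state A ε α k)).val = state A ε α (k + 1) := by
  rcases lt_or_ge α 1 with h | h
  · have hpos := (H.solution_succ_of_lt_one (Z := dualSeq A ε α) h (fun _ => rfl)
      (fun _ _ => rfl) k).1
    rw [state_succ] at hpos ⊢
    simp only [step, if_pos h] at hpos
    simp only [stepProgram, step, if_pos h, Timed.val_bind, Timed.val_pure, Timed.arrayOver,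
      Timed.add, Timed.pow, Timed.mul, Finset.mem_univ, if_true]
    rw [truncGradProgram_val H fun _ => hpos]
  rw [state_succ]
  rcases h.eq_or_lt with rfl | h
  · simp only [stepProgram, step, lt_irrefl, if_false, if_true, Timed.val_bind, Timed.val_pure,
      Timed.arrayOver, Timed.sub, Timed.mul, Finset.mem_univ]
    rw [truncGradProgram_val H fun h => absurd rfl h]
  · simp only [stepProgram, step, if_neg h.not_gt, if_neg h.ne', Timed.val_bind, Timed.val_pure,
      Timed.arrayOver, Timed.sub, Timed.mul, Finset.mem_univ, if_true]
    rw [truncGradProgram_val H fun _ => H.state_pos_of_one_lt h k]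
    ext j
    · simp only
      ring
    · rfl

/-! ### Approximate solutions -/

theorem mul_sum_fair {α : ℝ} (hα : α ≠ 1) (v : Fin n → ℝ) :
    (1 - α) * ∑ j, fair α (v j) = ∑ j, v j ^ (1 - α) := by
  have : 1 - α ≠ 0 := fun h => hα (by linarith)
  rw [Finset.mul_sum]
  refine Finset.sum_congr rfl fun j _ => ?_
  rw [fair_of_ne hα]
  field_simp

/-- Passes from real sums to the extended objective: the point is positive, and so is every optimum
when `α ≥ 1`, so no value is `-∞`. -/
theorem isApproxSolution_of_le {A : Matrix (Fin m) (Fin n) ℝ} (hA : IsScaled A) {ε α c : ℝ}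
    {x : Fin n → ℝ} (hx : IsFeasible A x) (hpos : ∀ j, 0 < x j)
    (h : ∀ v, IsOptimal A α v → ∑ j, fair α (v j) - ∑ j, fair α (x j) ≤
      if α = 1 then c * (ε * n) else c * (ε * ∑ j, v j ^ (1 - α))) :
    IsApproxSolution A ε α c x := by
  refine ⟨hx, fun v hv => ?_⟩
  have hvv := h v hv
  rw [objective_eq fun _ j => (hpos j).ne',
    objective_eq fun hα j => (hv.pos hA hα j).ne', ← EReal.coe_sub]
  split_ifs at hvv ⊢ with hα
  · exact EReal.coe_le_coe_iff.2 hvv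
  · rw [← EReal.coe_mul, mul_assoc, mul_assoc, mul_sum_fair hα]
    exact EReal.coe_le_coe_iff.2 hvv

theorem IsFeasible.sum_rpow_nonneg {A : Matrix (Fin m) (Fin n) ℝ} {v : Fin n → ℝ}
    (hv : IsFeasible A v) (p : ℝ) : 0 ≤ ∑ j, v j ^ p :=
  Finset.sum_nonneg fun j _ => Real.rpow_nonneg (hv.2 j) _

namespace Admissible
variable {A : Matrix (Fin m) (Fin n) ℝ} {ε α : ℝ} (H : Admissible A ε α)
include H

theorem isApproxSolution_solution_of_one_lt (hα : 1 < α) {c : ℝ} (hc : 12 ≤ c) {k : ℕ}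
    (hk : (α - 1) * Real.log (2 * (n * width A)) + Real.log (1 / (ε * (α - 1))) ≤
      beta A ε α * min (α - 1) 1 * k / 250) :
    IsApproxSolution A ε α c (solution A ε α k) := by
  have heps := H.eps_pos
  obtain ⟨hpos, hf⟩ := H.isFeasible_of_one_lt hα (H.solution_zero_of_one_le hα.le)
    (H.solution_succ_of_one_lt hα) k
  refine isApproxSolution_of_le H.scaled hf hpos fun v hv => ?_
  rw [if_neg hα.ne']
  have h1 := H.merit_le_of_one_lt hα (H.solution_zero_of_one_le hα.le)
    (H.solution_succ_of_one_lt hα) (hv.pos H.scaled hα.le) hv.1 hk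
  have h2 := congestion_nonneg H.beta_pos H.scaled.nonneg H.penalty_pos.le fun j => (hpos j).le
  have h3 := mul_le_mul_of_nonneg_right hc
    (mul_nonneg heps.le (hv.1.sum_rpow_nonneg (1 - α)))
  rw [merit] at h1
  linarith

theorem two_mul_le_div {μ : ℝ} (hμ : 0 < μ) (hμ1 : μ ≤ 1) :
    2 * (n * width A) ≤ n * width A / (ε * μ) := by
  have h1 := H.eps_pos
  have h2 := H.eps_le
  have h3 := H.scaled.one_le_card_mul_width
  rw [le_div_iff₀ (by positivity)]
  have : ε * μ ≤ 1 / 2 := by nlinarith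
  nlinarith

theorem one_div_le_div {μ : ℝ} (hμ : 0 < μ) (hμα : μ ≤ α - 1) :
    1 / (ε * (α - 1)) ≤ n * width A / (ε * μ) := by
  have h1 := H.eps_pos
  have h3 := H.scaled.one_le_card_mul_width
  exact div_le_div₀ (by linarith) h3 (by positivity) (mul_le_mul_of_nonneg_left hμα h1.le)

theorem log_two_le_log_div {μ : ℝ} (hμ : 0 < μ) (hμ1 : μ ≤ 1) :
    1 / 2 ≤ Real.log (n * width A / (ε * μ)) := by
  have h1 := H.two_mul_le_div hμ hμ1
  have h3 := H.scaled.one_le_card_mul_width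
  have := Real.log_le_log (by norm_num) (show 2 ≤ n * width A / (ε * μ) by linarith)
  linarith [Real.log_two_gt_d9]

theorem log_scale_eq :
    Real.log (scale A ε) = 2 * Real.log 2 + Real.log (m * n * width A / ε) := by
  have h := H.eight_le_scale
  have e : scale A ε = 2 ^ 2 * (m * n * width A / ε) := by rw [scale]; ring
  have h0 : m * n * width A / ε ≠ 0 := fun h' => by rw [e, h'] at h; norm_num at h
  rw [e, Real.log_mul (by norm_num) h0, Real.log_pow]
  norm_num

theorem log_two_le_log : Real.log 2 ≤ Real.log (m * n * width A / ε) := by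
  have h := H.eight_le_scale
  have e : scale A ε = 4 * (m * n * width A / ε) := by rw [scale]; ring
  exact Real.log_le_log (by norm_num) (by linarith)

theorem half_le_log : 1 / 2 ≤ Real.log (m * n * width A / ε) := by
  linarith [H.log_two_le_log, Real.log_two_gt_d9]

theorem log_scale_le : Real.log (scale A ε) ≤ 3 * Real.log (m * n * width A / ε) := by
  linarith [H.log_scale_eq, H.log_two_le_log]

theorem log_two_mul_scale_le :
    Real.log (2 * scale A ε) ≤ 4 * Real.log (m * n * width A / ε) := by
  rw [Real.log_mul (by norm_num) H.scale_pos.ne']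
  linarith [H.log_scale_le, H.log_two_le_log]

theorem eps_div_beta_le :
    ε / beta A ε α ≤ 12 * ((1 + α) * Real.log (m * n * width A / ε)) := by
  rw [H.eps_div_beta]
  have := mul_le_mul_of_nonneg_left H.log_scale_le H.one_add_alpha_pos.le
  linarith

theorem one_div_beta_le :
    1 / beta A ε α ≤ 12 * ((1 + α) * Real.log (m * n * width A / ε)) / ε := by
  have hb := H.beta_pos
  rw [le_div_iff₀ H.eps_pos]
  calc 1 / beta A ε α * ε = ε / beta A ε α := by ring
    _ ≤ _ := H.eps_div_beta_le

/-- The number of iterations after which all further iterates are accurate, for `α > 1`. -/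
theorem isApproxSolution_of_max_le (hα : 1 < α) {c : ℝ} (hc : 18000 ≤ c) {k : ℕ}
    (hk : c * max
      (α ^ 3 * Real.log (n * width A / ε) * Real.log (m * n * width A / ε) / ε)
      (Real.log (1 / (ε * (α - 1))) * Real.log (m * n * width A / ε) / (ε * (α - 1))) ≤ k) :
    IsApproxSolution A ε α c (solution A ε α k) := by
  refine H.isApproxSolution_solution_of_one_lt hα (by linarith) ?_
  have heps := H.eps_pos
  have hb := H.beta_pos
  have hℓ := H.half_le_log
  have hinv := H.eps_div_beta_le
  have hα1 : 0 < α - 1 := by linarith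
  have hnw := H.scaled.one_le_card_mul_width
  have hP : Real.log (2 * (n * width A)) ≤ Real.log (n * width A / ε) := by
    have := H.two_mul_le_div one_pos le_rfl
    rw [mul_one] at this
    exact Real.log_le_log (by linarith) this
  have hP0 : 0 ≤ Real.log (n * width A / ε) := by
    have := H.log_two_le_log_div one_pos le_rfl
    rw [mul_one] at this
    linarith
  have hR0 : 0 ≤ Real.log (1 / (ε * (α - 1))) := by
    refine Real.log_nonneg ?_
    rw [le_div_iff₀ (by positivity)]
    linarith [H.eps_mul_sub_one_le]
  -- For `α ≥ 2` the second logarithm is dominated by the first, so the first entry of the maximum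
  -- suffices.
  have hRP : 1 ≤ α - 1 → Real.log (1 / (ε * (α - 1))) ≤ Real.log (n * width A / ε) := fun h => by
    have := H.one_div_le_div one_pos h
    rw [mul_one] at this
    exact Real.log_le_log (by positivity) this
  set ℓ := Real.log (m * n * width A / ε)
  set P := Real.log (n * width A / ε)
  set R := Real.log (1 / (ε * (α - 1)))
  set Q := Real.log (2 * (n * width A))
  have hc0 : 0 ≤ c := by linarith
  have hk1 : c * (α ^ 3 * P * ℓ) ≤ k * ε := by
    have := (mul_le_mul_of_nonneg_left (le_max_left _ _) hc0).trans hk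
    rwa [← mul_div_assoc, div_le_iff₀ heps] at this
  have hk2 : c * (R * ℓ) ≤ k * (ε * (α - 1)) := by
    have := (mul_le_mul_of_nonneg_left (le_max_right _ _) hc0).trans hk
    rwa [← mul_div_assoc, div_le_iff₀ (by positivity)] at this
  have hℓ0 : 0 ≤ ℓ := by linarith
  have hPℓ : 0 ≤ P * ℓ := mul_nonneg hP0 hℓ0
  have hα3 : 1 ≤ α ^ 3 := one_le_pow₀ hα.le
  rw [div_le_iff₀ hb] at hinv
  have key : (((α - 1) * P + R) * 250) * (12 * ((1 + α) * ℓ)) ≤ k * ε * min (α - 1) 1 := by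
    rcases le_total 1 (α - 1) with h | h
    · rw [min_eq_right h, mul_one]
      have h1 : (α - 1) * P + R ≤ α * P := by linarith [hRP h]
      calc (((α - 1) * P + R) * 250) * (12 * ((1 + α) * ℓ))
          ≤ ((α * P) * 250) * (12 * ((α + α) * ℓ)) := by gcongr
        _ = 6000 * α ^ 2 * (P * ℓ) := by ring
        _ ≤ c * α ^ 3 * (P * ℓ) := by
            refine mul_le_mul_of_nonneg_right ?_ hPℓ
            exact mul_le_mul (by linarith) (pow_le_pow_right₀ hα.le (by norm_num)) (by positivity)
              hc0
        _ = c * (α ^ 3 * P * ℓ) := by ring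
        _ ≤ _ := hk1
    · rw [min_eq_left h]
      have h1 : c * (P * ℓ) ≤ k * ε := by
        refine le_trans ?_ hk1
        have := mul_le_mul_of_nonneg_left (mul_le_mul_of_nonneg_right hα3 hPℓ) hc0
        calc c * (P * ℓ) = c * (1 * (P * ℓ)) := by ring
          _ ≤ c * (α ^ 3 * (P * ℓ)) := this
          _ = _ := by ring
      have h2 := mul_le_mul_of_nonneg_right h1 hα1.le
      -- For `α ≤ 2` both entries of the maximum are added, which doubles the constant `250 * 12 * 3
      -- = 9000`.
      have h3 : 18000 * (((α - 1) * P + R) * ℓ) ≤ c * (((α - 1) * P + R) * ℓ) :=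
        mul_le_mul_of_nonneg_right hc (by positivity)
      calc (((α - 1) * P + R) * 250) * (12 * ((1 + α) * ℓ))
          ≤ (((α - 1) * P + R) * 250) * (12 * (3 * ℓ)) := by gcongr; linarith
        _ ≤ _ := by nlinarith
  rw [le_div_iff₀ (by norm_num)]
  have hQ : (α - 1) * Q + R ≤ (α - 1) * P + R := by
    linarith [mul_le_mul_of_nonneg_left hP hα1.le]
  have hS : 0 ≤ ((α - 1) * P + R) * 250 := by positivity
  have h4 := mul_le_mul_of_nonneg_left hinv hS
  have h5 := mul_le_mul_of_nonneg_right key hb.le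
  refine le_of_mul_le_mul_right ?_ heps
  calc ((α - 1) * Q + R) * 250 * ε ≤ ((α - 1) * P + R) * 250 * ε := by gcongr
    _ ≤ k * ε * min (α - 1) 1 * beta A ε α := by linarith
    _ = beta A ε α * min (α - 1) 1 * k * ε := by ring

/-! ### The returned point -/

theorem isApproxSolution_output_of_one_lt (hα : 1 < α) {c : ℝ} (hc : 12 ≤ c) :
    IsApproxSolution A ε α c (output A ε α) := by
  refine H.isApproxSolution_solution_of_one_lt hα hc ?_
  have heps := H.eps_pos
  have hb := H.beta_pos
  have hα1 : 0 < α - 1 := by linarith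
  have hnw := H.scaled.one_le_card_mul_width
  have hμ : 0 < min (α - 1) 1 := lt_min hα1 one_pos
  have hL := H.log_two_le_log_div hμ (min_le_right _ _)
  have h1 := Real.log_le_log (by linarith) (H.two_mul_le_div hμ (min_le_right _ _))
  have h2 := Real.log_le_log (by positivity) (H.one_div_le_div hμ (min_le_left _ _))
  have hK : 800 * ((1 + α) ^ 2 * Real.log (n * width A / (ε * min (α - 1) 1))) /
      (beta A ε α * min (α - 1) 1) ≤ (iterations A ε α : ℝ) := by
    rw [iterations, if_neg hα.not_gt, if_neg hα.ne']
    exact Nat.le_ceil _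
  rw [div_le_iff₀ (by positivity)] at hK
  set L := Real.log (n * width A / (ε * min (α - 1) 1))
  have h3 := mul_le_mul_of_nonneg_left h1 hα1.le
  -- Both logarithms in the requirement are at most `L`, so `(α - 1) L + L = α L` is all that is
  -- needed.
  have h4 : α * L ≤ (1 + α) ^ 2 * L :=
    mul_le_mul_of_nonneg_right (by nlinarith) (by linarith)
  have h5 : 0 ≤ α * L := mul_nonneg H.alpha_nonneg (by linarith)
  linarith

theorem isApproxSolution_output_of_lt_one (hα : α < 1) {c : ℝ} (hc : 25 ≤ c) :
    IsApproxSolution A ε α c (output A ε α) := by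
  have heps := H.eps_pos
  have hS : 0 < 2 / ((1 - α) * stepSize A ε α * ε) := by
    have := (H.stepSize_mul_le hα).1
    have h1 : 0 < 1 - α := by linarith
    have : (1 - α) * stepSize A ε α * ε = (1 - α) * (ε * stepSize A ε α) := by ring
    rw [this]
    positivity
  -- Writing `K = k + 1` matches the index shift; the two sides of the ceiling bound `k` from both
  -- directions.
  obtain ⟨k, hk⟩ : ∃ k, iterations A ε α = k + 1 := by
    refine Nat.exists_eq_succ_of_ne_zero ?_
    rw [iterations, if_pos hα]
    exact (Nat.ceil_pos.2 hS).ne'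
  have hk1 : 2 / ((1 - α) * stepSize A ε α * ε) ≤ k + 1 := by
    have := Nat.le_ceil (2 / ((1 - α) * stepSize A ε α * ε))
    rw [iterations, if_pos hα] at hk
    rw [hk] at this
    exact_mod_cast this
  have hk2 : k ≤ 2 / ((1 - α) * stepSize A ε α * ε) := by
    have := Nat.ceil_lt_add_one hS.le
    rw [iterations, if_pos hα] at hk
    rw [hk] at this
    push_cast at this
    linarith
  have h0 : ∀ j, dualSeq A ε α 0 j = Real.exp (ε / 4) := fun _ => rfl
  have hsucc : ∀ k j, dualSeq A ε α (k + 1) j = dualSeq A ε α k j + ε * stepSize A ε α *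
      clip (marginal A (beta A ε α) (penalty A ε α) α
        (primal (betaDual A ε α) α (dualSeq A ε α k)) j) := fun _ _ => rfl
  obtain ⟨hZ, hf⟩ := H.isFeasible_of_lt_one hα h0 hsucc k
  rw [output, hk, (H.solution_succ_of_lt_one hα h0 hsucc k).2]
  refine isApproxSolution_of_le H.scaled hf
    (fun j => Real.rpow_pos_of_pos (by linarith [hZ j]) _) fun v hv => ?_
  rw [if_neg hα.ne]
  refine le_trans ?_ (mul_le_mul_of_nonneg_right hc
    (mul_nonneg heps.le (hv.1.sum_rpow_nonneg (1 - α))))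
  rcases le_or_gt 2 (n * width A) with hnw | hnw
  · refine H.sum_fair_le_of_lt_one hα hnw h0 hsucc hv.1 (fun w hw => ?_) hk1 hk2
    have := hv.2 w hw
    rw [objective_eq fun h => absurd h hα.not_ge, objective_eq fun h => absurd h hα.not_ge,
      EReal.coe_le_coe_iff] at this
    rw [← mul_sum_fair hα.ne, ← mul_sum_fair hα.ne]
    exact mul_le_mul_of_nonneg_left this (by linarith)
  · exact H.single_fair_le hα hnw h0 hsucc hv.1 hk1

theorem isApproxSolution_output_of_eq_one (hα : α = 1) {c : ℝ} (hc : 250 ≤ c) :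
    IsApproxSolution A ε α c (output A ε α) := by
  subst hα
  have heps := H.eps_pos
  have hpos : ∀ v, IsOptimal A 1 v → _ := fun v hv =>
    H.sum_fair_le_of_eq_one (H.solution_zero_of_one_le le_rfl) H.solution_succ_of_eq_one
      (hv.pos H.scaled le_rfl) hv.1 (iterations A ε 1)
  -- Feasibility of the iterates was proved together with the comparison, so some optimum is needed
  -- to extract it.
  obtain ⟨v₀, hv₀⟩ := exists_isOptimal H.scaled 1
  refine isApproxSolution_of_le H.scaled (hpos v₀ hv₀).2.1 (hpos v₀ hv₀).1 fun v hv => ?_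
  rw [if_pos rfl]
  refine ((hpos v hv).2.2 ?_).trans (mul_le_mul_of_nonneg_right hc (by positivity))
  have e : 2 * scale A ε = 8 * width A * m * n / ε := by rw [scale]; ring
  rw [iterations, if_neg (lt_irrefl _), if_pos rfl, e]
  exact Nat.le_ceil _

theorem isApproxSolution_output {c : ℝ} (hc : 250 ≤ c) :
    IsApproxSolution A ε α c (output A ε α) := by
  rcases lt_trichotomy α 1 with h | h | h
  · exact H.isApproxSolution_output_of_lt_one h (by linarith)
  · exact H.isApproxSolution_output_of_eq_one h hc
  · exact H.isApproxSolution_output_of_one_lt h (by linarith)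

/-! ### The number of iterations -/

theorem iterations_le_of_eq_one (hα : α = 1) :
    (iterations A ε α : ℝ) ≤
      4000 * (Real.log (width A * m * n / ε) ^ 3 / ε ^ 2) := by
  subst hα
  have heps := H.eps_pos
  have heps' := H.eps_le
  have hb := H.beta_pos
  have hℓ := H.half_le_log
  have e1 : width A * m * n / ε = m * n * width A / ε := by ring
  have e2 : 8 * width A * m * n / ε = 2 * scale A ε := by rw [scale]; ring
  have h2 := H.log_two_mul_scale_le
  have h20 : 0 ≤ Real.log (2 * scale A ε) := Real.log_nonneg (by linarith [H.eight_le_scale])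
  have hinv := H.one_div_beta_le
  rw [iterations, if_neg (lt_irrefl _), if_pos rfl, e1, e2]
  set ℓ := Real.log (m * n * width A / ε)
  have hc := (Nat.ceil_lt_add_one (a := 10 * Real.log (2 * scale A ε) ^ 2 / (ε * beta A ε 1))
    (by positivity)).le
  refine hc.trans ?_
  have h3 : 10 * Real.log (2 * scale A ε) ^ 2 / (ε * beta A ε 1) ≤
      3840 * (ℓ ^ 3 / ε ^ 2) := by
    calc 10 * Real.log (2 * scale A ε) ^ 2 / (ε * beta A ε 1)
        = 10 * Real.log (2 * scale A ε) ^ 2 / ε * (1 / beta A ε 1) := by field_simp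
      _ ≤ 10 * (4 * ℓ) ^ 2 / ε * (12 * ((1 + 1) * ℓ) / ε) := by gcongr
      _ = 3840 * (ℓ ^ 3 / ε ^ 2) := by ring
  -- The unit lost to the ceiling is absorbed, since the logarithm is at least `1/2`.
  have h4 : 1 ≤ 160 * (ℓ ^ 3 / ε ^ 2) := by
    have h5 : (1 / 2 : ℝ) ^ 3 ≤ ℓ ^ 3 := pow_le_pow_left₀ (by norm_num) hℓ 3
    rw [← mul_div_assoc, le_div_iff₀ (by positivity)]
    nlinarith
  linarith

theorem iterations_le_of_one_lt (hα : 1 < α) :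
    (iterations A ε α : ℝ) ≤
      80000 * (α ^ 3 * Real.log (n * width A / (ε * min (α - 1) 1)) *
        Real.log (m * n * width A / ε) / (ε * min (α - 1) 1)) := by
  have heps := H.eps_pos
  have heps' := H.eps_le
  have hb := H.beta_pos
  have hℓ := H.half_le_log
  have hα1 : 0 < α - 1 := by linarith
  have hμ : 0 < min (α - 1) 1 := lt_min hα1 one_pos
  have hμ1 : min (α - 1) 1 ≤ 1 := min_le_right _ _
  have hL := H.log_two_le_log_div hμ hμ1
  have hinv := H.one_div_beta_le
  rw [iterations, if_neg hα.not_gt, if_neg hα.ne']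
  set ℓ := Real.log (m * n * width A / ε)
  set μ := min (α - 1) 1
  set L := Real.log (n * width A / (ε * μ))
  have hc := (Nat.ceil_lt_add_one (a := 800 * ((1 + α) ^ 2 * L) / (beta A ε α * μ))
    (by have : 0 ≤ L := by linarith
        positivity)).le
  refine hc.trans ?_
  have h3 : 800 * ((1 + α) ^ 2 * L) / (beta A ε α * μ) ≤
      76800 * (α ^ 3 * L * ℓ / (ε * μ)) := by
    calc 800 * ((1 + α) ^ 2 * L) / (beta A ε α * μ)
        = 800 * ((1 + α) ^ 2 * L) / μ * (1 / beta A ε α) := by field_simp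
      _ ≤ 800 * ((α + α) ^ 2 * L) / μ * (12 * ((α + α) * ℓ) / ε) :=
          mul_le_mul (by gcongr) (hinv.trans (by gcongr)) (by positivity)
            (by have : 0 ≤ L := by linarith
                positivity)
      _ = 76800 * (α ^ 3 * L * ℓ / (ε * μ)) := by field_simp; ring
  have h4 : 1 ≤ 3200 * (α ^ 3 * L * ℓ / (ε * μ)) := by
    have hα3 : 1 ≤ α ^ 3 := one_le_pow₀ hα.le
    have h5 : 1 / 4 ≤ L * ℓ := by nlinarith
    have h6 : ε * μ ≤ 1 := by nlinarith
    have h7 : 1 / 4 ≤ α ^ 3 * (L * ℓ) := by nlinarith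
    rw [← mul_div_assoc, le_div_iff₀ (by positivity)]
    linarith
  linarith

theorem iterations_le_of_lt_one (hα : α < 1) (hnw : 2 ≤ n * width A) :
    (iterations A ε α : ℝ) ≤
      13000 * (Real.log (n * width A) * Real.log (m * n * width A / ε) /
        ((1 - α) ^ 3 * ε ^ 2)) := by
  have heps := H.eps_pos
  have heps' := H.eps_le
  have hb := H.beta_pos
  have hD := H.betaDual_pos hα
  have hα0 := H.alpha_nonneg
  have ha : 0 < 1 - α := by linarith
  have hℓ := H.half_le_log
  have hinv := H.one_div_beta_le
  have hM : 1 / 2 ≤ Real.log (n * width A) := by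
    have := Real.log_le_log (by norm_num) hnw
    linarith [Real.log_two_gt_d9]
  have hlog : Real.log (n * width A / (1 - ε)) ≤ 2 * Real.log (n * width A) := by
    rw [two_mul, ← Real.log_mul (by linarith) (by linarith)]
    refine Real.log_le_log (div_pos (by linarith) (by linarith)) ?_
    rw [div_le_iff₀ (by linarith)]
    nlinarith
  have hDinv : 1 / betaDual A ε α ≤ 8 * Real.log (n * width A) / ((1 - α) * ε) := by
    have h1 := H.betaDual_mul_log
    have h2 := mul_le_mul_of_nonneg_left hlog hD.le
    rw [div_le_div_iff₀ hD (by positivity)]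
    linarith
  have hαb : 1 + α * beta A ε α ≤ 2 := by linarith [H.alpha_mul_beta_le]
  have hαb0 : 0 < 1 + α * beta A ε α := by positivity
  rw [iterations, if_pos hα]
  have e : 2 / ((1 - α) * stepSize A ε α * ε) =
      32 * (1 + α * beta A ε α) / (1 - α) ^ 2 * (1 / beta A ε α) * (1 / betaDual A ε α) := by
    have h1 := H.eps_mul_stepSize
    have h2 : (1 - α) * stepSize A ε α * ε = (1 - α) * (ε * stepSize A ε α) := by ring
    rw [h2, h1]
    field_simp
    ring
  rw [e]
  set ℓ := Real.log (m * n * width A / ε)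
  set M := Real.log (n * width A)
  refine (Nat.ceil_lt_add_one (by positivity)).le.trans ?_
  have h3 : 32 * (1 + α * beta A ε α) / (1 - α) ^ 2 * (1 / beta A ε α) * (1 / betaDual A ε α) ≤
      12288 * (M * ℓ / ((1 - α) ^ 3 * ε ^ 2)) := by
    calc 32 * (1 + α * beta A ε α) / (1 - α) ^ 2 * (1 / beta A ε α) * (1 / betaDual A ε α)
        ≤ 32 * 2 / (1 - α) ^ 2 * (12 * ((1 + 1) * ℓ) / ε) * (8 * M / ((1 - α) * ε)) := by
          refine mul_le_mul (mul_le_mul (by gcongr) (hinv.trans (by gcongr)) (by positivity)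
            (by positivity)) hDinv (by positivity) (by positivity)
      _ = 12288 * (M * ℓ / ((1 - α) ^ 3 * ε ^ 2)) := by field_simp; ring
  have h4 : 1 ≤ 700 * (M * ℓ / ((1 - α) ^ 3 * ε ^ 2)) := by
    have h5 : 1 / 4 ≤ M * ℓ := by nlinarith
    have h6 : (1 - α) ^ 3 ≤ 1 := pow_le_one₀ ha.le (by linarith)
    have h7 : ε ^ 2 ≤ 1 := by nlinarith
    have h8 : (1 - α) ^ 3 * ε ^ 2 ≤ 1 := mul_le_one₀ h6 (by positivity) h7
    rw [← mul_div_assoc, le_div_iff₀ (by positivity)]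
    linarith
  linarith

end Admissible

end FairPacking

end

/-! ### Assembly of the theorem -/

theorem mainTheorem1 :
    ∃ c : ℝ, 0 < c ∧
      ∀ (m n : ℕ) (A : Matrix (Fin m) (Fin n) ℝ) (α ε : ℝ),
        FairPacking.IsScaled A → 0 ≤ α → 0 < ε → ε ≤ 1 / 2 → ε * (10 * |α - 1|) ≤ 1 →
          -- an optimal solution exists, and the returned point is near-optimal
          (∃ xopt, FairPacking.IsOptimal A α xopt) ∧
          FairPacking.IsApproxSolution A ε α c (FairPacking.output A ε α) ∧
          -- the number of iterations
          (α < 1 → 2 ≤ n * FairPacking.width A →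
            (FairPacking.iterations A ε α : ℝ) ≤
              c * (Real.log (n * FairPacking.width A) *
                Real.log (m * n * FairPacking.width A / ε) / ((1 - α) ^ 3 * ε ^ 2))) ∧
          (α = 1 →
            (FairPacking.iterations A ε α : ℝ) ≤
              c * (Real.log (FairPacking.width A * m * n / ε) ^ 3 / ε ^ 2)) ∧
          (1 < α →
            (FairPacking.iterations A ε α : ℝ) ≤
              c * (α ^ 3 * Real.log (n * FairPacking.width A / (ε * min (α - 1) 1)) *
                Real.log (m * n * FairPacking.width A / ε) / (ε * min (α - 1) 1)) ∧
            ∀ k : ℕ,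
              c * max
                (α ^ 3 * Real.log (n * FairPacking.width A / ε) *
                  Real.log (m * n * FairPacking.width A / ε) / ε)
                (Real.log (1 / (ε * (α - 1))) *
                  Real.log (m * n * FairPacking.width A / ε) / (ε * (α - 1))) ≤ k →
              FairPacking.IsApproxSolution A ε α c (FairPacking.solution A ε α k)) ∧
          -- every iteration takes work linear in the number of nonzero entries
          ∀ k : ℕ,
            (FairPacking.stepProgram A ε α (FairPacking.state A ε α k)).val =
              FairPacking.state A ε α (k + 1) ∧
            ((FairPacking.stepProgram A ε α (FairPacking.state A ε α k)).ops : ℝ) ≤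
              c * FairPacking.nnz A := by
  -- The largest constant needed, that of the prescribed number of iterations for `α > 1`. The same
  -- `c` also serves as the accuracy factor and in the threshold on `k`.
  refine ⟨80000, by norm_num, fun m n A α ε hA hα hε hε' hεα => ?_⟩
  have H : FairPacking.Admissible A ε α := ⟨hA, hα, hε, hε', hεα⟩
  have hℓ := H.half_le_log
  refine ⟨FairPacking.exists_isOptimal hA α, H.isApproxSolution_output (by norm_num),
    fun h hnw => (H.iterations_le_of_lt_one h hnw).trans ?_,
    fun h => (H.iterations_le_of_eq_one h).trans ?_,
    fun h => ⟨H.iterations_le_of_one_lt h, fun k hk =>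
      H.isApproxSolution_of_max_le h (by norm_num) hk⟩,
    fun k => ⟨FairPacking.stepProgram_val H k, ?_⟩⟩
  · have h1 : 0 < 1 - α := by linarith
    have h2 := Real.log_nonneg (show 1 ≤ n * FairPacking.width A by linarith)
    exact mul_le_mul_of_nonneg_right (by norm_num) (by positivity)
  · have e : FairPacking.width A * m * n / ε = m * n * FairPacking.width A / ε := by ring
    rw [e]
    exact mul_le_mul_of_nonneg_right (by norm_num) (by positivity)
  · have h1 := FairPacking.stepProgram_ops hA ε α (FairPacking.state A ε α k)
    have h2 : ((FairPacking.stepProgram A ε α (FairPacking.state A ε α k)).ops : ℝ) ≤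
        21 * FairPacking.nnz A := by exact_mod_cast h1
    have h3 : (0 : ℝ) ≤ FairPacking.nnz A := Nat.cast_nonneg _
    linarith
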